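/- Let $\sigma_1=\begin{bmatrix}0&1\\1&0\end{bmatrix}$, $\sigma_2=\begin{bmatrix}0&-i\\i&0\end{bmatrix}$, $\sigma_3=\begin{bmatrix}1&0\\0&-1\end{bmatrix}$, let $Y=\{y_1<\dots<y_n\}\subset\mathbb R$, and let $H^k(\mathbb R\setminus Y;\mathbb C^2)$ be the space of $\Psi\in L^2(\mathbb R;\mathbb C^2)$ whose distributional derivatives on $\mathbb R\setminus Y$ up to order $k$ are in $L^2$. Put $\langle f\rangle_y=\frac12(f(y^-)+f(y^+))$, $[f]_y=f(y^+)-f(y^-)$, $\tau\Psi=(\langle\Psi\rangle_{y_k})_{k}$ and $\rho\Psi=(i\sigma_1[\Psi]_{y_k})_{k}$ in $\mathbb C^{2n}$. For an orthogonal projector $\Pi$ in $\mathbb C^{2n}$ and a symmetric $\Theta:\mathrm{ran}(\Pi)\to\mathrm{ran}(\Pi)$ let $\mathsf D_{\Pi,\Theta}$ be the operator in $L^2(\mathbb R;\mathbb C^2)$ acting as $-i\sigma_1\frac{d}{dx}+\frac12\sigma_3$ on $\mathbb R\setminus Y$ with domain $$\{\Psi\in H^1(\mathbb R\setminus Y;\mathbb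 C^2):\ \rho\Psi\in\mathrm{ran}(\Pi),\ \Pi\tau\Psi=\Theta\rho\Psi\}.$$ For $\Psi=(\psi_1,\psi_2)\in H^2(\mathbb R\setminus Y;\mathbb C^2)$ put, in $\mathbb C^{4n}=\mathbb C^{2n}\oplus\mathbb C^{2n}$, $\hat\tau\Psi=(\langle\psi_1\rangle_{y_k},\langle\psi_1'\rangle_{y_k})_k\oplus(\langle\psi_2\rangle_{y_k},\langle\psi_2'\rangle_{y_k})_k$ and $\hat\rho\Psi=([\psi_1']_{y_k},-[\psi_1]_{y_k})_k\oplus([\psi_2']_{y_k},-[\psi_2]_{y_k})_k$. Let $$M_1=\begin{bmatrix}1&0&0&0\\0&\frac i2&0&i\\0&1&0&0\\-\frac i2&0&i&0\end{bmatrix},\qquad M_2=\begin{bmatrix}\frac12&0&1&0\\0&i&0&0\\0&-\frac12&0&1\\i&0&0&0\end{bmatrix},$$ and let $N_j=U^*(M_j\oplus\dots\oplus M_j)U$, where $U(\xi_1,\dots,\xi_{2n})=(\xi_1,\xi_{n+1},\xi_2,\xi_{n+2},\dots,\xi_n,\xi_{2n})$, $\xi_k\in\mathbb C^2$. Let $\hat\Pi$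 be the orthogonal projector onto $\mathrm{ran}(N_2(\Pi\oplus\Pi))$, let $$\hat\Theta=\big(N_2(\Pi\oplus\Pi)N_1^{-1}\big)^{-1}N_2(\Theta\oplus\Theta)N_2^{-1}:\mathrm{ran}(\hat\Pi)\to\mathrm{ran}(\hat\Pi),$$ the inverse being that of the operator $N_2(\Pi\oplus\Pi)N_1^{-1}$ restricted to $\mathrm{ran}(\hat\Pi)$, and let $\hat{\mathsf H}=\hat{\mathsf H}_{\hat\Pi,\hat\Theta}$ be the operator acting as $-\frac{d^2}{dx^2}$ on $\mathbb R\setminus Y$ with domain $\{\Psi\in H^2(\mathbb R\setminus Y;\mathbb C^2):\hat\rho\Psi\in\mathrm{ran}(\hat\Pi),\ \hat\Pi\hat\tau\Psi=\hat\Theta\hat\rho\Psi\}$. Let $\tau G_0:\mathbb C^{2n}\to\mathbb C^{2n}$ have the $2\times2$ blocks $[\tau G_0]_{jk}=g_0(y_j-y_k)$, where $$g_0(x)=\frac{e^{-|x|/2}}{2i}\begin{bmatrix}-i&\mathrm{sgn}(x)\\\mathrm{sgn}(x)&i\end{bmatrix},\qquad \mathrm{sgn}(0)=0,$$ is the convolution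 kernel of $(-\mathsf D)^{-1}$, $\mathsf D$ the free Dirac operator. A triple $(H,P,Q)$ of self-adjoint operators, $P$ bounded, is a supersymmetric system if $P^2=1$, $P$ maps $\mathrm{dom}(Q)$ into itself with $PQ+QP=0$ there, and $H=Q^2$. Its supersymmetry is spontaneously broken if it has no supersymmetric state, i.e. no $\Psi\neq0$ with $H\Psi=0$. (1) Suppose that $\Pi$ commutes with $\sigma_2^{\oplus}=\sigma_2\oplus\dots\oplus\sigma_2$ and that $\Theta$ anticommutes with (the restriction to $\mathrm{ran}(\Pi)$ of) $\sigma_2^\oplus$. Then $\hat\Pi$ is an orthogonal projector, $\hat\Theta$ is symmetric, and $(\hat{\mathsf H}+\frac14,\sigma_2,\mathsf D_{\Pi,\Theta})$ is a supersymmetric system; in particular $\sigma_2$ anticommutes with $\mathsf D_{\Pi,\Theta}$. If moreover $\det(\Theta-\Pi\,\tau G_0\,\Pi)\neq0$ (determinant on $\mathrm{ran}(\Pi)$), then $0$ is not an eigenvalue of $\mathsf D_{\Pi,\Theta}$ and supersymmetry is spontaneously broken. (2) Let $n=1$ and $\Pi=1$. The symmetric $\Theta$ that anticommute with $\sigma_2$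 are exactly $\Theta_{a,b}=b\sigma_1+a\sigma_3$, $a,b\in\mathbb R$. One has $\det(\Theta_{a,b}-\tau G_0)=0$ if and only if $b=0$ and $a=-\frac12$. Hence, for every $(a,b)\neq(-\frac12,0)$, $0$ is not an eigenvalue of $\mathsf D_{1,\Theta_{a,b}}$ and supersymmetry is spontaneously broken. -/

import Mathlib

open MeasureTheory Filter Topology
open scoped Kronecker ContDiff

namespace DiracPoint

noncomputable section

/-! ### Linear algebra: Pauli matrices, couples `(Π, Θ)` and boundary conditions -/

/-- The Pauli matrix `σ₁`. -/
def sigma1 : Matrix (Fin 2) (Fin 2) ℂ := !![0, 1; 1, 0]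

/-- The Pauli matrix `σ₂`. -/
def sigma2 : Matrix (Fin 2) (Fin 2) ℂ := !![0, -Complex.I; Complex.I, 0]

/-- The Pauli matrix `σ₃`. -/
def sigma3 : Matrix (Fin 2) (Fin 2) ℂ := !![1, 0; 0, -1]

/-- `ℂ²` with its Euclidean norm. -/
abbrev C2 : Type := EuclideanSpace ℂ (Fin 2)

/-- The boundary space `ℂ²ⁿ = ℂ² ⊕ ⋯ ⊕ ℂ²`; the index `(k, s)` is the `s`-th component of the
`k`-th summand. -/
abbrev Bdry (n : ℕ) : Type := EuclideanSpace ℂ (Fin n × Fin 2)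

/-- The boundary space `ℂ⁴ⁿ = ℂ²ⁿ ⊕ ℂ²ⁿ`; the index `(j, k, s)` is the entry `(k, s)` of the
`j`-th summand `ℂ²ⁿ`. -/
abbrev HatBdry (n : ℕ) : Type := EuclideanSpace ℂ (Fin 2 × Fin n × Fin 2)

set_option linter.unusedSectionVars false

section LinearAlgebra

variable {ι : Type} [Fintype ι]

/-- The range of an operator on `ℂ^ι`, as a subspace. -/
abbrev Ran (P : EuclideanSpace ℂ ι →L[ℂ] EuclideanSpace ℂ ι) :
    Submodule ℂ (EuclideanSpace ℂ ι) :=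
  LinearMap.range (P : EuclideanSpace ℂ ι →ₗ[ℂ] EuclideanSpace ℂ ι)

/-- The compression `P A P : ran P → ran P`: inject `ran P` into `ℂ^ι`, apply `A`, then apply the
surjection `P : ℂ^ι → ran P`. -/
def compress (P A : EuclideanSpace ℂ ι →L[ℂ] EuclideanSpace ℂ ι) : Module.End ℂ (Ran P) :=
  (LinearMap.rangeRestrict (P : EuclideanSpace ℂ ι →ₗ[ℂ] EuclideanSpace ℂ ι)) ∘ₗ
    (A : EuclideanSpace ℂ ι →ₗ[ℂ] EuclideanSpace ℂ ι) ∘ₗ (Ran P).subtype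

/-- `(P, T)` is a couple parametrizing a self-adjoint extension: `P` is an orthogonal projector and
`T : ran P → ran P` is symmetric. -/
def IsCouple (P : EuclideanSpace ℂ ι →L[ℂ] EuclideanSpace ℂ ι) (T : Module.End ℂ (Ran P)) : Prop :=
  IsStarProjection P ∧ LinearMap.IsSymmetric (𝕜 := ℂ) (E := Ran P) T

/-- The boundary condition `r ∈ ran P`, `P t = T r`. -/
def BoundaryCondition (P : EuclideanSpace ℂ ι →L[ℂ] EuclideanSpace ℂ ι) (T : Module.End ℂ (Ran P))
    (t r : EuclideanSpace ℂ ι) : Prop :=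
  ∃ h : r ∈ Ran P, P t = T ⟨r, h⟩

variable {P : EuclideanSpace ℂ ι →L[ℂ] EuclideanSpace ℂ ι} {T : Module.End ℂ (Ran P)}

theorem BoundaryCondition.zero : BoundaryCondition P T 0 0 :=
  ⟨Submodule.zero_mem _, by
    have : (⟨0, Submodule.zero_mem _⟩ : Ran P) = 0 := rfl
    rw [this, map_zero, map_zero]; rfl⟩

theorem BoundaryCondition.add {t r t' r' : EuclideanSpace ℂ ι} (h : BoundaryCondition P T t r)
    (h' : BoundaryCondition P T t' r') : BoundaryCondition P T (t + t') (r + r') := by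
  obtain ⟨a, ha⟩ := h
  obtain ⟨b, hb⟩ := h'
  refine ⟨Submodule.add_mem _ a b, ?_⟩
  have : (⟨r + r', Submodule.add_mem _ a b⟩ : Ran P) = ⟨r, a⟩ + ⟨r', b⟩ := rfl
  rw [this, map_add, map_add, ha, hb]; rfl

theorem BoundaryCondition.smul {t r : EuclideanSpace ℂ ι} (c : ℂ) (h : BoundaryCondition P T t r) :
    BoundaryCondition P T (c • t) (c • r) := by
  obtain ⟨a, ha⟩ := h
  refine ⟨Submodule.smul_mem _ c a, ?_⟩
  have : (⟨c • r, Submodule.smul_mem _ c a⟩ : Ran P) = c • ⟨r, a⟩ := rfl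
  rw [this, map_smul, map_smul, ha]; rfl

end LinearAlgebra

/-- `σ₂^⊕ = σ₂ ⊕ ⋯ ⊕ σ₂` on `ℂ²ⁿ`. -/
def sigma2Sum (n : ℕ) : Bdry n →L[ℂ] Bdry n :=
  Matrix.toEuclideanCLM (𝕜 := ℂ) ((1 : Matrix (Fin n) (Fin n) ℂ) ⊗ₖ sigma2)

/-- `Π σ₂^⊕ - σ₂^⊕ Π = 0 = Θ σ₂^⊕ + σ₂^⊕ Θ`. Since `Π` commutes with `σ₂^⊕`, the latter maps
`ran Π` into itself and its restriction to `ran Π` is `compress Π σ₂^⊕`. -/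
def SusyCondition {n : ℕ} (P : Bdry n →L[ℂ] Bdry n) (T : Module.End ℂ (Ran P)) : Prop :=
  P * sigma2Sum n - sigma2Sum n * P = 0 ∧
    T * compress P (sigma2Sum n) + compress P (sigma2Sum n) * T = 0

/-! ### Weak derivatives and one-sided limits on `ℝ \ Y`, `Y = {y₁, …, yₙ}` -/

/-- The Hilbert space `L²(ℝ; ℂ²)`. -/
abbrev L2 : Type := Lp C2 2 (volume : Measure ℝ)

/-- The operator on `L²(ℝ; ℂ²)` of pointwise multiplication by a constant matrix. -/
def mulL2 (M : Matrix (Fin 2) (Fin 2) ℂ) : L2 →L[ℂ] L2 :=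
  ContinuousLinearMap.compLpL 2 volume (Matrix.toEuclideanCLM (𝕜 := ℂ) M)

/-- `g` is the derivative of `f` in the sense of distributions on `ℝ \ Y`. Thus `f` belongs to
`H¹(ℝ \ Y; ℂ²)` iff `IsWeakDeriv y f g` for some `g : L2`. -/
def IsWeakDeriv {n : ℕ} (y : Fin n → ℝ) (f g : L2) : Prop :=
  ∀ φ : ℝ → ℝ, ContDiff ℝ ∞ φ → HasCompactSupport φ → tsupport φ ⊆ (Set.range y)ᶜ →
    ∫ x, deriv φ x • f x = - ∫ x, φ x • g x

/-- `f(y_k⁻) = L k` and `f(y_k⁺) = R k` for all `k`. As `f` is only defined almost everywhere, the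
limits are taken along the complements of null sets; for `f` in `H¹(ℝ \ Y; ℂ²)` they exist and
are the one-sided limits of the continuous representative. -/
def HasSideLimits {n : ℕ} (y : Fin n → ℝ) (f : ℝ → C2) (L R : Fin n → C2) : Prop :=
  ∀ k, Tendsto f (𝓝[<] (y k) ⊓ ae volume) (𝓝 (L k)) ∧
    Tendsto f (𝓝[>] (y k) ⊓ ae volume) (𝓝 (R k))

/-- `τΨ = (⟨Ψ⟩_{y_k})_k`, where `⟨f⟩_y = (f(y⁻) + f(y⁺))/2`, in terms of the one-sided limits. -/
def tau {n : ℕ} (L R : Fin n → C2) : Bdry n :=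
  WithLp.toLp 2 fun p => (1 / 2 : ℂ) * (L p.1 p.2 + R p.1 p.2)

/-- `ρΨ = (i σ₁ [Ψ]_{y_k})_k`, where `[f]_y = f(y⁺) - f(y⁻)`, in terms of the one-sided limits. -/
def rho {n : ℕ} (L R : Fin n → C2) : Bdry n :=
  WithLp.toLp 2 fun p => Complex.I * (sigma1.mulVec (fun s => R p.1 s - L p.1 s)) p.2

/-- `(τ̂ 1)Ψ = (⟨ψ₁⟩_{y_k}, ⟨ψ₁'⟩_{y_k})_k ⊕ (⟨ψ₂⟩_{y_k}, ⟨ψ₂'⟩_{y_k})_k`, in terms of the one-sided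
limits `L, R` of `Ψ` and `L', R'` of `Ψ'`. -/
def hatTau {n : ℕ} (L R L' R' : Fin n → C2) : HatBdry n :=
  WithLp.toLp 2 fun p => ![(1 / 2 : ℂ) * (L p.2.1 p.1 + R p.2.1 p.1),
    (1 / 2 : ℂ) * (L' p.2.1 p.1 + R' p.2.1 p.1)] p.2.2

/-- `(ρ̂ 1)Ψ = ([ψ₁']_{y_k}, -[ψ₁]_{y_k})_k ⊕ ([ψ₂']_{y_k}, -[ψ₂]_{y_k})_k`, in terms of the one-sided
limits `L, R` of `Ψ` and `L', R'` of `Ψ'`. -/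
def hatRho {n : ℕ} (L R L' R' : Fin n → C2) : HatBdry n :=
  WithLp.toLp 2 fun p => ![R' p.2.1 p.1 - L' p.2.1 p.1, -(R p.2.1 p.1 - L p.2.1 p.1)] p.2.2

section Linearity

variable {n : ℕ} {y : Fin n → ℝ}

theorem integrable_smul_L2 (f : L2) {φ : ℝ → ℝ} (hφ : Continuous φ) (hc : HasCompactSupport φ) :
    Integrable (fun x => φ x • f x) :=
  ((Lp.memLp f).locallyIntegrable (by norm_num)).integrable_smul_left_of_hasCompactSupport hφ hc

theorem IsWeakDeriv.zero : IsWeakDeriv y 0 0 := by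
  intro φ _ _ _
  have h1 : ∫ x, deriv φ x • (0 : L2) x = 0 :=
    integral_eq_zero_of_ae (by filter_upwards [Lp.coeFn_zero C2 2 (volume : Measure ℝ)] with x _
                               simp)
  have h2 : ∫ x, φ x • (0 : L2) x = 0 :=
    integral_eq_zero_of_ae (by filter_upwards [Lp.coeFn_zero C2 2 (volume : Measure ℝ)] with x _
                               simp)
  rw [h1, h2, neg_zero]

theorem IsWeakDeriv.add {f g f' g' : L2} (h : IsWeakDeriv y f g) (h' : IsWeakDeriv y f' g') :
    IsWeakDeriv y (f + f') (g + g') := by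
  intro φ hφ hc hs
  have hd : Continuous (deriv φ) := hφ.continuous_deriv (by simp)
  have e1 : ∫ x, deriv φ x • (f + f') x = (∫ x, deriv φ x • f x) + ∫ x, deriv φ x • f' x := by
    rw [← integral_add (integrable_smul_L2 f hd hc.deriv) (integrable_smul_L2 f' hd hc.deriv)]
    refine integral_congr_ae ?_
    filter_upwards [Lp.coeFn_add f f'] with x hx
    rw [hx, Pi.add_apply, smul_add]
  have e2 : ∫ x, φ x • (g + g') x = (∫ x, φ x • g x) + ∫ x, φ x • g' x := by
    rw [← integral_add (integrable_smul_L2 g hφ.continuous hc)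
      (integrable_smul_L2 g' hφ.continuous hc)]
    refine integral_congr_ae ?_
    filter_upwards [Lp.coeFn_add g g'] with x hx
    rw [hx, Pi.add_apply, smul_add]
  rw [e1, e2, h φ hφ hc hs, h' φ hφ hc hs, neg_add]

theorem IsWeakDeriv.smul {f g : L2} (c : ℂ) (h : IsWeakDeriv y f g) :
    IsWeakDeriv y (c • f) (c • g) := by
  intro φ hφ hc hs
  have e : ∀ (u : L2) (θ : ℝ → ℝ), ∫ x, θ x • (c • u) x = c • ∫ x, θ x • u x := by
    intro u θ
    rw [← integral_smul]
    refine integral_congr_ae ?_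
    filter_upwards [Lp.coeFn_smul c u] with x hx
    simp only [hx, Pi.smul_apply]
    rw [smul_comm]
  rw [e, e, h φ hφ hc hs, smul_neg]

/-- The weak derivative is unique. -/
theorem IsWeakDeriv.eq_zero {g : L2} (h : IsWeakDeriv y 0 g) : g = 0 := by
  have hopen : IsOpen (Set.range y)ᶜ := (Set.finite_range y).isClosed.isOpen_compl
  have key := hopen.ae_eq_zero_of_integral_contDiff_smul_eq_zero (μ := volume) (f := (g : ℝ → C2))
    (((Lp.memLp g).locallyIntegrable (by norm_num)).locallyIntegrableOn _) (by
      intro φ hφ hc hs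
      have h1 := h φ hφ hc hs
      have h2 : ∫ x, deriv φ x • (0 : L2) x = 0 :=
        integral_eq_zero_of_ae (by
          filter_upwards [Lp.coeFn_zero C2 2 (volume : Measure ℝ)] with x _
          simp)
      rw [h2] at h1
      exact neg_eq_zero.mp h1.symm)
  have hY : ∀ᵐ x ∂(volume : Measure ℝ), x ∈ (Set.range y)ᶜ :=
    compl_mem_ae_iff.mpr ((Set.finite_range y).measure_zero _)
  refine Lp.ext ?_
  filter_upwards [key, hY, Lp.coeFn_zero C2 2 (volume : Measure ℝ)] with x h1 h2 h3
  rw [h1 h2, h3]; rfl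

theorem HasSideLimits.zero : HasSideLimits y ((0 : L2) : ℝ → C2) 0 0 := by
  have h : ∀ l : Filter ℝ, Tendsto ((0 : L2) : ℝ → C2) (l ⊓ ae volume) (𝓝 0) := fun l =>
    Tendsto.congr' (f₁ := fun _ => (0 : C2))
      (((Lp.coeFn_zero C2 2 (volume : Measure ℝ)).filter_mono inf_le_right).mono
        fun x hx => by rw [hx]; rfl) tendsto_const_nhds
  exact fun k => ⟨h _, h _⟩

theorem HasSideLimits.add {f f' : L2} {L R L' R' : Fin n → C2} (h : HasSideLimits y f L R)
    (h' : HasSideLimits y f' L' R') : HasSideLimits y (f + f' : L2) (L + L') (R + R') := by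
  have e : ∀ l : Filter ℝ, (fun x => f x + f' x) =ᶠ[l ⊓ ae volume] ((f + f' : L2) : ℝ → C2) :=
    fun l => ((Lp.coeFn_add f f').filter_mono inf_le_right).mono fun x hx => by rw [hx]; rfl
  exact fun k => ⟨((h k).1.add (h' k).1).congr' (e _), ((h k).2.add (h' k).2).congr' (e _)⟩

theorem HasSideLimits.smul {f : L2} {L R : Fin n → C2} (c : ℂ) (h : HasSideLimits y f L R) :
    HasSideLimits y (c • f : L2) (c • L) (c • R) := by
  have e : ∀ l : Filter ℝ, (fun x => c • f x) =ᶠ[l ⊓ ae volume] ((c • f : L2) : ℝ → C2) :=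
    fun l => ((Lp.coeFn_smul c f).filter_mono inf_le_right).mono fun x hx => by rw [hx]; rfl
  exact fun k => ⟨((h k).1.const_smul c).congr' (e _), ((h k).2.const_smul c).congr' (e _)⟩

theorem tau_zero : tau (0 : Fin n → C2) 0 = 0 := by ext p; simp [tau]

theorem rho_zero : rho (0 : Fin n → C2) 0 = 0 := by
  ext p; simp [rho, Matrix.mulVec, dotProduct]

theorem tau_add (L R L' R' : Fin n → C2) : tau (L + L') (R + R') = tau L R + tau L' R' := by
  ext p; simp [tau]; ring

theorem rho_add (L R L' R' : Fin n → C2) : rho (L + L') (R + R') = rho L R + rho L' R' := by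
  ext p; simp [rho, Matrix.mulVec, dotProduct]; ring

theorem tau_smul (c : ℂ) (L R : Fin n → C2) : tau (c • L) (c • R) = c • tau L R := by
  ext p; simp [tau]; ring

theorem rho_smul (c : ℂ) (L R : Fin n → C2) : rho (c • L) (c • R) = c • rho L R := by
  ext p; simp [rho, Matrix.mulVec, dotProduct]; ring

theorem hatTau_zero : hatTau (0 : Fin n → C2) 0 0 0 = 0 := by
  ext ⟨c, k, d⟩; fin_cases d <;> simp [hatTau]

theorem hatRho_zero : hatRho (0 : Fin n → C2) 0 0 0 = 0 := by
  ext ⟨c, k, d⟩; fin_cases d <;> simp [hatRho]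

theorem hatTau_add (A B C D A' B' C' D' : Fin n → C2) :
    hatTau (A + A') (B + B') (C + C') (D + D') = hatTau A B C D + hatTau A' B' C' D' := by
  ext ⟨c, k, d⟩; fin_cases d <;> simp [hatTau] <;> ring

theorem hatRho_add (A B C D A' B' C' D' : Fin n → C2) :
    hatRho (A + A') (B + B') (C + C') (D + D') = hatRho A B C D + hatRho A' B' C' D' := by
  ext ⟨c, k, d⟩; fin_cases d <;> simp [hatRho] <;> ring

theorem hatTau_smul (a : ℂ) (A B C D : Fin n → C2) :
    hatTau (a • A) (a • B) (a • C) (a • D) = a • hatTau A B C D := by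
  ext ⟨c, k, d⟩; fin_cases d <;> simp [hatTau] <;> ring

theorem hatRho_smul (a : ℂ) (A B C D : Fin n → C2) :
    hatRho (a • A) (a • B) (a • C) (a • D) = a • hatRho A B C D := by
  ext ⟨c, k, d⟩; fin_cases d <;> simp [hatRho] <;> ring

end Linearity

/-! ### The operators -/

/-- The free Dirac expression `-i σ₁ Ψ' + ½ σ₃ Ψ`, as a function of `Ψ` and `Ψ'`. -/
def diracExpr (f f' : L2) : L2 :=
  -Complex.I • mulL2 sigma1 f' + (1 / 2 : ℂ) • mulL2 sigma3 f

/-- The graph of the Dirac operator `D_{Π,Θ}`. -/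
def diracGraph {n : ℕ} (y : Fin n → ℝ) (P : Bdry n →L[ℂ] Bdry n) (T : Module.End ℂ (Ran P)) :
    Submodule ℂ (L2 × L2) where
  carrier := {q | ∃ f' : L2, IsWeakDeriv y q.1 f' ∧ q.2 = diracExpr q.1 f' ∧
    ∃ L R, HasSideLimits y q.1 L R ∧ BoundaryCondition P T (tau L R) (rho L R)}
  zero_mem' := ⟨0, IsWeakDeriv.zero, by simp [diracExpr], 0, 0, HasSideLimits.zero, by
    rw [tau_zero, rho_zero]; exact BoundaryCondition.zero⟩
  add_mem' := by
    rintro ⟨f, g⟩ ⟨f₂, g₂⟩ ⟨f', hf, hg, L, R, hl, hb⟩ ⟨f₂', hf₂, hg₂, L₂, R₂, hl₂, hb₂⟩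
    refine ⟨f' + f₂', hf.add hf₂, ?_, L + L₂, R + R₂, hl.add hl₂, ?_⟩
    · simp only [Prod.mk_add_mk] at *
      rw [hg, hg₂]; simp only [diracExpr, map_add, smul_add]; abel
    · rw [tau_add, rho_add]; exact hb.add hb₂
  smul_mem' := by
    rintro c ⟨f, g⟩ ⟨f', hf, hg, L, R, hl, hb⟩
    refine ⟨c • f', hf.smul c, ?_, c • L, c • R, hl.smul c, ?_⟩
    · simp only [Prod.smul_mk] at *
      rw [hg]; simp only [diracExpr, map_smul, smul_add]
      rw [smul_comm c (-Complex.I), smul_comm c (1 / 2 : ℂ)]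
    · rw [tau_smul, rho_smul]; exact hb.smul c

/-- The Dirac operator `D_{Π,Θ}` in `L²(ℝ; ℂ²)`: its domain is
`{Ψ ∈ H¹(ℝ \ Y; ℂ²) : ρΨ ∈ ran Π, ΠτΨ = ΘρΨ}` and it acts as `-i σ₁ d/dx + ½ σ₃` in the sense of
distributions on `ℝ \ Y`. -/
def diracOp {n : ℕ} (y : Fin n → ℝ) (P : Bdry n →L[ℂ] Bdry n) (T : Module.End ℂ (Ran P)) :
    L2 →ₗ.[ℂ] L2 :=
  (diracGraph y P T).toLinearPMap

theorem diracOp_graph {n : ℕ} (y : Fin n → ℝ) (P : Bdry n →L[ℂ] Bdry n)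
    (T : Module.End ℂ (Ran P)) : (diracOp y P T).graph = diracGraph y P T := by
  refine Submodule.toLinearPMap_graph_eq _ ?_
  rintro ⟨f, g⟩ ⟨f', hf, hg, -⟩ (rfl : f = 0)
  have := hf.eq_zero
  subst this
  simpa [diracExpr] using hg

/-- The graph of the Schrödinger operator `Ĥ_{Π̂,Θ̂}`. -/
def schrodingerGraph {n : ℕ} (y : Fin n → ℝ) (P : HatBdry n →L[ℂ] HatBdry n)
    (T : Module.End ℂ (Ran P)) : Submodule ℂ (L2 × L2) where
  carrier := {q | ∃ f' f'' : L2, IsWeakDeriv y q.1 f' ∧ IsWeakDeriv y f' f'' ∧ q.2 = -f'' ∧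
    ∃ L R L' R', HasSideLimits y q.1 L R ∧ HasSideLimits y f' L' R' ∧
      BoundaryCondition P T (hatTau L R L' R') (hatRho L R L' R')}
  zero_mem' := ⟨0, 0, IsWeakDeriv.zero, IsWeakDeriv.zero, by simp, 0, 0, 0, 0,
    HasSideLimits.zero, HasSideLimits.zero, by
      rw [hatTau_zero, hatRho_zero]; exact BoundaryCondition.zero⟩
  add_mem' := by
    rintro ⟨f, g⟩ ⟨u, v⟩ ⟨f', f'', h1, h2, h3, A, B, C, D, h4, h5, h6⟩
      ⟨u', u'', k1, k2, k3, A', B', C', D', k4, k5, k6⟩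
    refine ⟨f' + u', f'' + u'', h1.add k1, h2.add k2, ?_, A + A', B + B', C + C', D + D',
      h4.add k4, h5.add k5, ?_⟩
    · simp only [Prod.mk_add_mk] at *
      rw [h3, k3, neg_add]
    · rw [hatTau_add, hatRho_add]; exact h6.add k6
  smul_mem' := by
    rintro c ⟨f, g⟩ ⟨f', f'', h1, h2, h3, A, B, C, D, h4, h5, h6⟩
    refine ⟨c • f', c • f'', h1.smul c, h2.smul c, ?_, c • A, c • B, c • C, c • D,
      h4.smul c, h5.smul c, ?_⟩
    · simp only [Prod.smul_mk] at *
      rw [h3, smul_neg]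
    · rw [hatTau_smul, hatRho_smul]; exact h6.smul c

/-- The Schrödinger operator `Ĥ_{Π̂,Θ̂}` in `L²(ℝ; ℂ²)`: its domain is
`{Ψ ∈ H²(ℝ \ Y; ℂ²) : (ρ̂ 1)Ψ ∈ ran Π̂, Π̂(τ̂ 1)Ψ = Θ̂(ρ̂ 1)Ψ}` and it acts as `-d²/dx²` in the sense
of distributions on `ℝ \ Y`. -/
def schrodingerOp {n : ℕ} (y : Fin n → ℝ) (P : HatBdry n →L[ℂ] HatBdry n)
    (T : Module.End ℂ (Ran P)) : L2 →ₗ.[ℂ] L2 :=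
  (schrodingerGraph y P T).toLinearPMap

theorem schrodingerOp_graph {n : ℕ} (y : Fin n → ℝ) (P : HatBdry n →L[ℂ] HatBdry n)
    (T : Module.End ℂ (Ran P)) : (schrodingerOp y P T).graph = schrodingerGraph y P T := by
  refine Submodule.toLinearPMap_graph_eq _ ?_
  rintro ⟨f, g⟩ ⟨f', f'', h1, h2, h3, -⟩ (rfl : f = 0)
  have := h1.eq_zero
  subst this
  have := h2.eq_zero
  subst this
  simpa using h3

/-! ### The couple `(Π̂, Θ̂)` associated with `(Π, Θ)` -/

/-- The matrix `M₁`, for which `(τ̂_y 1)Ψ = M₁ (τ_y Ψ, τ_y DΨ)`. -/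
def M1 : Matrix (Fin 4) (Fin 4) ℂ :=
  !![1, 0, 0, 0; 0, Complex.I / 2, 0, Complex.I; 0, 1, 0, 0; -(Complex.I / 2), 0, Complex.I, 0]

/-- The matrix `M₂`, for which `(ρ̂_y 1)Ψ = M₂ (ρ_y Ψ, ρ_y DΨ)`. -/
def M2 : Matrix (Fin 4) (Fin 4) ℂ :=
  !![1 / 2, 0, 1, 0; 0, Complex.I, 0, 0; 0, -(1 / 2), 0, 1; Complex.I, 0, 0, 0]

/-- The operator `U* M^⊕ U` on `ℂ⁴ⁿ = ℂ²ⁿ ⊕ ℂ²ⁿ`, where `M^⊕ = M ⊕ ⋯ ⊕ M` and `U` is the permutation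
`(ξ₁, …, ξ₂ₙ) ↦ (ξ₁, ξₙ₊₁, …, ξₙ, ξ₂ₙ)`, `ξ_k ∈ ℂ²`: for each point `k` it applies `M` to the four
entries `(0,k,0), (0,k,1), (1,k,0), (1,k,1)`. -/
def atPoints (n : ℕ) (M : Matrix (Fin 4) (Fin 4) ℂ) : HatBdry n →L[ℂ] HatBdry n :=
  Matrix.toEuclideanCLM (𝕜 := ℂ) (Matrix.of fun p q : Fin 2 × Fin n × Fin 2 =>
    if p.2.1 = q.2.1 then
      M (finProdFinEquiv (p.1, p.2.2)) (finProdFinEquiv (q.1, q.2.2)) else 0)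

/-- `A ⊕ A` on `ℂ⁴ⁿ = ℂ²ⁿ ⊕ ℂ²ⁿ`. -/
def doubled {n : ℕ} (A : Bdry n →ₗ[ℂ] Bdry n) : HatBdry n →L[ℂ] HatBdry n :=
  LinearMap.toContinuousLinearMap
    { toFun := fun x => WithLp.toLp 2 fun q => A (WithLp.toLp 2 fun p => x (q.1, p)) q.2
      map_add' := by
        intro x z
        ext q
        have : (WithLp.toLp 2 fun p => (x + z) (q.1, p) : Bdry n) =
            (WithLp.toLp 2 fun p => x (q.1, p)) + (WithLp.toLp 2 fun p => z (q.1, p)) := rfl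
        change A (WithLp.toLp 2 fun p => (x + z) (q.1, p)) q.2 = _
        rw [this, map_add]; rfl
      map_smul' := by
        intro c x
        ext q
        have : (WithLp.toLp 2 fun p => (c • x) (q.1, p) : Bdry n) =
            c • (WithLp.toLp 2 fun p => x (q.1, p)) := rfl
        change A (WithLp.toLp 2 fun p => (c • x) (q.1, p)) q.2 = _
        rw [this, map_smul]; rfl }

/-- `U* M₂^⊕ U (Π ⊕ Π)`. -/
def hatRangeMap {n : ℕ} (P : Bdry n →L[ℂ] Bdry n) : HatBdry n →L[ℂ] HatBdry n :=
  atPoints n M2 * doubled (P : Bdry n →ₗ[ℂ] Bdry n)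

/-- `Π̂`: the orthogonal projector onto `ran (U* M₂^⊕ U (Π ⊕ Π))`. -/
def hatPi {n : ℕ} (P : Bdry n →L[ℂ] Bdry n) : HatBdry n →L[ℂ] HatBdry n :=
  (Ran (hatRangeMap P)).starProjection

/-- `Θ : ran Π → ran Π` preceded by the surjection `Π` and followed by the injection. -/
def extendTheta {n : ℕ} (P : Bdry n →L[ℂ] Bdry n) (T : Module.End ℂ (Ran P)) :
    Bdry n →ₗ[ℂ] Bdry n :=
  (Ran P).subtype ∘ₗ T ∘ₗ LinearMap.rangeRestrict (P : Bdry n →ₗ[ℂ] Bdry n)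

/-- The operator `U* M₂^⊕ U (Π ⊕ Π) U* (M₁^⊕)⁻¹ U : ran Π̂ → ran Π̂`. -/
def hatA {n : ℕ} (P : Bdry n →L[ℂ] Bdry n) : Module.End ℂ (Ran (hatPi P)) :=
  compress (hatPi P) (hatRangeMap P * atPoints n M1⁻¹)

/-- The operator `U* M₂^⊕ U (Θ ⊕ Θ) U* (M₂^⊕)⁻¹ U : ran Π̂ → ran Π̂`. -/
def hatB {n : ℕ} (P : Bdry n →L[ℂ] Bdry n) (T : Module.End ℂ (Ran P)) :
    Module.End ℂ (Ran (hatPi P)) :=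
  compress (hatPi P) (atPoints n M2 * doubled (extendTheta P T) * atPoints n M2⁻¹)

/-- `Θ̂ = (U* M₂^⊕ U (Π ⊕ Π) U* (M₁^⊕)⁻¹ U)⁻¹ U* M₂^⊕ U (Θ ⊕ Θ) U* (M₂^⊕)⁻¹ U` on `ran Π̂`. -/
def hatTheta {n : ℕ} (P : Bdry n →L[ℂ] Bdry n) (T : Module.End ℂ (Ran P)) :
    Module.End ℂ (Ran (hatPi P)) :=
  Ring.inverse (hatA P) * hatB P T

/-- `Ĥ_{Π̂,Θ̂} + 1/4`, for the couple `(Π̂, Θ̂)` associated with `(Π, Θ)`. -/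
def susyHamiltonian {n : ℕ} (y : Fin n → ℝ) (P : Bdry n →L[ℂ] Bdry n) (T : Module.End ℂ (Ran P)) :
    L2 →ₗ.[ℂ] L2 :=
  ((1 / 4 : ℂ) • (LinearMap.id : L2 →ₗ[ℂ] L2)) +ᵥ schrodingerOp y (hatPi P) (hatTheta P T)

/-! ### The operator `τ G₀` -/

/-- The kernel `g₀(x - x')` of `(-D)⁻¹`, `D` the free Dirac operator:
`g₀(x) = (e^{-|x|/2} / 2i) [[ζ₀, sgn x], [sgn x, ζ₀⁻¹]]` with `ζ₀ = -i`. -/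
def g0 (x : ℝ) : Matrix (Fin 2) (Fin 2) ℂ :=
  ((Real.exp (-|x| / 2) : ℂ) / (2 * Complex.I)) •
    !![-Complex.I, (Real.sign x : ℂ); (Real.sign x : ℂ), Complex.I]

/-- `(G₀ ξ)(x) = ∑ₖ g₀(x - y_k) ξ_k`. -/
def G0 {n : ℕ} (y : Fin n → ℝ) (ξ : Bdry n) (x : ℝ) : C2 :=
  WithLp.toLp 2 fun s => ∑ k, ∑ s', g0 (x - y k) s s' * ξ (k, s')

/-- `τ G₀` on `ℂ²ⁿ`, with blocks `[τ G₀]_{jk} = g₀(y_j - y_k)`. -/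
def tauG0 {n : ℕ} (y : Fin n → ℝ) : Bdry n →L[ℂ] Bdry n :=
  Matrix.toEuclideanCLM (𝕜 := ℂ) (Matrix.of fun p q => g0 (y p.1 - y q.1) p.2 q.2)

theorem tendsto_sign_right (a b : ℝ) : Tendsto (fun x => Real.sign (x - b)) (𝓝[>] a)
    (𝓝 (if a = b then 1 else Real.sign (a - b))) := by
  refine tendsto_nhds_of_eventually_eq ?_
  rcases lt_trichotomy a b with h | h | h
  · rw [if_neg h.ne]
    filter_upwards [nhdsWithin_le_nhds (eventually_lt_nhds h)] with x hx
    rw [Real.sign_of_neg (by linarith), Real.sign_of_neg (by linarith)]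
  · rw [if_pos h]
    filter_upwards [self_mem_nhdsWithin] with x hx
    exact Real.sign_of_pos (by have : a < x := hx; linarith)
  · rw [if_neg h.ne']
    filter_upwards [nhdsWithin_le_nhds (eventually_gt_nhds h)] with x hx
    rw [Real.sign_of_pos (by linarith), Real.sign_of_pos (by linarith)]

theorem tendsto_sign_left (a b : ℝ) : Tendsto (fun x => Real.sign (x - b)) (𝓝[<] a)
    (𝓝 (if a = b then -1 else Real.sign (a - b))) := by
  refine tendsto_nhds_of_eventually_eq ?_
  rcases lt_trichotomy a b with h | h | h
  · rw [if_neg h.ne]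
    filter_upwards [nhdsWithin_le_nhds (eventually_lt_nhds h)] with x hx
    rw [Real.sign_of_neg (by linarith), Real.sign_of_neg (by linarith)]
  · rw [if_pos h]
    filter_upwards [self_mem_nhdsWithin] with x hx
    exact Real.sign_of_neg (by have : x < a := hx; linarith)
  · rw [if_neg h.ne']
    filter_upwards [nhdsWithin_le_nhds (eventually_gt_nhds h)] with x hx
    rw [Real.sign_of_pos (by linarith), Real.sign_of_pos (by linarith)]

/-- The matrix `tauG0` is indeed `τ` composed with `G₀`; moreover `ρ G₀ = 1`. -/
theorem tauG0_spec {n : ℕ} {y : Fin n → ℝ} (hy : Function.Injective y) (ξ : Bdry n) :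
    ∃ L R, HasSideLimits y (G0 y ξ) L R ∧ tau L R = tauG0 y ξ ∧ rho L R = ξ := by
  obtain ⟨m, m_def⟩ : ∃ m : ℝ → ℝ → Matrix (Fin 2) (Fin 2) ℂ, m = fun (t σ : ℝ) =>
    ((Real.exp (-|t| / 2) : ℂ) / (2 * Complex.I)) •
      !![-Complex.I, (σ : ℂ); (σ : ℂ), Complex.I] := ⟨_, rfl⟩
  have g0_eq : g0 = fun x => m x (Real.sign x) := by rw [m_def]; rfl
  have hm : ∀ (l : Filter ℝ) (a b σ : ℝ), l ≤ 𝓝 a →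
      Tendsto (fun x => Real.sign (x - b)) l (𝓝 σ) →
      Tendsto (fun x => g0 (x - b)) l (𝓝 (m (a - b) σ)) := by
    intro l a b σ hl hs
    have hc : Continuous fun q : ℝ × ℝ => m q.1 q.2 := by
      refine continuous_matrix fun i j => ?_
      fin_cases i <;> fin_cases j <;> simp [m_def] <;> fun_prop
    have h1 : Tendsto (fun x => x - b) l (𝓝 (a - b)) :=
      ((continuous_id.sub continuous_const).tendsto a).mono_left hl
    rw [g0_eq]
    exact (hc.tendsto (a - b, σ)).comp (h1.prodMk_nhds hs)
  let lim : ℝ → Fin n → C2 := fun ε j => WithLp.toLp 2 fun s => ∑ k, ∑ s',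
    m (y j - y k) (if y j = y k then ε else Real.sign (y j - y k)) s s' * ξ (k, s')
  have hlim : ∀ (l : Filter ℝ) (j : Fin n) (ε : ℝ), l ≤ 𝓝 (y j) →
      (∀ b, Tendsto (fun x => Real.sign (x - b)) l
        (𝓝 (if y j = b then ε else Real.sign (y j - b)))) →
      Tendsto (G0 y ξ) l (𝓝 (lim ε j)) := by
    intro l j ε hl hs
    refine ((PiLp.continuous_toLp 2 fun _ : Fin 2 => ℂ).tendsto _).comp ?_
    refine tendsto_pi_nhds.mpr fun s => tendsto_finsetSum _ fun k _ =>
      tendsto_finsetSum _ fun s' _ => Tendsto.mul_const _ ?_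
    exact ((continuous_apply_apply s s').tendsto _).comp (hm l (y j) (y k) _ hl (hs _))
  refine ⟨lim (-1), lim 1, fun j => ⟨?_, ?_⟩, ?_, ?_⟩
  · exact (hlim _ j _ nhdsWithin_le_nhds fun b => tendsto_sign_left _ b).mono_left inf_le_left
  · exact (hlim _ j _ nhdsWithin_le_nhds fun b => tendsto_sign_right _ b).mono_left inf_le_left
  · ext ⟨j, s⟩
    have e : (tauG0 y ξ) (j, s) = ∑ k, ∑ s', g0 (y j - y k) s s' * ξ (k, s') := by
      simp [tauG0, Matrix.mulVec, dotProduct, Fintype.sum_prod_type]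
    rw [e]
    simp only [tau, lim, ← Finset.sum_add_distrib, Finset.mul_sum]
    refine Finset.sum_congr rfl fun k _ => Finset.sum_congr rfl fun s' _ => ?_
    by_cases h : y j = y k
    · fin_cases s <;> fin_cases s' <;> simp [m_def, g0, h] <;> ring
    · fin_cases s <;> fin_cases s' <;> simp [m_def, g0, h] <;> ring
  · ext ⟨j, s⟩
    have key : ∀ s, lim 1 j s - lim (-1) j s = -Complex.I * (sigma1.mulVec fun s' => ξ (j, s')) s := by
      intro s
      simp only [lim, ← Finset.sum_sub_distrib]
      rw [Finset.sum_eq_single j]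
      · fin_cases s <;> simp [m_def, sigma1, Matrix.mulVec, dotProduct, Fin.sum_univ_two] <;>
          field_simp <;> ring_nf
      · intro k _ hk
        have : y j ≠ y k := fun h => hk (hy h).symm
        simp [this]
      · simp
    simp only [rho, key]
    fin_cases s <;> simp [sigma1, Matrix.mulVec, dotProduct, Fin.sum_univ_two, ← mul_assoc]

/-! ### Supersymmetry -/

section Susy

variable {E : Type*} [NormedAddCommGroup E] [InnerProductSpace ℂ E] [CompleteSpace E]

/-- `(H, P, Q)` is a supersymmetric system: `H`, `P`, `Q` are self-adjoint with `P` bounded,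
`P² = 1`, `P` maps `dom Q` into itself and `PQ + QP = 0` on `dom Q`, and `H = Q²`
(with `dom Q² = {x ∈ dom Q : Q x ∈ dom Q}`). -/
structure IsSupersymmetric (H : E →ₗ.[ℂ] E) (P : E →L[ℂ] E) (Q : E →ₗ.[ℂ] E) : Prop where
  selfAdjoint_H : IsSelfAdjoint H
  selfAdjoint_P : IsSelfAdjoint P
  selfAdjoint_Q : IsSelfAdjoint Q
  involution : P * P = 1
  anticomm : ∀ x : Q.domain, ∃ h : P x ∈ Q.domain, P (Q x) + Q ⟨P x, h⟩ = 0
  square : ∀ x z : E, (x, z) ∈ H.graph ↔ ∃ w, (x, w) ∈ Q.graph ∧ (w, z) ∈ Q.graph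

/-- `c` is an eigenvalue of the unbounded operator `A`. -/
def HasEigenvalue (A : E →ₗ.[ℂ] E) (c : ℂ) : Prop :=
  ∃ x : A.domain, (x : E) ≠ 0 ∧ A x = c • (x : E)

/-- Supersymmetry of `(H, P, Q)` is spontaneously broken: the system is supersymmetric but has no
supersymmetric state, i.e. no nonzero vector `x` with `H x = 0`. -/
def IsSpontaneouslyBroken (H : E →ₗ.[ℂ] E) (P : E →L[ℂ] E) (Q : E →ₗ.[ℂ] E) : Prop :=
  IsSupersymmetric H P Q ∧ ¬ ∃ x : H.domain, (x : E) ≠ 0 ∧ H x = 0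

end Susy

/-- `Θ_{a,b} = b σ₁ + a σ₃` on `ℂ² = ran 1`, for `n = 1` and `Π = 1`. -/
def thetaAB (a b : ℝ) : Module.End ℂ (Ran (1 : Bdry 1 →L[ℂ] Bdry 1)) :=
  compress 1 (Matrix.toEuclideanCLM (𝕜 := ℂ)
    ((1 : Matrix (Fin 1) (Fin 1) ℂ) ⊗ₖ ((b : ℂ) • sigma1 + (a : ℂ) • sigma3)))

end

end DiracPoint

/-!
The Dirac operator `Q = D_{Π,Θ}` is self-adjoint, anticommutes with `σ₂`, and its square is
`Ĥ + 1/4`. These facts make up the supersymmetric system, and self-adjointness of `Ĥ + 1/4` need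
not be proved separately: the square of a self-adjoint operator is self-adjoint
(`isSelfAdjoint_of_sq`), because `1 + Q²` is symmetric and onto.

*Sobolev functions.* Everything about `H¹(ℝ \ Y; ℂ²)` follows from one description of its scalar
components: on each interval of `ℝ \ Y` they are primitives of their weak derivatives
(`HasPrimitiveOff`), so that they are the sum of a primitive on `ℝ` and of a step function
(`HasPrimitiveOff.exists_jumps`). One-sided limits exist, products of such functions are again of
this form, and an integrable one vanishes at `±∞`; this gives Green's formula
`inner_add_inner_eq_neg_sum`.

*Self-adjointness of `Q`.* By Green's formula the boundary form of the Dirac expression is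
`⟨ρΨ, τΦ⟩ - ⟨τΨ, ρΦ⟩` (`inner_diracExpr_sub`), and the boundary conditions of a couple `(Π, Θ)` form
a Lagrangian subspace for it (`IsCouple.boundaryCondition_iff`). A vector in the domain of the
adjoint is weakly differentiable on `ℝ \ Y`, as one sees by testing with functions supported there;
since all traces are attained, it satisfies the boundary conditions (`isSelfAdjoint_diracOp`).

*The square of `Q`.* The matrices `M₁`, `M₂` are such that `τ̂Ψ` and `ρ̂Ψ` are `N₁ (τΨ, τQΨ)` and
`N₂ (ρΨ, ρQΨ)`. Moreover `M₂* M₁` exchanges the two summands `ℂ²`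
(`M2_conjTranspose_mul_M1`), whence `N₁⁻¹ = S N₂*` for an `S` which commutes with `Π ⊕ Π` and
`Θ ⊕ Θ`. It follows that `N₂ (Π ⊕ Π) N₁⁻¹ = N₂ (Π ⊕ Π) S N₂*` is invertible on `ran Π̂`, that `Θ̂` is
symmetric, and that the boundary conditions for `(Π̂, Θ̂)` are those of `(Π, Θ)` for both `Ψ` and
`QΨ` (`IsLift`).

*Zero modes.* If `QΨ = 0`, then `ψ₁ + iψ₂` and `ψ₁ - iψ₂` are multiples of `e^{x/2}` and `e^{-x/2}` on
each interval of `ℝ \ Y`. Square integrability determines them by their jumps, and the outcome is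
`Ψ = G₀ ρΨ` (`ae_eq_G0_of_diracExpr_eq_zero`). Then `τΨ = τG₀ ρΨ`, so the boundary condition reads
`(Θ - Π τG₀ Π) ρΨ = 0`; if the determinant does not vanish, `ρΨ = 0` and `Ψ = 0`. As `(Ĥ + 1/4)Ψ = 0`
implies `QΨ = 0`, supersymmetry is then broken. For one point and `Π = 1`, the determinant is
`-(b² + (a + 1/2)²)`.
-/

namespace DiracPoint

open scoped InnerProductSpace

/-! ### Primitives, and functions whose weak derivative vanishes -/

/-- Integration by parts for two primitives: the square `(a, b]²` is cut along its diagonal and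
Fubini's theorem is applied to both halves. -/
theorem integral_mul_integral_eq_integral_primitive {f g : ℝ → ℂ} {a b : ℝ} (hab : a ≤ b)
    (hf : IntervalIntegrable f volume a b) (hg : IntervalIntegrable g volume a b) :
    (∫ x in a..b, f x) * (∫ x in a..b, g x) =
      ∫ x in a..b, (f x * (∫ t in a..x, g t) + (∫ t in a..x, f t) * g x) := by
  have hcf : ContinuousOn (fun x => ∫ t in a..x, f t) (Set.uIcc a b) :=
    intervalIntegral.continuousOn_primitive_interval' hf Set.left_mem_uIcc
  have hcg : ContinuousOn (fun x => ∫ t in a..x, g t) (Set.uIcc a b) :=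
    intervalIntegral.continuousOn_primitive_interval' hg Set.left_mem_uIcc
  rw [intervalIntegral.integral_add (hf.mul_continuousOn hcg) (hg.continuousOn_mul hcf)]
  rw [intervalIntegrable_iff_integrableOn_Ioc_of_le hab] at hf hg
  simp only [intervalIntegral.integral_of_le hab]
  set μ : Measure ℝ := volume.restrict (Set.Ioc a b) with hμ
  have hk : Integrable (fun p : ℝ × ℝ => f p.1 * g p.2) (μ.prod μ) := hf.mul_prod hg
  have hA : MeasurableSet {p : ℝ × ℝ | p.2 ≤ p.1} := measurableSet_le measurable_snd measurable_fst
  have e1 : ∫ x in Set.Ioc a b, f x * (∫ t in a..x, g t) =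
      ∫ p in {p : ℝ × ℝ | p.2 ≤ p.1}, f p.1 * g p.2 ∂(μ.prod μ) := by
    rw [← integral_indicator hA, integral_prod _ (hk.indicator hA)]
    refine setIntegral_congr_fun measurableSet_Ioc fun x hx => ?_
    have : ∀ t, Set.indicator {p : ℝ × ℝ | p.2 ≤ p.1} (fun p : ℝ × ℝ => f p.1 * g p.2) (x, t) =
        f x * Set.indicator (Set.Iic x) g t := by
      intro t
      by_cases h : t ≤ x <;> simp [Set.indicator, h]
    simp only [this, integral_const_mul]
    rw [integral_indicator measurableSet_Iic, hμ, Measure.restrict_restrict measurableSet_Iic,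
      intervalIntegral.integral_of_le hx.1.le]
    congr 3
    ext t
    simp only [Set.mem_Ioc, Set.mem_inter_iff, Set.mem_Iic]
    constructor
    · rintro ⟨h1, h2⟩; exact ⟨h2, h1, h2.trans hx.2⟩
    · rintro ⟨h1, h2, -⟩; exact ⟨h2, h1⟩
  have e2 : ∫ x in Set.Ioc a b, (∫ t in a..x, f t) * g x =
      ∫ p in {p : ℝ × ℝ | p.2 ≤ p.1}ᶜ, f p.1 * g p.2 ∂(μ.prod μ) := by
    rw [← integral_indicator hA.compl, integral_prod_symm _ (hk.indicator hA.compl)]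
    refine setIntegral_congr_fun measurableSet_Ioc fun x hx => ?_
    have : ∀ t, Set.indicator {p : ℝ × ℝ | p.2 ≤ p.1}ᶜ (fun p : ℝ × ℝ => f p.1 * g p.2) (t, x) =
        Set.indicator (Set.Iio x) f t * g x := by
      intro t
      by_cases h : t < x
      · simp [Set.indicator, h]
      · simp [Set.indicator, h, not_lt.mp h]
    simp only [this, integral_mul_const]
    rw [integral_indicator measurableSet_Iio, hμ, Measure.restrict_restrict measurableSet_Iio,
      intervalIntegral.integral_of_le hx.1.le, integral_Ioc_eq_integral_Ioo]
    congr 3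
    ext t
    simp only [Set.mem_Ioc, Set.mem_Ioo, Set.mem_inter_iff, Set.mem_Iio]
    constructor
    · rintro ⟨h1, h2⟩; exact ⟨h2, h1, h2.le.trans hx.2⟩
    · rintro ⟨h1, h2, -⟩; exact ⟨h2, h1⟩
  rw [e1, e2, integral_add_compl hA hk, integral_prod_mul]

/-- The integral of a function that vanishes outside `(a, b)`. -/
theorem integral_eq_intervalIntegral_of_support_subset {E : Type*} [NormedAddCommGroup E]
    [NormedSpace ℝ E] {f : ℝ → E} {a b : ℝ} (hab : a ≤ b)
    (h : ∀ x, x ∉ Set.Ioo a b → f x = 0) : ∫ x, f x = ∫ x in a..b, f x := by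
  rw [intervalIntegral.integral_of_le hab]
  refine (setIntegral_eq_integral_of_forall_compl_eq_zero fun x hx => h x fun h' => ?_).symm
  exact hx ⟨h'.1, h'.2.le⟩

/-- The primitive `∫₀ˣ g` has the weak derivative `g`. -/
theorem integral_deriv_smul_primitive {g : ℝ → ℂ} (hg : LocallyIntegrable g volume) {φ : ℝ → ℝ}
    (hφ : ContDiff ℝ ∞ φ) {a b : ℝ} (hab : a ≤ b) (hs : tsupport φ ⊆ Set.Ioo a b) :
    ∫ x, deriv φ x • (∫ t in (0 : ℝ)..x, g t) = - ∫ x, φ x • g x := by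
  have hi : ∀ u v, IntervalIntegrable g volume u v := fun u v =>
    (hg.integrableOn_isCompact isCompact_uIcc).intervalIntegrable
  have hd : Continuous (deriv φ) := hφ.continuous_deriv (by simp)
  have z1 : ∀ x, x ∉ Set.Ioo a b → φ x = 0 := fun x hx =>
    image_eq_zero_of_notMem_tsupport fun h => hx (hs h)
  have z2 : ∀ x, x ∉ Set.Ioo a b → deriv φ x = 0 := fun x hx =>
    image_eq_zero_of_notMem_tsupport fun h => hx (hs (closure_minimal
      (support_deriv_subset) (isClosed_tsupport φ) h))
  rw [integral_eq_intervalIntegral_of_support_subset hab (fun x hx => by simp [z2 x hx]),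
    integral_eq_intervalIntegral_of_support_subset hab (fun x hx => by simp [z1 x hx])]
  have hdi : IntervalIntegrable (fun x => ((deriv φ x : ℝ) : ℂ)) volume a b :=
    (Complex.continuous_ofReal.comp hd).intervalIntegrable _ _
  have ftc : ∀ x, ∫ t in a..x, ((deriv φ t : ℝ) : ℂ) = φ x := by
    intro x
    rw [intervalIntegral.integral_ofReal, intervalIntegral.integral_deriv_eq_sub
      (fun t _ => (hφ.differentiable (by simp)) t) (hd.intervalIntegrable _ _),
      z1 a (by simp), sub_zero]
  have key := integral_mul_integral_eq_integral_primitive hab hdi (hi a b)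
  rw [ftc b, z1 b (by simp), Complex.ofReal_zero, zero_mul] at key
  have hcg : Continuous (fun x => ∫ t in a..x, g t) := intervalIntegral.continuous_primitive hi a
  have hφc : Continuous fun x => (φ x : ℂ) := Complex.continuous_ofReal.comp hφ.continuous
  simp only [ftc] at key
  rw [intervalIntegral.integral_add (hdi.mul_continuousOn hcg.continuousOn)
    ((hi a b).continuousOn_mul hφc.continuousOn)] at key
  have split : ∀ x, deriv φ x • (∫ t in (0 : ℝ)..x, g t) =
      ((deriv φ x : ℝ) : ℂ) * (∫ t in (0 : ℝ)..a, g t) +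
        ((deriv φ x : ℝ) : ℂ) * (∫ t in a..x, g t) := by
    intro x
    rw [← intervalIntegral.integral_add_adjacent_intervals (hi 0 a) (hi a x), Complex.real_smul,
      mul_add]
  simp only [split]
  rw [intervalIntegral.integral_add (hdi.mul_const _) (hdi.mul_continuousOn hcg.continuousOn),
    intervalIntegral.integral_mul_const, ftc b, z1 b (by simp)]
  simp only [Complex.real_smul]
  rw [Complex.ofReal_zero, zero_mul, zero_add]
  exact eq_neg_of_add_eq_zero_left key.symm

/-- Du Bois-Reymond's lemma. A test function with vanishing integral is the derivative of a test
function, so that `h` is orthogonal to all of them. -/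
theorem exists_ae_eq_const_of_integral_deriv_smul_eq_zero {h : ℝ → ℂ}
    (hh : LocallyIntegrable h volume) {a b : ℝ} (hab : a < b)
    (hw : ∀ φ : ℝ → ℝ, ContDiff ℝ ∞ φ → HasCompactSupport φ → tsupport φ ⊆ Set.Ioo a b →
      ∫ x, deriv φ x • h x = 0) :
    ∃ c, ∀ᵐ x, x ∈ Set.Ioo a b → h x = c := by
  let η₀ : ContDiffBump ((a + b) / 2) := ⟨(b - a) / 8, (b - a) / 4, by linarith, by linarith⟩
  set η : ℝ → ℝ := η₀.normed volume with hη
  have ηs : ContDiff ℝ ∞ η := η₀.contDiff_normed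
  have ηc : HasCompactSupport η := η₀.hasCompactSupport_normed
  have ηt : tsupport η ⊆ Set.Ioo a b := by
    rw [hη, η₀.tsupport_normed_eq, Real.closedBall_eq_Icc]
    intro x hx
    have : η₀.rOut = (b - a) / 4 := rfl
    rw [this] at hx
    exact ⟨by linarith [hx.1], by linarith [hx.2]⟩
  have ηi : ∫ x, η x = 1 := η₀.integral_normed
  have ηn : (tsupport η).Nonempty := by
    rw [hη, η₀.tsupport_normed_eq]; exact ⟨_, Metric.mem_closedBall_self η₀.rOut_pos.le⟩
  have hint : ∀ φ : ℝ → ℝ, Continuous φ → HasCompactSupport φ → Integrable (fun x => φ x • h x) :=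
    fun φ h1 h2 => hh.integrable_smul_left_of_hasCompactSupport h1 h2
  refine ⟨∫ x, η x • h x, ?_⟩
  set c := ∫ x, η x • h x with hc
  have := (isOpen_Ioo (a := a) (b := b)).ae_eq_zero_of_integral_contDiff_smul_eq_zero
    (μ := volume) (f := fun x => h x - c)
    ((hh.sub (locallyIntegrable_const c)).locallyIntegrableOn _)
    (by
      intro φ φs φc φt
      have hphi := φs.continuous
      have heta := ηs.continuous
      obtain ⟨ψ, hψ⟩ : ∃ ψ : ℝ → ℝ, ψ = fun x => φ x - (∫ t, φ t) * η x := ⟨_, rfl⟩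
      have ψs : ContDiff ℝ ∞ ψ := by rw [hψ]; exact φs.sub (contDiff_const.mul ηs)
      have ψi : ∫ x, ψ x = 0 := by
        rw [hψ, integral_sub (hphi.integrable_of_hasCompactSupport φc)
          ((heta.integrable_of_hasCompactSupport ηc).const_mul _), integral_const_mul, ηi]
        simp
      -- both supports lie in a compact subinterval `[a', b']` of `(a, b)`
      have Kc : IsCompact (tsupport φ ∪ tsupport η) := φc.union ηc
      have Kn : (tsupport φ ∪ tsupport η).Nonempty := ηn.mono Set.subset_union_right
      obtain ⟨a', ha', la⟩ := Kc.exists_isLeast Kn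
      obtain ⟨b', hb', lb⟩ := Kc.exists_isGreatest Kn
      have Kab : tsupport φ ∪ tsupport η ⊆ Set.Ioo a b := Set.union_subset φt ηt
      have ψz : ∀ x, x ∉ Set.Icc a' b' → ψ x = 0 := by
        intro x hx
        have hx' : x ∉ tsupport φ ∪ tsupport η := fun h' => hx ⟨la h', lb h'⟩
        rw [Set.mem_union, not_or] at hx'
        rw [hψ]
        simp [image_eq_zero_of_notMem_tsupport hx'.1, image_eq_zero_of_notMem_tsupport hx'.2]
      have za : ∀ x, x ≤ a → ψ x = 0 := fun x hx => ψz x fun h' => by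
        linarith [h'.1, (Kab ha').1]
      have zb : ∀ x, b ≤ x → ψ x = 0 := fun x hx => ψz x fun h' => by
        linarith [h'.2, (Kab hb').2]
      obtain ⟨Φ, hΦ⟩ : ∃ Φ : ℝ → ℝ, Φ = fun x => ∫ t in a..x, ψ t := ⟨_, rfl⟩
      have Φd : ∀ x, HasDerivAt Φ (ψ x) x := fun x => by
        rw [hΦ]
        exact intervalIntegral.integral_hasDerivAt_right (ψs.continuous.intervalIntegrable _ _)
          ψs.continuous.stronglyMeasurable.stronglyMeasurableAtFilter ψs.continuous.continuousAt
      have Φd' : deriv Φ = ψ := funext fun x => (Φd x).deriv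
      have Φs : ContDiff ℝ ∞ Φ :=
        contDiff_infty_iff_deriv.mpr ⟨fun x => (Φd x).differentiableAt, by rwa [Φd']⟩
      have Φz : Function.support Φ ⊆ Set.Icc a' b' := by
        intro x hx
        by_contra hx'
        refine hx ?_
        rw [hΦ]
        dsimp only
        rw [Set.mem_Icc, not_and_or, not_le, not_le] at hx'
        rcases hx' with hx' | hx'
        · refine intervalIntegral.integral_zero_ae (Eventually.of_forall fun t ht => ψz t fun h' => ?_)
          have : max a x < a' := max_lt (Kab ha').1 hx'
          have := (Set.uIoc_subset_uIcc ht)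
          rw [Set.uIcc, Set.mem_Icc] at this
          have h3 := this.2
          have : t < a' := lt_of_le_of_lt h3 ‹max a x < a'›
          linarith [h'.1]
        · have hax : a ≤ x := by linarith [(Kab hb').1]
          rw [← ψi]
          symm
          refine integral_eq_intervalIntegral_of_support_subset hax fun t ht => ?_
          rw [Set.mem_Ioo, not_and_or, not_lt, not_lt] at ht
          rcases ht with ht | ht
          · exact za t ht
          · exact ψz t fun h' => by linarith [h'.2]
      have Φt : tsupport Φ ⊆ Set.Icc a' b' := closure_minimal Φz isClosed_Icc
      have Φc : HasCompactSupport Φ := HasCompactSupport.of_support_subset_isCompact isCompact_Icc Φz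
      have h0 := hw Φ Φs Φc (Φt.trans fun x hx =>
        ⟨lt_of_lt_of_le (Kab ha').1 hx.1, lt_of_le_of_lt hx.2 (Kab hb').2⟩)
      rw [Φd', hψ] at h0
      simp only [sub_smul, mul_smul] at h0
      have hint' : Integrable (fun x => (∫ t, φ t) • η x • h x) :=
        (hint η heta ηc).smul (∫ t, φ t)
      rw [integral_sub (hint φ hphi φc) hint', integral_smul, ← hc] at h0
      simp only [smul_sub]
      rw [integral_sub (hint φ hphi φc) ((hphi.integrable_of_hasCompactSupport φc).smul_const c),
        integral_smul_const]
      exact h0)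
  filter_upwards [this] with x hx hx'
  exact sub_eq_zero.mp (hx hx')

section

/-! ### Functions with a primitive on each interval of `ℝ \ Y` -/

theorem intervalIntegrable_of_locallyIntegrable {g : ℝ → ℂ} (hg : LocallyIntegrable g volume)
    (a b : ℝ) : IntervalIntegrable g volume a b :=
  (hg.integrableOn_isCompact isCompact_uIcc).intervalIntegrable

/-- `f` is, on each interval of `ℝ \ Y`, almost everywhere a primitive of the locally integrable
function `g`. This is the form in which scalar functions in `H¹(ℝ \ Y)` are handled: `f` need not
be continuous, and its values at the points of `Y` and on null sets are irrelevant. -/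
structure HasPrimitiveOff {n : ℕ} (y : Fin n → ℝ) (f g : ℝ → ℂ) : Prop where
  locallyIntegrable : LocallyIntegrable g volume
  exists_const : ∀ a b, a < b → (∀ k, y k ∉ Set.Ioo a b) →
    ∃ c, ∀ᵐ x, x ∈ Set.Ioo a b → f x = c + ∫ t in (0 : ℝ)..x, g t

variable {n : ℕ} {y : Fin n → ℝ}

theorem HasPrimitiveOff.of_integral_deriv_smul {f g : ℝ → ℂ} (hf : LocallyIntegrable f volume)
    (hg : LocallyIntegrable g volume)
    (h : ∀ φ : ℝ → ℝ, ContDiff ℝ ∞ φ → HasCompactSupport φ → tsupport φ ⊆ (Set.range y)ᶜ →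
      ∫ x, deriv φ x • f x = - ∫ x, φ x • g x) : HasPrimitiveOff y f g := by
  refine ⟨hg, fun a b hab hy => ?_⟩
  have hG : Continuous fun x => ∫ t in (0 : ℝ)..x, g t :=
    intervalIntegral.continuous_primitive (intervalIntegrable_of_locallyIntegrable hg) 0
  obtain ⟨c, hc⟩ := exists_ae_eq_const_of_integral_deriv_smul_eq_zero
    (h := fun x => f x - ∫ t in (0 : ℝ)..x, g t) (hf.sub hG.locallyIntegrable) hab (by
      intro φ φs φc φt
      have hd : Continuous (deriv φ) := φs.continuous_deriv (by simp)
      simp only [smul_sub]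
      rw [integral_sub (hf.integrable_smul_left_of_hasCompactSupport hd φc.deriv)
        (hG.locallyIntegrable.integrable_smul_left_of_hasCompactSupport hd φc.deriv),
        integral_deriv_smul_primitive hg φs hab.le φt, h φ φs φc, sub_self]
      rintro x hx ⟨k, rfl⟩
      exact hy k (φt hx))
  refine ⟨c, ?_⟩
  filter_upwards [hc] with x hx hx'
  rw [← hx hx', sub_add_cancel]

theorem HasPrimitiveOff.congr {f f' g g' : ℝ → ℂ} (h : HasPrimitiveOff y f g)
    (hf : f =ᵐ[volume] f')
    (hg : g =ᵐ[volume] g') : HasPrimitiveOff y f' g' := by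
  refine ⟨h.1.congr hg, fun a b hab hy => ?_⟩
  obtain ⟨c, hc⟩ := h.2 a b hab hy
  refine ⟨c, ?_⟩
  filter_upwards [hc, hf] with x hx hx' hx''
  rw [← hx', hx hx'', intervalIntegral.integral_congr_ae (hg.mono fun t ht _ => ht)]

theorem HasPrimitiveOff.of_hasDerivAt {f g : ℝ → ℂ} (h : ∀ x, HasDerivAt f (g x) x)
    (hg : Continuous g) : HasPrimitiveOff y f g := by
  refine ⟨hg.locallyIntegrable, fun a b _ _ => ⟨f 0, Eventually.of_forall fun x _ => ?_⟩⟩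
  rw [intervalIntegral.integral_eq_sub_of_hasDerivAt (fun t _ => h t) (hg.intervalIntegrable _ _)]
  ring

theorem HasPrimitiveOff.ofReal {χ : ℝ → ℝ} (hχ : ContDiff ℝ ∞ χ) :
    HasPrimitiveOff y (fun x => (χ x : ℂ)) (fun x => ((deriv χ x : ℝ) : ℂ)) :=
  .of_hasDerivAt (fun x => ((hχ.differentiable (by simp)) x).hasDerivAt.ofReal_comp)
    (Complex.continuous_ofReal.comp (hχ.continuous_deriv (by simp)))

theorem HasPrimitiveOff.step (k : Fin n) (l r : ℂ) :
    HasPrimitiveOff y (fun x => if x ≤ y k then l else r) 0 := by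
  refine ⟨locallyIntegrable_zero, fun a b hab hy => ?_⟩
  have h := hy k
  rw [Set.mem_Ioo, not_and_or, not_lt, not_lt] at h
  rcases h with h | h
  · refine ⟨r, Eventually.of_forall fun x hx => ?_⟩
    simp [not_le.mpr (lt_of_le_of_lt h hx.1)]
  · refine ⟨l, Eventually.of_forall fun x hx => ?_⟩
    simp [hx.2.le.trans h]

theorem HasPrimitiveOff.add {f g f' g' : ℝ → ℂ} (h : HasPrimitiveOff y f g)
    (h' : HasPrimitiveOff y f' g') :
    HasPrimitiveOff y (fun x => f x + f' x) (fun x => g x + g' x) := by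
  refine ⟨h.1.add h'.1, fun a b hab hy => ?_⟩
  obtain ⟨c, hc⟩ := h.2 a b hab hy
  obtain ⟨c', hc'⟩ := h'.2 a b hab hy
  refine ⟨c + c', ?_⟩
  filter_upwards [hc, hc'] with x hx hx' hI
  rw [hx hI, hx' hI, intervalIntegral.integral_add (intervalIntegrable_of_locallyIntegrable h.1 _ _)
    (intervalIntegrable_of_locallyIntegrable h'.1 _ _)]
  ring

theorem HasPrimitiveOff.const_mul {f g : ℝ → ℂ} (z : ℂ) (h : HasPrimitiveOff y f g) :
    HasPrimitiveOff y (fun x => z * f x) (fun x => z * g x) := by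
  refine ⟨h.1.smul z, fun a b hab hy => ?_⟩
  obtain ⟨c, hc⟩ := h.2 a b hab hy
  refine ⟨z * c, ?_⟩
  filter_upwards [hc] with x hx hI
  rw [hx hI, intervalIntegral.integral_const_mul]
  ring

theorem HasPrimitiveOff.conj {f g : ℝ → ℂ} (h : HasPrimitiveOff y f g) :
    HasPrimitiveOff y (fun x => (starRingEnd ℂ) (f x)) (fun x => (starRingEnd ℂ) (g x)) := by
  refine ⟨fun x => ?_, fun a b hab hy => ?_⟩
  · obtain ⟨s, hs, hi⟩ := h.1 x
    exact ⟨s, hs, Complex.conjCLE.toContinuousLinearMap.integrable_comp hi⟩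
  · obtain ⟨c, hc⟩ := h.2 a b hab hy
    refine ⟨(starRingEnd ℂ) c, ?_⟩
    filter_upwards [hc] with x hx hI
    rw [hx hI, map_add, intervalIntegral, intervalIntegral, map_sub, integral_conj, integral_conj]

/-- The product rule. -/
theorem HasPrimitiveOff.mul {f g f' g' : ℝ → ℂ} (h : HasPrimitiveOff y f g)
    (h' : HasPrimitiveOff y f' g')
    (hw : LocallyIntegrable (fun x => g x * f' x + f x * g' x) volume) :
    HasPrimitiveOff y (fun x => f x * f' x) (fun x => g x * f' x + f x * g' x) := by
  refine ⟨hw, fun a b hab hy => ?_⟩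
  obtain ⟨c, hc⟩ := h.2 a b hab hy
  obtain ⟨c', hc'⟩ := h'.2 a b hab hy
  have hi := intervalIntegrable_of_locallyIntegrable h.1
  have hi' := intervalIntegrable_of_locallyIntegrable h'.1
  have hiw := intervalIntegrable_of_locallyIntegrable hw
  -- the primitives are taken from the left end point `a`, so that all integrals run over `(a, b)`
  obtain ⟨d, hd⟩ : ∃ d, d = c + ∫ t in (0 : ℝ)..a, g t := ⟨_, rfl⟩
  obtain ⟨d', hd'⟩ : ∃ d', d' = c' + ∫ t in (0 : ℝ)..a, g' t := ⟨_, rfl⟩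
  have e : ∀ᵐ x, x ∈ Set.Ioo a b → f x = d + ∫ t in a..x, g t := by
    filter_upwards [hc] with x hx hI
    rw [hx hI, hd, add_assoc, intervalIntegral.integral_add_adjacent_intervals (hi _ _) (hi _ _)]
  have e' : ∀ᵐ x, x ∈ Set.Ioo a b → f' x = d' + ∫ t in a..x, g' t := by
    filter_upwards [hc'] with x hx hI
    rw [hx hI, hd', add_assoc,
      intervalIntegral.integral_add_adjacent_intervals (hi' _ _) (hi' _ _)]
  refine ⟨d * d' - ∫ t in (0 : ℝ)..a, (g t * f' t + f t * g' t), ?_⟩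
  filter_upwards [e, e'] with x hx hx' hI
  rw [← intervalIntegral.integral_add_adjacent_intervals (hiw 0 a) (hiw a x), hx hI, hx' hI]
  have hG : Continuous fun x => ∫ t in a..x, g t := intervalIntegral.continuous_primitive hi a
  have hG' : Continuous fun x => ∫ t in a..x, g' t := intervalIntegral.continuous_primitive hi' a
  have key : ∫ t in a..x, (g t * f' t + f t * g' t) =
      ∫ t in a..x, ((d' * g t + d * g' t) +
        (g t * (∫ s in a..t, g' s) + (∫ s in a..t, g s) * g' t)) := by
    refine intervalIntegral.integral_congr_ae ?_
    filter_upwards [e, e'] with t ht ht' hI'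
    rw [Set.uIoc_of_le hI.1.le] at hI'
    have hI'' : t ∈ Set.Ioo a b := ⟨hI'.1, lt_of_le_of_lt hI'.2 hI.2⟩
    rw [ht hI'', ht' hI'']
    ring
  rw [key, intervalIntegral.integral_add (((hi a x).const_mul d').add ((hi' a x).const_mul d))
    (((hi a x).mul_continuousOn hG'.continuousOn).add ((hi' a x).continuousOn_mul hG.continuousOn)),
    ← integral_mul_integral_eq_integral_primitive hI.1.le (hi a x) (hi' a x),
    intervalIntegral.integral_add ((hi a x).const_mul d') ((hi' a x).const_mul d),
    intervalIntegral.integral_const_mul, intervalIntegral.integral_const_mul]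
  ring

theorem exists_mem_of_ae_of_lt {p : ℝ → Prop} (hp : ∀ᵐ x, p x) {a b : ℝ} (hab : a < b) :
    ∃ x ∈ Set.Ioo a b, p x := by
  by_contra hcon
  push Not at hcon
  have h0 : volume (Set.Ioo a b) = 0 := measure_mono_null (fun x hx => hcon x hx) hp
  rw [Real.volume_Ioo, ENNReal.ofReal_eq_zero] at h0
  linarith

/-- A locally almost everywhere constant function is almost everywhere constant. -/
theorem exists_ae_eq_const_of_locally {h : ℝ → ℂ}
    (hl : ∀ x₀, ∃ ε > 0, ∃ c, ∀ᵐ x, x ∈ Set.Ioo (x₀ - ε) (x₀ + ε) → h x = c) :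
    ∃ c, ∀ᵐ x, h x = c := by
  choose ε hε c hc using hl
  have hloc : IsLocallyConstant c := by
    rw [IsLocallyConstant.iff_exists_open]
    refine fun x₀ => ⟨Set.Ioo (x₀ - ε x₀) (x₀ + ε x₀), isOpen_Ioo, ⟨by linarith [hε x₀],
      by linarith [hε x₀]⟩, fun x hx => ?_⟩
    obtain ⟨t, ht, h1, h2⟩ := exists_mem_of_ae_of_lt ((hc x₀).and (hc x))
      (a := max (x₀ - ε x₀) (x - ε x)) (b := min (x₀ + ε x₀) (x + ε x))
      (by rw [max_lt_iff, lt_min_iff, lt_min_iff]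
          refine ⟨⟨?_, ?_⟩, ?_, ?_⟩ <;> linarith [hε x₀, hε x, hx.1, hx.2])
    rw [Set.mem_Ioo, max_lt_iff, lt_min_iff] at ht
    rw [← h1 ⟨ht.1.1, ht.2.1⟩, h2 ⟨ht.1.2, ht.2.2⟩]
  refine ⟨c 0, ?_⟩
  rw [ae_iff]
  refine measure_null_of_locally_null _ fun x₀ _ => ⟨Set.Ioo (x₀ - ε x₀) (x₀ + ε x₀) ∩
    {x | ¬ h x = c 0}, ?_, ?_⟩
  · exact inter_mem (mem_nhdsWithin_of_mem_nhds (Ioo_mem_nhds (by linarith [hε x₀])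
      (by linarith [hε x₀]))) self_mem_nhdsWithin
  · refine measure_mono_null ?_ (hc x₀)
    rintro x ⟨hx, hx'⟩ h2
    exact hx' ((h2 hx).trans (hloc.apply_eq_of_preconnectedSpace _ _))

theorem exists_Ioo_avoiding (y : Fin n → ℝ) (x₀ : ℝ) :
    ∃ ε > 0, ∀ k, y k ≠ x₀ → y k ∉ Set.Ioo (x₀ - ε) (x₀ + ε) := by
  have : (({z | ∃ k, y k = z} \ {x₀})ᶜ : Set ℝ) ∈ 𝓝 x₀ :=
    (((Set.finite_range y).subset Set.sdiff_subset).isClosed.isOpen_compl).mem_nhds (by simp)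
  obtain ⟨ε, hε, h⟩ := Metric.mem_nhds_iff.mp this
  rw [Real.ball_eq_Ioo] at h
  exact ⟨ε, hε, fun k hk hm => h hm ⟨⟨k, rfl⟩, hk⟩⟩

/-- A function with a primitive on each interval of `ℝ \ Y` is the sum of a primitive on `ℝ` and
of a step function with steps `J k` at the points of `Y`. -/
theorem HasPrimitiveOff.exists_jumps (hy : Function.Injective y) {W w : ℝ → ℂ}
    (h : HasPrimitiveOff y W w) :
    ∃ (c : ℂ) (J : Fin n → ℂ), ∀ᵐ x, W x = c + (∫ t in (0 : ℝ)..x, w t) +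
      ∑ k, if y k < x then J k else 0 := by
  choose ε hε hav using exists_Ioo_avoiding y
  have hr : ∀ k, ∃ c, ∀ᵐ x, x ∈ Set.Ioo (y k) (y k + ε (y k)) →
      W x = c + ∫ t in (0 : ℝ)..x, w t := fun k => by
    refine h.2 _ _ (by linarith [hε (y k)]) fun j hj => ?_
    exact hav (y k) j hj.1.ne' ⟨by linarith [hε (y k), hj.1], hj.2⟩
  have hl : ∀ k, ∃ c, ∀ᵐ x, x ∈ Set.Ioo (y k - ε (y k)) (y k) →
      W x = c + ∫ t in (0 : ℝ)..x, w t := fun k => by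
    refine h.2 _ _ (by linarith [hε (y k)]) fun j hj => ?_
    exact hav (y k) j hj.2.ne ⟨hj.1, by linarith [hε (y k), hj.2]⟩
  choose r hr using hr
  choose l hl using hl
  obtain ⟨c, hc⟩ := exists_ae_eq_const_of_locally
    (h := fun x => W x - (∫ t in (0 : ℝ)..x, w t) - ∑ k, if y k < x then r k - l k else 0) (by
      intro x₀
      refine ⟨ε x₀, hε x₀, ?_⟩
      -- near `x₀`, only the step at `x₀` itself is not constant
      have hstep : ∀ x ∈ Set.Ioo (x₀ - ε x₀) (x₀ + ε x₀), ∀ k, y k ≠ x₀ →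
          (y k < x ↔ y k < x₀) := by
        intro x hx k hk
        have h1 := hav x₀ k hk
        rw [Set.mem_Ioo, not_and_or, not_lt, not_lt] at h1
        rcases h1 with h1 | h1
        · exact ⟨fun _ => by linarith [hε x₀], fun _ => by linarith [hx.1]⟩
        · exact ⟨fun h2 => by linarith [hx.2], fun h2 => by linarith [hε x₀]⟩
      by_cases hx₀ : ∃ k, y k = x₀
      · obtain ⟨k, rfl⟩ := hx₀
        refine ⟨l k - ∑ j, if y j < y k then r j - l j else 0, ?_⟩
        have hne : ∀ᵐ x : ℝ, x ≠ y k := by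
          rw [ae_iff]; simp
        filter_upwards [hl k, hr k, hne] with x h1 h2 h3 hx
        rw [← Finset.add_sum_erase _ _ (Finset.mem_univ k),
          ← Finset.add_sum_erase (a := k) _ (fun j => if y j < y k then r j - l j else 0)
            (Finset.mem_univ k)]
        have hs : ∑ j ∈ Finset.univ.erase k, (if y j < x then r j - l j else 0) =
            ∑ j ∈ Finset.univ.erase k, if y j < y k then r j - l j else 0 := by
          refine Finset.sum_congr rfl fun j hj => ?_
          simp only [hstep x hx j fun h => Finset.ne_of_mem_erase hj (hy h)]
        rw [hs]
        rcases lt_or_gt_of_ne h3 with h4 | h4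
        · rw [h1 ⟨hx.1, h4⟩, if_neg (not_lt.mpr h4.le), if_neg (lt_irrefl _)]
          ring
        · rw [h2 ⟨h4, hx.2⟩, if_pos h4, if_neg (lt_irrefl _)]
          ring
      · push Not at hx₀
        obtain ⟨c, hc⟩ := h.2 (x₀ - ε x₀) (x₀ + ε x₀) (by linarith [hε x₀])
          fun k => hav x₀ k (hx₀ k)
        refine ⟨c - ∑ j, if y j < x₀ then r j - l j else 0, ?_⟩
        filter_upwards [hc] with x h1 hx
        rw [h1 hx, Finset.sum_congr rfl fun j _ => by
          rw [show (if y j < x then r j - l j else 0) = if y j < x₀ then r j - l j else 0 by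
            simp only [hstep x hx j (hx₀ j)]]]
        ring)
  refine ⟨c, fun k => r k - l k, ?_⟩
  filter_upwards [hc] with x hx
  rw [← hx]
  ring

/-- The one-sided limits of `c + ∫₀ˣ w + ∑ₖ J k 1_{y k < x}`. -/
theorem tendsto_of_ae_eq_jumps {W w : ℝ → ℂ} (hw : LocallyIntegrable w volume) {c : ℂ}
    {J : Fin n → ℂ} (h : ∀ᵐ x, W x = c + (∫ t in (0 : ℝ)..x, w t) + ∑ k, if y k < x then J k else 0)
    (x₀ : ℝ) :
    Tendsto W (𝓝[<] x₀ ⊓ ae volume) (𝓝 (c + (∫ t in (0 : ℝ)..x₀, w t) +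
      ∑ k, if y k < x₀ then J k else 0)) ∧
    Tendsto W (𝓝[>] x₀ ⊓ ae volume) (𝓝 (c + (∫ t in (0 : ℝ)..x₀, w t) +
      ∑ k, if y k ≤ x₀ then J k else 0)) := by
  have hG : Continuous fun x => c + ∫ t in (0 : ℝ)..x, w t :=
    continuous_const.add (intervalIntegral.continuous_primitive
      (intervalIntegrable_of_locallyIntegrable hw) 0)
  have hW : ∀ l : Filter ℝ, (fun x => c + (∫ t in (0 : ℝ)..x, w t) +
      ∑ k, if y k < x then J k else 0) =ᶠ[l ⊓ ae volume] W := fun l =>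
    (h.filter_mono inf_le_right).mono fun x hx => hx.symm
  refine ⟨Tendsto.congr' (hW _) (Tendsto.mono_left ?_ inf_le_left),
    Tendsto.congr' (hW _) (Tendsto.mono_left ?_ inf_le_left)⟩
  · refine ((hG.tendsto x₀).mono_left nhdsWithin_le_nhds).add (tendsto_finsetSum _ fun k _ => ?_)
    refine tendsto_nhds_of_eventually_eq ?_
    rcases lt_or_ge (y k) x₀ with hk | hk
    · filter_upwards [nhdsWithin_le_nhds (eventually_gt_nhds hk)] with x hx
      simp [hx, hk]
    · filter_upwards [self_mem_nhdsWithin] with x hx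
      simp [not_lt.mpr hk, not_lt.mpr ((le_of_lt hx).trans hk)]
  · refine ((hG.tendsto x₀).mono_left nhdsWithin_le_nhds).add (tendsto_finsetSum _ fun k _ => ?_)
    refine tendsto_nhds_of_eventually_eq ?_
    rcases le_or_gt (y k) x₀ with hk | hk
    · filter_upwards [self_mem_nhdsWithin] with x hx
      simp [lt_of_le_of_lt hk hx, hk]
    · filter_upwards [nhdsWithin_le_nhds (eventually_lt_nhds hk)] with x hx
      simp [not_le.mpr hk, not_lt.mpr hx.le]

theorem neBot_nhdsLT_inf_ae (x : ℝ) : (𝓝[<] x ⊓ ae (volume : Measure ℝ)).NeBot := by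
  rw [inf_neBot_iff]
  intro s hs t ht
  obtain ⟨l, hl, hls⟩ := (mem_nhdsLT_iff_exists_Ioo_subset).mp hs
  obtain ⟨z, hz, hzt⟩ := exists_mem_of_ae_of_lt (p := (· ∈ t)) ht hl
  exact ⟨z, hls hz, hzt⟩

theorem neBot_nhdsGT_inf_ae (x : ℝ) : (𝓝[>] x ⊓ ae (volume : Measure ℝ)).NeBot := by
  rw [inf_neBot_iff]
  intro s hs t ht
  obtain ⟨u, hu, hus⟩ := (mem_nhdsGT_iff_exists_Ioo_subset).mp hs
  obtain ⟨z, hz, hzt⟩ := exists_mem_of_ae_of_lt (p := (· ∈ t)) ht hu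
  exact ⟨z, hus hz, hzt⟩

/-- A function in `Lᵖ` is not bounded below near `∞`. -/
theorem not_ae_le_norm_atTop {p : ENNReal} (hp : p ≠ 0) (hp' : p ≠ ⊤) {W : ℝ → ℂ}
    (hW : MemLp W p volume) {δ : ℝ} (hδ : 0 < δ) (A : ℝ) :
    ¬ ∀ᵐ x, A < x → δ ≤ ‖W x‖ := by
  intro h
  have h1 := hW.meas_ge_lt_top hp hp' (ε := ⟨δ, hδ.le⟩)
    (fun h0 => hδ.ne' (congrArg NNReal.toReal h0))
  have h2 : volume (Set.Ioi A) ≤ volume {x | (⟨δ, hδ.le⟩ : NNReal) ≤ ‖W x‖₊} := by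
    refine measure_mono_ae ?_
    filter_upwards [h] with x hx hx'
    exact hx hx'
  rw [Real.volume_Ioi] at h2
  exact absurd h1 (not_lt.mpr h2)

/-- A function in `Lᵖ` is not bounded below near `-∞`. -/
theorem not_ae_le_norm_atBot {p : ENNReal} (hp : p ≠ 0) (hp' : p ≠ ⊤) {W : ℝ → ℂ}
    (hW : MemLp W p volume) {δ : ℝ} (hδ : 0 < δ) (A : ℝ) :
    ¬ ∀ᵐ x, x < A → δ ≤ ‖W x‖ := by
  intro h
  have h1 := hW.meas_ge_lt_top hp hp' (ε := ⟨δ, hδ.le⟩)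
    (fun h0 => hδ.ne' (congrArg NNReal.toReal h0))
  have h2 : volume (Set.Iio A) ≤ volume {x | (⟨δ, hδ.le⟩ : NNReal) ≤ ‖W x‖₊} := by
    refine measure_mono_ae ?_
    filter_upwards [h] with x hx hx'
    exact hx hx'
  rw [Real.volume_Iio] at h2
  exact absurd h1 (not_lt.mpr h2)

/-- The fundamental theorem of calculus on `ℝ \ Y`. Integrability of `W` makes its limits at `±∞`
vanish. -/
theorem integral_eq_neg_sum_jumps {W w : ℝ → ℂ} (hW : Integrable W) (hw : Integrable w) {c : ℂ}
    {J : Fin n → ℂ}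
    (h : ∀ᵐ x, W x = c + (∫ t in (0 : ℝ)..x, w t) + ∑ k, if y k < x then J k else 0) :
    ∫ x, w x = - ∑ k, J k := by
  have hW1 : MemLp W 1 volume := memLp_one_iff_integrable.mpr hW
  have htop : c + (∫ x in Set.Ioi 0, w x) + ∑ k, J k = 0 := by
    by_contra hne
    have hpos := norm_pos_iff.mpr hne
    have ht : Tendsto (fun x => c + (∫ t in (0 : ℝ)..x, w t) + ∑ k, J k) atTop
        (𝓝 (c + (∫ x in Set.Ioi 0, w x) + ∑ k, J k)) :=
      (tendsto_const_nhds.add (intervalIntegral_tendsto_integral_Ioi 0 hw.integrableOn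
        tendsto_id)).add tendsto_const_nhds
    have h1 := ht.norm.eventually (lt_mem_nhds (half_lt_self hpos))
    have h2 : ∀ᶠ x in atTop, ∀ k, y k < x := eventually_all.mpr fun k => eventually_gt_atTop (y k)
    obtain ⟨A, hA⟩ := eventually_atTop.mp (h1.and h2)
    refine not_ae_le_norm_atTop one_ne_zero ENNReal.one_ne_top hW1 (half_pos hpos) A ?_
    filter_upwards [h] with x hx hAx
    rw [hx, Finset.sum_congr rfl fun k _ => if_pos ((hA x hAx.le).2 k)]
    exact (hA x hAx.le).1.le
  have hbot : c - (∫ x in Set.Iic 0, w x) = 0 := by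
    by_contra hne
    have hpos := norm_pos_iff.mpr hne
    have ht : Tendsto (fun x => c - ∫ t in x..(0 : ℝ), w t) atBot
        (𝓝 (c - ∫ x in Set.Iic 0, w x)) :=
      tendsto_const_nhds.sub (intervalIntegral_tendsto_integral_Iic 0 hw.integrableOn tendsto_id)
    have h1 := ht.norm.eventually (lt_mem_nhds (half_lt_self hpos))
    have h2 : ∀ᶠ x in atBot, ∀ k, ¬ y k < x := eventually_all.mpr fun k =>
      (eventually_le_atBot (y k)).mono fun x hx => not_lt.mpr hx
    obtain ⟨A, hA⟩ := eventually_atBot.mp (h1.and h2)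
    refine not_ae_le_norm_atBot one_ne_zero ENNReal.one_ne_top hW1 (half_pos hpos) A ?_
    filter_upwards [h] with x hx hAx
    rw [hx, Finset.sum_congr rfl fun k _ => if_neg ((hA x hAx.le).2 k), Finset.sum_const_zero,
      add_zero, intervalIntegral.integral_symm, ← sub_eq_add_neg]
    exact (hA x hAx.le).1.le
  rw [← intervalIntegral.integral_Iic_add_Ioi (b := 0) hw.integrableOn hw.integrableOn]
  linear_combination htop - hbot

/-- The constants `J k` are the jumps. -/
theorem jump_eq_of_ae_eq_jumps (hy : Function.Injective y) {W w : ℝ → ℂ}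
    (hw : LocallyIntegrable w volume) {c : ℂ} {J : Fin n → ℂ}
    (h : ∀ᵐ x, W x = c + (∫ t in (0 : ℝ)..x, w t) + ∑ k, if y k < x then J k else 0) {k : Fin n}
    {l r : ℂ} (hl : Tendsto W (𝓝[<] (y k) ⊓ ae volume) (𝓝 l))
    (hr : Tendsto W (𝓝[>] (y k) ⊓ ae volume) (𝓝 r)) : J k = r - l := by
  have ht := tendsto_of_ae_eq_jumps hw h (y k)
  have := neBot_nhdsLT_inf_ae (y k)
  have := neBot_nhdsGT_inf_ae (y k)
  rw [tendsto_nhds_unique hl ht.1, tendsto_nhds_unique hr ht.2, add_sub_add_left_eq_sub,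
    ← Finset.sum_sub_distrib, Finset.sum_eq_single k]
  · simp
  · intro j _ hj
    have : y j ≠ y k := fun h => hj (hy h)
    simp only [this.le_iff_lt, sub_self]
  · simp

/-- The fundamental theorem of calculus on `ℝ \ Y`, in terms of one-sided limits. -/
theorem HasPrimitiveOff.integral_eq (hy : Function.Injective y) {W w : ℝ → ℂ}
    (h : HasPrimitiveOff y W w) (hW : Integrable W) (hw : Integrable w) {l r : Fin n → ℂ}
    (hl : ∀ k, Tendsto W (𝓝[<] (y k) ⊓ ae volume) (𝓝 (l k)))
    (hr : ∀ k, Tendsto W (𝓝[>] (y k) ⊓ ae volume) (𝓝 (r k))) :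
    ∫ x, w x = - ∑ k, (r k - l k) := by
  obtain ⟨c, J, hJ⟩ := h.exists_jumps hy
  rw [integral_eq_neg_sum_jumps hW hw hJ]
  congr 1
  exact Finset.sum_congr rfl fun k _ => jump_eq_of_ae_eq_jumps hy h.1 hJ (hl k) (hr k)

end

section

/-! ### `H¹(ℝ \ Y; ℂ²)`: traces and Green's formula -/

variable {n : ℕ} {y : Fin n → ℝ}

theorem memLp_coord (f : L2) (s : Fin 2) : MemLp (fun x => f x s) 2 (volume : Measure ℝ) :=
  (EuclideanSpace.proj (𝕜 := ℂ) s).comp_memLp' (Lp.memLp f)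

theorem locallyIntegrable_coord (f : L2) (s : Fin 2) :
    LocallyIntegrable (fun x => f x s) (volume : Measure ℝ) :=
  (memLp_coord f s).locallyIntegrable (by norm_num)

theorem integral_smul_coord (f : L2) {φ : ℝ → ℝ} (hφ : Continuous φ) (hc : HasCompactSupport φ)
    (s : Fin 2) : (∫ x, φ x • f x) s = ∫ x, φ x • f x s := by
  have := (EuclideanSpace.proj s : C2 →L[ℂ] ℂ).integral_comp_comm
    (integrable_smul_L2 f hφ hc)
  simpa using this.symm

theorem IsWeakDeriv.hasPrimitiveOff {f g : L2} (h : IsWeakDeriv y f g) (s : Fin 2) :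
    HasPrimitiveOff y (fun x => f x s) (fun x => g x s) := by
  refine .of_integral_deriv_smul (locallyIntegrable_coord f s) (locallyIntegrable_coord g s)
    fun φ hφ hc ht => ?_
  have hd : Continuous (deriv φ) := hφ.continuous_deriv (by simp)
  rw [← integral_smul_coord f hd hc.deriv, ← integral_smul_coord g hφ.continuous hc,
    h φ hφ hc ht]
  rfl

theorem eventually_eq_zero_of_tsupport_subset_compl {φ : ℝ → ℝ}
    (ht : tsupport φ ⊆ (Set.range y)ᶜ) (k : Fin n) : ∀ᶠ x in 𝓝 (y k), φ x = 0 := by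
  have : (tsupport φ)ᶜ ∈ 𝓝 (y k) :=
    (isClosed_tsupport φ).isOpen_compl.mem_nhds fun h => ht h ⟨k, rfl⟩
  filter_upwards [this] with x hx using image_eq_zero_of_notMem_tsupport hx

/-- The boundary terms vanish when the fundamental theorem of calculus on `ℝ \ Y` is applied to the
product with a test function. -/
theorem isWeakDeriv_of_hasPrimitiveOff (hy : Function.Injective y) {f g : L2}
    (h : ∀ s, HasPrimitiveOff y (fun x => f x s) (fun x => g x s)) : IsWeakDeriv y f g := by
  intro φ hφ hc ht
  have hd : Continuous (deriv φ) := hφ.continuous_deriv (by simp)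
  ext s
  have hcoord : (-∫ x, φ x • g x) s = -((∫ x, φ x • g x) s) := rfl
  rw [hcoord, integral_smul_coord f hd hc.deriv, integral_smul_coord g hφ.continuous hc]
  have i1 : Integrable (fun x => deriv φ x • f x s) :=
    (locallyIntegrable_coord f s).integrable_smul_left_of_hasCompactSupport hd hc.deriv
  have i2 : Integrable (fun x => φ x • g x s) :=
    (locallyIntegrable_coord g s).integrable_smul_left_of_hasCompactSupport hφ.continuous hc
  have i3 : Integrable (fun x => φ x • f x s) :=
    (locallyIntegrable_coord f s).integrable_smul_left_of_hasCompactSupport hφ.continuous hc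
  simp only [Complex.real_smul] at i1 i2 i3 ⊢
  have hz : ∀ l : Filter ℝ, ∀ k, l ≤ 𝓝 (y k) →
      Tendsto (fun x => (φ x : ℂ) * f x s) (l ⊓ ae volume) (𝓝 0) := fun l k hl => by
    refine tendsto_nhds_of_eventually_eq ?_
    filter_upwards [(eventually_eq_zero_of_tsupport_subset_compl ht k).filter_mono
      (inf_le_left.trans hl)] with x hx
    simp [hx]
  have := ((HasPrimitiveOff.ofReal hφ).mul (h s) (i1.add i2).locallyIntegrable).integral_eq hy i3 (i1.add i2)
    (fun k => hz _ k nhdsWithin_le_nhds) (fun k => hz _ k nhdsWithin_le_nhds)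
  rw [integral_add i1 i2] at this
  simp only [sub_self, Finset.sum_const_zero, neg_zero] at this
  exact eq_neg_of_add_eq_zero_left this

theorem tendsto_C2_iff {l : Filter ℝ} {f : ℝ → C2} {a : C2} :
    Tendsto f l (𝓝 a) ↔ ∀ s, Tendsto (fun x => f x s) l (𝓝 (a s)) := by
  constructor
  · intro h s
    exact ((EuclideanSpace.proj s : C2 →L[ℂ] ℂ).continuous.tendsto a).comp h
  · intro h
    exact ((PiLp.continuous_toLp 2 fun _ : Fin 2 => ℂ).tendsto _).comp (tendsto_pi_nhds.mpr h)

/-- Functions in `H¹(ℝ \ Y; ℂ²)` have traces. -/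
theorem IsWeakDeriv.exists_hasSideLimits (hy : Function.Injective y) {f g : L2}
    (h : IsWeakDeriv y f g) : ∃ L R, HasSideLimits y f L R := by
  choose c J hJ using fun s => (h.hasPrimitiveOff s).exists_jumps hy
  have ht := fun s => tendsto_of_ae_eq_jumps (locallyIntegrable_coord g s) (hJ s)
  exact ⟨fun k => WithLp.toLp 2 fun s => _, fun k => WithLp.toLp 2 fun s => _,
    fun k => ⟨tendsto_C2_iff.mpr fun s => (ht s (y k)).1, tendsto_C2_iff.mpr fun s => (ht s (y k)).2⟩⟩

theorem HasSideLimits.unique {f : ℝ → C2} {L R L' R' : Fin n → C2} (h : HasSideLimits y f L R)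
    (h' : HasSideLimits y f L' R') : L = L' ∧ R = R' := by
  refine ⟨funext fun k => ?_, funext fun k => ?_⟩
  · have := neBot_nhdsLT_inf_ae (y k)
    exact tendsto_nhds_unique (h k).1 (h' k).1
  · have := neBot_nhdsGT_inf_ae (y k)
    exact tendsto_nhds_unique (h k).2 (h' k).2

theorem HasSideLimits.congr {f f' : ℝ → C2} {L R : Fin n → C2} (h : HasSideLimits y f L R)
    (hf : f =ᵐ[volume] f') : HasSideLimits y f' L R := fun k =>
  ⟨(h k).1.congr' (hf.filter_mono inf_le_right), (h k).2.congr' (hf.filter_mono inf_le_right)⟩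

/-- Green's formula. -/
theorem inner_add_inner_eq_neg_sum (hy : Function.Injective y) {f f' g g' : L2}
    (hf : IsWeakDeriv y f f') (hg : IsWeakDeriv y g g') {L R L' R' : Fin n → C2}
    (hl : HasSideLimits y f L R) (hl' : HasSideLimits y g L' R') :
    ⟪f', g⟫_ℂ + ⟪f, g'⟫_ℂ = - ∑ k, (⟪R k, R' k⟫_ℂ - ⟪L k, L' k⟫_ℂ) := by
  have hmul : ∀ (u v : L2) s, Integrable (fun x => (starRingEnd ℂ) (u x s) * v x s) := fun u v s =>
    MemLp.integrable_mul (p := 2) (q := 2) (memLp_coord u s).star (memLp_coord v s)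
  have hin : ∀ u v : L2, ⟪u, v⟫_ℂ = ∑ s, ∫ x, (starRingEnd ℂ) (u x s) * v x s := by
    intro u v
    rw [L2.inner_def, ← integral_finsetSum _ fun s _ => hmul u v s]
    refine integral_congr_ae (Eventually.of_forall fun x => ?_)
    simp only [PiLp.inner_apply, RCLike.inner_apply, mul_comm]
  have hin' : ∀ u v : C2, ⟪u, v⟫_ℂ = ∑ s, (starRingEnd ℂ) (u s) * v s := by
    intro u v
    simp only [PiLp.inner_apply, RCLike.inner_apply, mul_comm]
  have main : ∀ s, (∫ x, (starRingEnd ℂ) (f' x s) * g x s) +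
      (∫ x, (starRingEnd ℂ) (f x s) * g' x s) =
      - ∑ k, ((starRingEnd ℂ) (R k s) * R' k s - (starRingEnd ℂ) (L k s) * L' k s) := by
    intro s
    rw [← integral_add (hmul f' g s) (hmul f g' s)]
    refine ((hf.hasPrimitiveOff s).conj.mul (hg.hasPrimitiveOff s)
      ((hmul f' g s).add (hmul f g' s)).locallyIntegrable).integral_eq hy (hmul f g s)
      ((hmul f' g s).add (hmul f g' s)) (fun k => ?_) (fun k => ?_)
    · exact (((Complex.continuous_conj.tendsto _).comp (tendsto_C2_iff.mp (hl k).1 s))).mul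
        (tendsto_C2_iff.mp (hl' k).1 s)
    · exact (((Complex.continuous_conj.tendsto _).comp (tendsto_C2_iff.mp (hl k).2 s))).mul
        (tendsto_C2_iff.mp (hl' k).2 s)
  simp only [hin, hin']
  rw [← Finset.sum_add_distrib, Finset.sum_congr rfl fun s _ => main s, Finset.sum_neg_distrib,
    Finset.sum_comm]
  simp only [Finset.sum_sub_distrib]

/-! ### Multiplication by constant matrices -/

/-- The action of a matrix on `ℂ²`. -/
noncomputable abbrev act (M : Matrix (Fin 2) (Fin 2) ℂ) : C2 →L[ℂ] C2 := Matrix.toEuclideanCLM (𝕜 := ℂ) M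

theorem act_apply (M : Matrix (Fin 2) (Fin 2) ℂ) (v : C2) (s : Fin 2) :
    act M v s = M s 0 * v 0 + M s 1 * v 1 := by
  simp [Matrix.mulVec, dotProduct, Fin.sum_univ_two]

theorem coeFn_mulL2 (M : Matrix (Fin 2) (Fin 2) ℂ) (f : L2) :
    mulL2 M f =ᵐ[volume] fun x => act M (f x) :=
  ContinuousLinearMap.coeFn_compLpL _ _

theorem mulL2_mulL2 (M N : Matrix (Fin 2) (Fin 2) ℂ) (f : L2) :
    mulL2 M (mulL2 N f) = mulL2 (M * N) f := by
  refine Lp.ext ?_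
  filter_upwards [coeFn_mulL2 M (mulL2 N f), coeFn_mulL2 N f, coeFn_mulL2 (M * N) f] with x h1 h2 h3
  rw [h1, h2, h3, act, act, act, map_mul]
  rfl

theorem mulL2_one (f : L2) : mulL2 1 f = f := by
  refine Lp.ext ?_
  filter_upwards [coeFn_mulL2 1 f] with x h1
  rw [h1, act, map_one]
  rfl

theorem mulL2_smul (c : ℂ) (M : Matrix (Fin 2) (Fin 2) ℂ) (f : L2) :
    mulL2 (c • M) f = c • mulL2 M f := by
  rw [mulL2, map_smul, ContinuousLinearMap.smul_compLpL]; rfl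

theorem inner_mulL2_left (M : Matrix (Fin 2) (Fin 2) ℂ) (f g : L2) :
    ⟪mulL2 M f, g⟫_ℂ = ⟪f, mulL2 M.conjTranspose g⟫_ℂ := by
  rw [L2.inner_def, L2.inner_def]
  refine integral_congr_ae ?_
  filter_upwards [coeFn_mulL2 M f, coeFn_mulL2 M.conjTranspose g] with x h1 h2
  rw [h1, h2, act, act, ← Matrix.star_eq_conjTranspose, map_star,
    ContinuousLinearMap.star_eq_adjoint, ContinuousLinearMap.adjoint_inner_right]

theorem IsWeakDeriv.mulL2 (M : Matrix (Fin 2) (Fin 2) ℂ) {f g : L2} (h : IsWeakDeriv y f g) :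
    IsWeakDeriv y (mulL2 M f) (mulL2 M g) := by
  intro φ hφ hc ht
  have hd : Continuous (deriv φ) := hφ.continuous_deriv (by simp)
  have e : ∀ (u : L2) (θ : ℝ → ℝ), Continuous θ → HasCompactSupport θ →
      ∫ x, θ x • DiracPoint.mulL2 M u x = act M (∫ x, θ x • u x) := by
    intro u θ h1 h2
    rw [← (act M).integral_comp_comm (integrable_smul_L2 u h1 h2)]
    refine integral_congr_ae ?_
    filter_upwards [coeFn_mulL2 M u] with x hx
    rw [hx, ← Complex.coe_smul, ← Complex.coe_smul, map_smul]
  rw [e f _ hd hc.deriv, e g _ hφ.continuous hc, h φ hφ hc ht, map_neg]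

theorem HasSideLimits.mulL2 (M : Matrix (Fin 2) (Fin 2) ℂ) {f : L2} {L R : Fin n → C2}
    (h : HasSideLimits y f L R) :
    HasSideLimits y (mulL2 M f) (fun k => act M (L k)) (fun k => act M (R k)) := by
  have : HasSideLimits y (fun x => act M (f x)) (fun k => act M (L k)) (fun k => act M (R k)) :=
    fun k => ⟨((act M).continuous.tendsto _).comp (h k).1, ((act M).continuous.tendsto _).comp (h k).2⟩
  exact this.congr (coeFn_mulL2 M f).symm

/-! ### Elements of `H¹(ℝ \ Y; ℂ²)` with prescribed traces -/

theorem memLp_ofReal_smul {θ : ℝ → ℝ} (h1 : Continuous θ) (h2 : HasCompactSupport θ) (v : C2) :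
    MemLp (fun x => (θ x : ℂ) • v) 2 (volume : Measure ℝ) :=
  ((Complex.continuous_ofReal.comp h1).smul continuous_const).memLp_of_hasCompactSupport
    (HasCompactSupport.smul_right (f := fun x => (θ x : ℂ)) (f' := fun _ => v)
      (h2.comp_left (g := Complex.ofReal) Complex.ofReal_zero))

/-- The jump at `y k`, localized near `y k` by a cutoff `χ`, is an element of `H¹(ℝ \ Y; ℂ²)`. -/
theorem exists_isWeakDeriv_step (hy : Function.Injective y) {χ : ℝ → ℝ} (hχ : ContDiff ℝ ∞ χ)
    (hc : HasCompactSupport χ) (k : Fin n) (a b : C2) :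
    ∃ f f' : L2, IsWeakDeriv y f f' ∧
      f =ᵐ[volume] fun x => (χ x : ℂ) • (if x ≤ y k then a else b) := by
  have hd : Continuous (deriv χ) := hχ.continuous_deriv (by simp)
  have hmem : ∀ θ : ℝ → ℝ, Continuous θ → HasCompactSupport θ →
      MemLp (fun x => (θ x : ℂ) • (if x ≤ y k then a else b)) 2 (volume : Measure ℝ) := by
    intro θ h1 h2
    have hm := memLp_ofReal_smul h1 h2
    refine (((hm a).indicator (measurableSet_Iic (a := y k))).add
      ((hm b).indicator (measurableSet_Iic (a := y k)).compl)).ae_eq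
      (Eventually.of_forall fun x => ?_)
    by_cases hx : x ≤ y k <;> simp [hx]
  refine ⟨(hmem χ hχ.continuous hc).toLp, (hmem (deriv χ) hd hc.deriv).toLp,
    isWeakDeriv_of_hasPrimitiveOff hy fun s => ?_, MemLp.coeFn_toLp _⟩
  have e2 : ((fun x => ((deriv χ x : ℝ) : ℂ) * (if x ≤ y k then a s else b s) + (χ x : ℂ) * 0)) =ᵐ[
      volume] fun x => (hmem (deriv χ) hd hc.deriv).toLp _ x s := by
    filter_upwards [(hmem (deriv χ) hd hc.deriv).coeFn_toLp] with x hx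
    rw [hx]
    split_ifs <;> simp
  refine ((HasPrimitiveOff.ofReal hχ).mul (.step k (a s) (b s)) ?_).congr ?_ e2
  · exact (locallyIntegrable_coord _ s).congr e2.symm
  · filter_upwards [(hmem χ hχ.continuous hc).coeFn_toLp] with x hx
    rw [hx]
    split_ifs <;> simp

/-- All one-sided limits are attained in `H¹(ℝ \ Y; ℂ²)`. -/
theorem exists_isWeakDeriv_hasSideLimits (hy : Function.Injective y) (L R : Fin n → C2) :
    ∃ f f' : L2, IsWeakDeriv y f f' ∧ HasSideLimits y f L R := by
  choose ε hε hav using exists_Ioo_avoiding y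
  let χ : ∀ k, ContDiffBump (y k) := fun k =>
    ⟨ε (y k) / 4, ε (y k) / 2, by linarith [hε (y k)], by linarith [hε (y k)]⟩
  have one : ∀ k, ∃ f f' : L2, IsWeakDeriv y f f' ∧
      HasSideLimits y f (Pi.single k (L k)) (Pi.single k (R k)) := by
    intro k
    obtain ⟨f, f', hf, he⟩ := exists_isWeakDeriv_step hy (χ k).contDiff (χ k).hasCompactSupport k
      (L k) (R k)
    refine ⟨f, f', hf, HasSideLimits.congr (fun j => ?_) he.symm⟩
    have hj : (∀ᶠ x in 𝓝 (y j), χ k x = 1) ∧ j = k ∨ (∀ᶠ x in 𝓝 (y j), χ k x = 0) ∧ j ≠ k := by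
      by_cases hjk : j = k
      · subst hjk
        exact Or.inl ⟨(χ j).eventuallyEq_one, rfl⟩
      · refine Or.inr ⟨?_, hjk⟩
        have h1 := hav (y k) j fun h => hjk (hy h)
        have h2 : (Metric.closedBall (y k) (ε (y k) / 2))ᶜ ∈ 𝓝 (y j) := by
          refine Metric.isClosed_closedBall.isOpen_compl.mem_nhds fun h => h1 ?_
          rw [Real.closedBall_eq_Icc] at h
          exact ⟨by linarith [h.1, hε (y k)], by linarith [h.2, hε (y k)]⟩
        filter_upwards [h2] with x hx
        refine (χ k).zero_of_le_dist ?_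
        rw [Set.mem_compl_iff, Metric.mem_closedBall, not_le] at hx
        exact hx.le
    rcases hj with ⟨h1, rfl⟩ | ⟨h1, h2⟩
    · constructor
      · refine tendsto_nhds_of_eventually_eq (Eventually.filter_mono inf_le_left ?_)
        filter_upwards [nhdsWithin_le_nhds h1, self_mem_nhdsWithin] with x hx hx'
        simp [hx, (Set.mem_Iio.mp hx').le]
      · refine tendsto_nhds_of_eventually_eq (Eventually.filter_mono inf_le_left ?_)
        filter_upwards [nhdsWithin_le_nhds h1, self_mem_nhdsWithin] with x hx hx'
        simp [hx, not_le.mpr (Set.mem_Ioi.mp hx')]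
    · constructor
      · refine tendsto_nhds_of_eventually_eq (Eventually.filter_mono inf_le_left ?_)
        filter_upwards [nhdsWithin_le_nhds h1] with x hx
        simp [hx, h2]
      · refine tendsto_nhds_of_eventually_eq (Eventually.filter_mono inf_le_left ?_)
        filter_upwards [nhdsWithin_le_nhds h1] with x hx
        simp [hx, h2]
  choose f f' hf hs using one
  have hsum : ∀ t : Finset (Fin n), IsWeakDeriv y (∑ k ∈ t, f k) (∑ k ∈ t, f' k) ∧
      HasSideLimits y (∑ k ∈ t, f k : L2) (∑ k ∈ t, Pi.single k (L k))
        (∑ k ∈ t, Pi.single k (R k)) := by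
    intro t
    induction t using Finset.induction_on with
    | empty => exact ⟨by simpa using IsWeakDeriv.zero, by simpa using HasSideLimits.zero⟩
    | insert k t hk ih =>
      rw [Finset.sum_insert hk, Finset.sum_insert hk, Finset.sum_insert hk, Finset.sum_insert hk]
      exact ⟨(hf k).add ih.1, (hs k).add ih.2⟩
  have := hsum Finset.univ
  rw [Finset.univ_sum_single, Finset.univ_sum_single] at this
  exact ⟨_, _, this⟩

/-- Every pair in `ℂ²ⁿ × ℂ²ⁿ` is `(τΨ, ρΨ)` for one-sided limits of some `Ψ`. -/
theorem exists_tau_rho (t r : Bdry n) : ∃ L R : Fin n → C2, tau L R = t ∧ rho L R = r := by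
  let j : Fin n → Fin 2 → ℂ := fun k s => -Complex.I * r (k, 1 - s)
  refine ⟨fun k => WithLp.toLp 2 fun s => t (k, s) - j k s / 2,
    fun k => WithLp.toLp 2 fun s => t (k, s) + j k s / 2, ?_, ?_⟩
  · ext ⟨k, s⟩
    simp only [tau]
    ring
  · ext ⟨k, s⟩
    have hI := Complex.I_mul_I
    fin_cases s <;>
    · simp [rho, sigma1, Matrix.mulVec, dotProduct, Fin.sum_univ_two, j]
      linear_combination (-r (k, _)) * hI

/-- Test functions with support in `ℝ \ Y`, with values on a line of `ℂ²`. -/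
theorem exists_testFunction (hy : Function.Injective y) {φ : ℝ → ℝ} (hφ : ContDiff ℝ ∞ φ)
    (hc : HasCompactSupport φ) (ht : tsupport φ ⊆ (Set.range y)ᶜ) (e : C2) :
    ∃ f f' : L2, IsWeakDeriv y f f' ∧ HasSideLimits y f 0 0 ∧
      (∀ g : L2, ⟪f, g⟫_ℂ = ⟪e, ∫ x, φ x • g x⟫_ℂ) ∧
      ∀ g : L2, ⟪f', g⟫_ℂ = ⟪e, ∫ x, deriv φ x • g x⟫_ℂ := by
  have hd : Continuous (deriv φ) := hφ.continuous_deriv (by simp)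
  have hmem : ∀ θ : ℝ → ℝ, Continuous θ → HasCompactSupport θ →
      MemLp (fun x => (θ x : ℂ) • e) 2 (volume : Measure ℝ) := fun θ h1 h2 =>
    memLp_ofReal_smul h1 h2 e
  have hin : ∀ (θ : ℝ → ℝ) (h1 : Continuous θ) (h2 : HasCompactSupport θ) (g : L2),
      ⟪(hmem θ h1 h2).toLp, g⟫_ℂ = ⟪e, ∫ x, θ x • g x⟫_ℂ := by
    intro θ h1 h2 g
    rw [L2.inner_def, ← integral_inner (integrable_smul_L2 g h1 h2)]
    refine integral_congr_ae ?_
    filter_upwards [(hmem θ h1 h2).coeFn_toLp] with x hx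
    rw [hx, inner_smul_left, Complex.conj_ofReal, ← Complex.coe_smul, inner_smul_right]
  refine ⟨(hmem φ hφ.continuous hc).toLp, (hmem (deriv φ) hd hc.deriv).toLp,
    isWeakDeriv_of_hasPrimitiveOff hy fun s => ?_, ?_, hin _ hφ.continuous hc, hin _ hd hc.deriv⟩
  · refine ((HasPrimitiveOff.ofReal hφ).const_mul (e s)).congr ?_ ?_
    · filter_upwards [(hmem φ hφ.continuous hc).coeFn_toLp] with x hx
      rw [hx]; simp [mul_comm]
    · filter_upwards [(hmem (deriv φ) hd hc.deriv).coeFn_toLp] with x hx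
      rw [hx]; simp [mul_comm]
  · refine HasSideLimits.congr (fun k => ?_) (hmem φ hφ.continuous hc).coeFn_toLp.symm
    have hz := eventually_eq_zero_of_tsupport_subset_compl ht k
    constructor <;>
    · refine tendsto_nhds_of_eventually_eq (Eventually.filter_mono
        (inf_le_left.trans nhdsWithin_le_nhds) ?_)
      filter_upwards [hz] with x hx
      simp [hx]

end

section

/-! ### Self-adjoint operators and their squares -/

section SelfAdjoint

variable {E : Type*} [NormedAddCommGroup E] [InnerProductSpace ℂ E] [CompleteSpace E]

theorem dense_domain_of_orthogonal {A : E →ₗ.[ℂ] E}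
    (hd : ∀ x, (∀ a b, (a, b) ∈ A.graph → ⟪a, x⟫_ℂ = 0) → x = 0) : Dense (A.domain : Set E) := by
  rw [Submodule.dense_iff_topologicalClosure_eq_top, Submodule.topologicalClosure_eq_top_iff,
    Submodule.eq_bot_iff]
  intro x hx
  exact hd x fun a b hab => (Submodule.mem_orthogonal _ _).mp hx a (LinearPMap.mem_domain_of_mem_graph hab)

theorem isSelfAdjoint_of_mem_graph_iff {A : E →ₗ.[ℂ] E}
    (hd : ∀ x, (∀ a b, (a, b) ∈ A.graph → ⟪a, x⟫_ℂ = 0) → x = 0)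
    (h : ∀ x z, (x, z) ∈ A.graph ↔ ∀ a b, (a, b) ∈ A.graph → ⟪b, x⟫_ℂ = ⟪a, z⟫_ℂ) :
    IsSelfAdjoint A := by
  rw [LinearPMap.isSelfAdjoint_def]
  refine LinearPMap.eq_of_eq_graph ?_
  rw [LinearPMap.adjoint_graph_eq_graph_adjoint (dense_domain_of_orthogonal hd)]
  ext ⟨x, z⟩
  rw [Submodule.mem_adjoint_iff, h]
  simp only [sub_eq_zero]

theorem mem_graph_iff_of_isSelfAdjoint {A : E →ₗ.[ℂ] E} (hA : IsSelfAdjoint A) (x z : E) :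
    (x, z) ∈ A.graph ↔ ∀ a b, (a, b) ∈ A.graph → ⟪b, x⟫_ℂ = ⟪a, z⟫_ℂ := by
  conv_lhs => rw [← LinearPMap.isSelfAdjoint_def.mp hA,
    LinearPMap.adjoint_graph_eq_graph_adjoint hA.dense_domain, Submodule.mem_adjoint_iff]
  simp only [sub_eq_zero]

/-- `1 + Q²` is onto: `(v, 0)` is the sum of a vector `(x, Q x)` of the closed graph of `Q` and of
a vector orthogonal to the graph, which is `(Q w, -w)` for some `w`. -/
theorem exists_add_sq_eq {Q : E →ₗ.[ℂ] E} (hQ : IsSelfAdjoint Q) (v : E) :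
    ∃ x w z, (x, w) ∈ Q.graph ∧ (w, z) ∈ Q.graph ∧ x + z = v := by
  let e := (WithLp.linearEquiv 2 ℂ (E × E)).symm
  let K : Submodule ℂ (WithLp 2 (E × E)) := Q.graph.map e.toLinearMap
  have hK : IsClosed (K : Set (WithLp 2 (E × E))) := by
    have : (K : Set (WithLp 2 (E × E))) = (WithLp.linearEquiv 2 ℂ (E × E)) ⁻¹' (Q.graph : Set (E × E)) := by
      rw [Submodule.map_coe]
      exact LinearEquiv.image_symm_eq_preimage _ _
    rw [this]
    exact hQ.isClosed.preimage (WithLp.prod_continuous_ofLp _ _ _)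
  have : CompleteSpace K := hK.completeSpace_coe
  obtain ⟨p, hp, q, hq, hpq⟩ := K.exists_add_mem_mem_orthogonal (WithLp.toLp 2 (v, 0))
  obtain ⟨⟨x, w⟩, hxw, rfl⟩ := hp
  have h1 : v = x + q.fst := congrArg WithLp.fst hpq
  have h2 : (0 : E) = w + q.snd := congrArg WithLp.snd hpq
  refine ⟨x, w, q.fst, hxw, ?_, h1.symm⟩
  have hw : q.snd = -w := eq_neg_of_add_eq_zero_right h2.symm
  rw [mem_graph_iff_of_isSelfAdjoint hQ]
  intro a b hab
  have h3 := (Submodule.mem_orthogonal _ _).mp hq (WithLp.toLp 2 (a, b)) ⟨(a, b), hab, rfl⟩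
  rw [WithLp.prod_inner_apply] at h3
  change ⟪a, q.fst⟫_ℂ + ⟪b, q.snd⟫_ℂ = 0 at h3
  rw [hw, inner_neg_right] at h3
  linear_combination -h3

/-- The square of a self-adjoint operator is self-adjoint. -/
theorem isSelfAdjoint_of_sq {Q S : E →ₗ.[ℂ] E} (hQ : IsSelfAdjoint Q)
    (hS : ∀ x z, (x, z) ∈ S.graph ↔ ∃ w, (x, w) ∈ Q.graph ∧ (w, z) ∈ Q.graph) :
    IsSelfAdjoint S := by
  have hsymm := fun x z => mem_graph_iff_of_isSelfAdjoint hQ x z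
  refine isSelfAdjoint_of_mem_graph_iff (fun v hv => ?_) fun u v => ⟨fun huv a b hab => ?_,
    fun h => ?_⟩
  · obtain ⟨x, w, z, hxw, hwz, rfl⟩ := exists_add_sq_eq hQ v
    have h1 := hv x z ((hS x z).mpr ⟨w, hxw, hwz⟩)
    rw [inner_add_right, ← (hsymm w z).mp hwz x w hxw, inner_self_eq_norm_sq_to_K,
      inner_self_eq_norm_sq_to_K] at h1
    norm_cast at h1
    rw [RCLike.ofReal_eq_zero] at h1
    have hx : ‖x‖ = 0 := by nlinarith [sq_nonneg ‖x‖, sq_nonneg ‖w‖]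
    have hw : ‖w‖ = 0 := by nlinarith [sq_nonneg ‖x‖, sq_nonneg ‖w‖]
    rw [norm_eq_zero] at hx hw
    subst hx hw
    rw [zero_add]
    exact LinearPMap.graph_fst_eq_zero_snd _ hwz rfl
  · obtain ⟨w, huw, hwv⟩ := (hS u v).mp huv
    obtain ⟨c, hac, hcb⟩ := (hS a b).mp hab
    rw [(hsymm u w).mp huw c b hcb, (hsymm w v).mp hwv a c hac]
  · obtain ⟨x, w, z, hxw, hwz, hv⟩ := exists_add_sq_eq hQ (u + v)
    have hux : u = x := by
      refine sub_eq_zero.mp ?_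
      obtain ⟨a, c, b, hac, hcb, hab⟩ := exists_add_sq_eq hQ (u - x)
      have h1 := h a b ((hS a b).mpr ⟨c, hac, hcb⟩)
      have h2 : ⟪b, x⟫_ℂ = ⟪a, z⟫_ℂ := by
        rw [(hsymm x w).mp hxw c b hcb, (hsymm w z).mp hwz a c hac]
      have h3 : ⟪a, x + z⟫_ℂ = ⟪a, u + v⟫_ℂ := by rw [hv]
      have h4 : ⟪a + b, u - x⟫_ℂ = 0 := by
        simp only [inner_add_left, inner_add_right, inner_sub_right] at h3 ⊢
        linear_combination h1 - h2 - h3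
      rw [hab] at h4
      exact inner_self_eq_zero.mp h4
    subst hux
    rw [hS]
    exact ⟨w, hxw, by rwa [← add_left_cancel hv]⟩

end SelfAdjoint

/-! ### Self-adjointness of the Dirac operator -/

section Boundary

variable {ι : Type} [Fintype ι] {P : EuclideanSpace ℂ ι →L[ℂ] EuclideanSpace ℂ ι}
  {T : Module.End ℂ (Ran P)}

theorem starProjection_apply_of_mem {Q : EuclideanSpace ℂ ι →L[ℂ] EuclideanSpace ℂ ι}
    (hQ : IsStarProjection Q) {x : EuclideanSpace ℂ ι}
    (hx : x ∈ Ran Q) : Q x = x := by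
  obtain ⟨z, rfl⟩ := hx
  exact DFunLike.congr_fun hQ.isIdempotentElem z

theorem starProjection_inner {Q : EuclideanSpace ℂ ι →L[ℂ] EuclideanSpace ℂ ι}
    (hQ : IsStarProjection Q) (x z : EuclideanSpace ℂ ι) :
    ⟪Q x, z⟫_ℂ = ⟪x, Q z⟫_ℂ := by
  rw [← ContinuousLinearMap.adjoint_inner_right, ← ContinuousLinearMap.star_eq_adjoint,
    hQ.isSelfAdjoint.star_eq]

theorem IsCouple.inner_left (h : IsCouple P T) (x z : EuclideanSpace ℂ ι) :
    ⟪P x, z⟫_ℂ = ⟪x, P z⟫_ℂ :=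
  starProjection_inner h.1 x z

theorem IsCouple.apply_of_mem (h : IsCouple P T) {x : EuclideanSpace ℂ ι} (hx : x ∈ Ran P) :
    P x = x :=
  starProjection_apply_of_mem h.1 hx

/-- The boundary conditions of a couple define a Lagrangian subspace of the boundary space. -/
theorem IsCouple.boundaryCondition_iff (h : IsCouple P T) (t' r' : EuclideanSpace ℂ ι) :
    BoundaryCondition P T t' r' ↔
      ∀ t r, BoundaryCondition P T t r → ⟪r, t'⟫_ℂ - ⟪t, r'⟫_ℂ = 0 := by
  constructor
  · rintro ⟨hr', ht'⟩ t r ⟨hr, ht⟩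
    have h1 : ⟪r, t'⟫_ℂ = ⟪(⟨r, hr⟩ : Ran P), T ⟨r', hr'⟩⟫_ℂ := by
      rw [Submodule.coe_inner, ← ht', ← h.inner_left, h.apply_of_mem hr]
    have h2 : ⟪t, r'⟫_ℂ = ⟪T ⟨r, hr⟩, (⟨r', hr'⟩ : Ran P)⟫_ℂ := by
      rw [Submodule.coe_inner, ← ht, h.inner_left, h.apply_of_mem hr']
    rw [h1, h2, h.2, sub_self]
  · intro hb
    have hr' : r' ∈ Ran P := by
      refine ⟨r', ?_⟩
      refine sub_eq_zero.mp (inner_self_eq_zero (𝕜 := ℂ).mp ?_)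
      have := hb (P r' - r') 0 ⟨Submodule.zero_mem _, by
        rw [map_sub, h.apply_of_mem (x := P r') ⟨r', rfl⟩, sub_self]
        exact (congrArg Subtype.val (map_zero T)).symm⟩
      rw [inner_zero_left, zero_sub, neg_eq_zero] at this
      change ⟪P r' - r', P r' - r'⟫_ℂ = 0
      rw [inner_sub_right, this, sub_zero, ← h.inner_left, map_sub,
        h.apply_of_mem (x := P r') ⟨r', rfl⟩, sub_self, inner_zero_left]
    refine ⟨hr', ?_⟩
    have key : (⟨P t', t', rfl⟩ : Ran P) = T ⟨r', hr'⟩ := by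
      refine ext_inner_left ℂ fun r => ?_
      have := hb (T r) r ⟨r.2, h.apply_of_mem (T r).2⟩
      rw [← h.2 r, Submodule.coe_inner, Submodule.coe_inner, ← sub_eq_zero, ← this,
        ← h.inner_left, h.apply_of_mem r.2]
    exact congrArg Subtype.val key

end Boundary

theorem sigma1_mul_sigma1 : sigma1 * sigma1 = 1 := by
  ext i j; fin_cases i <;> fin_cases j <;> simp [sigma1, Matrix.mul_apply]

theorem sigma1_conjTranspose : sigma1.conjTranspose = sigma1 := by
  ext i j; fin_cases i <;> fin_cases j <;> simp [sigma1]

theorem sigma2_conjTranspose : sigma2.conjTranspose = sigma2 := by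
  ext i j; fin_cases i <;> fin_cases j <;> simp [sigma2]

theorem sigma3_conjTranspose : sigma3.conjTranspose = sigma3 := by
  ext i j; fin_cases i <;> fin_cases j <;> simp [sigma3]

theorem mulL2_sigma1_sigma1 (f : L2) : mulL2 sigma1 (mulL2 sigma1 f) = f := by
  rw [mulL2_mulL2, sigma1_mul_sigma1, mulL2_one]

theorem inner_sigma1 (f g : L2) : ⟪mulL2 sigma1 f, g⟫_ℂ = ⟪f, mulL2 sigma1 g⟫_ℂ := by
  rw [inner_mulL2_left, sigma1_conjTranspose]

theorem inner_sigma3 (f g : L2) : ⟪mulL2 sigma3 f, g⟫_ℂ = ⟪f, mulL2 sigma3 g⟫_ℂ := by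
  rw [inner_mulL2_left, sigma3_conjTranspose]

/-- The derivative is recovered from the Dirac expression. -/
theorem eq_of_diracExpr_eq {f f' q : L2} (h : q = diracExpr f f') :
    f' = Complex.I • mulL2 sigma1 (q - (1 / 2 : ℂ) • mulL2 sigma3 f) := by
  rw [h, diracExpr, add_sub_cancel_right, map_smul, mulL2_sigma1_sigma1, smul_smul]
  simp

theorem diracExpr_of_eq {f f' q : L2}
    (h : f' = Complex.I • mulL2 sigma1 (q - (1 / 2 : ℂ) • mulL2 sigma3 f)) :
    q = diracExpr f f' := by
  rw [h, diracExpr, map_smul, mulL2_sigma1_sigma1, smul_smul]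
  simp

variable {n : ℕ} {y : Fin n → ℝ}

/-- The boundary form of the Dirac expression. -/
theorem inner_diracExpr_sub (hy : Function.Injective y) {f f' g g' : L2}
    (hf : IsWeakDeriv y f f') (hg : IsWeakDeriv y g g') {L R L' R' : Fin n → C2}
    (hl : HasSideLimits y f L R) (hl' : HasSideLimits y g L' R') :
    ⟪diracExpr f f', g⟫_ℂ - ⟪f, diracExpr g g'⟫_ℂ =
      ⟪rho L R, tau L' R'⟫_ℂ - ⟪tau L R, rho L' R'⟫_ℂ := by
  have h1 : ⟪diracExpr f f', g⟫_ℂ - ⟪f, diracExpr g g'⟫_ℂ =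
      Complex.I * (⟪f', mulL2 sigma1 g⟫_ℂ + ⟪f, mulL2 sigma1 g'⟫_ℂ) := by
    simp only [diracExpr, inner_add_left, inner_add_right, inner_smul_left, inner_smul_right,
      inner_sigma1, inner_sigma3]
    simp only [map_neg, Complex.conj_I, map_div₀, map_one, map_ofNat]
    ring
  rw [h1, inner_add_inner_eq_neg_sum hy hf (hg.mulL2 sigma1) hl (hl'.mulL2 sigma1)]
  simp only [PiLp.inner_apply, Fintype.sum_prod_type, rho, tau, RCLike.inner_apply]
  rw [← Finset.sum_sub_distrib, ← Finset.sum_neg_distrib, Finset.mul_sum]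
  refine Finset.sum_congr rfl fun k _ => ?_
  simp [Fin.sum_univ_two, act_apply, sigma1, Matrix.mulVec, dotProduct, map_ofNat]
  ring

theorem mem_diracOp_graph {P : Bdry n →L[ℂ] Bdry n} {T : Module.End ℂ (Ran P)} {f q : L2} :
    (f, q) ∈ (diracOp y P T).graph ↔ ∃ f' : L2, IsWeakDeriv y f f' ∧ q = diracExpr f f' ∧
      ∃ L R, HasSideLimits y f L R ∧ BoundaryCondition P T (tau L R) (rho L R) := by
  rw [diracOp_graph]; rfl

theorem isSelfAdjoint_diracOp (hy : Function.Injective y) {P : Bdry n →L[ℂ] Bdry n}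
    {T : Module.End ℂ (Ran P)} (h : IsCouple P T) : IsSelfAdjoint (diracOp y P T) := by
  have htest : ∀ {f f' : L2}, IsWeakDeriv y f f' → HasSideLimits y f 0 0 →
      (f, diracExpr f f') ∈ (diracOp y P T).graph := fun {f f'} hf hs =>
    mem_diracOp_graph.mpr ⟨f', hf, rfl, 0, 0, hs, by
      rw [tau_zero, rho_zero]; exact BoundaryCondition.zero⟩
  refine isSelfAdjoint_of_mem_graph_iff (fun x hx => ?_) fun g q => ⟨fun hgq a b hab => ?_,
    fun hgq => ?_⟩
  -- a vector orthogonal to all test functions is a weak derivative of `0`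
  · refine IsWeakDeriv.eq_zero (y := y) fun φ hφ hc ht => ?_
    have h1 : ∫ t, φ t • x t = 0 := ext_inner_left ℂ fun e => by
      obtain ⟨f, f', hf, hs, h1, -⟩ := exists_testFunction hy hφ hc ht e
      rw [← h1, hx _ _ (htest hf hs), inner_zero_right]
    have h2 : ∫ t, deriv φ t • (0 : L2) t = 0 :=
      integral_eq_zero_of_ae (by
        filter_upwards [Lp.coeFn_zero C2 2 (volume : Measure ℝ)] with t ht
        rw [ht]
        simp)
    rw [h1, h2, neg_zero]
  · obtain ⟨g', hg, rfl, L', R', hl', hb'⟩ := mem_diracOp_graph.mp hgq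
    obtain ⟨a', ha, rfl, L, R, hl, hb⟩ := mem_diracOp_graph.mp hab
    rw [← sub_eq_zero, inner_diracExpr_sub hy ha hg hl hl']
    exact (h.boundaryCondition_iff _ _).mp hb' _ _ hb
  · obtain ⟨u, hu⟩ : ∃ u : L2, u = q - (1 / 2 : ℂ) • mulL2 sigma3 g := ⟨_, rfl⟩
    -- testing with functions supported in `ℝ \ Y` shows that `g` has a weak derivative
    have hweak : IsWeakDeriv y (Complex.I • mulL2 sigma1 g) (-u) := by
      intro φ hφ hc ht
      refine ext_inner_left ℂ fun e => ?_
      obtain ⟨f, f', hf, hs, h1, h2⟩ := exists_testFunction hy hφ hc ht e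
      have h3 := hgq _ _ (htest hf hs)
      have h4 : ∫ x, φ x • (-u : L2) x = - ∫ x, φ x • u x := by
        rw [← integral_neg]
        refine integral_congr_ae ?_
        filter_upwards [Lp.coeFn_neg u] with x hx
        rw [hx, Pi.neg_apply, smul_neg]
      rw [h4, neg_neg, ← h1, ← h2, hu, inner_sub_right, ← h3]
      simp only [diracExpr, inner_add_left, inner_smul_left, inner_smul_right, inner_sigma1,
        inner_sigma3]
      simp only [map_neg, Complex.conj_I, map_div₀, map_one, map_ofNat]
      ring
    have hweak' : IsWeakDeriv y g (Complex.I • mulL2 sigma1 u) := by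
      have := (hweak.mulL2 sigma1).smul (-Complex.I)
      rw [map_smul, mulL2_sigma1_sigma1, smul_smul, map_neg] at this
      simpa using this
    obtain ⟨L', R', hl'⟩ := hweak'.exists_hasSideLimits hy
    have hq : q = diracExpr g (Complex.I • mulL2 sigma1 u) := diracExpr_of_eq (by rw [hu])
    refine mem_diracOp_graph.mpr ⟨_, hweak', hq, L', R', hl',
      (h.boundaryCondition_iff _ _).mpr fun t r hb => ?_⟩
    obtain ⟨L, R, rfl, rfl⟩ := exists_tau_rho t r
    obtain ⟨f, f', hf, hl⟩ := exists_isWeakDeriv_hasSideLimits hy L R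
    rw [← inner_diracExpr_sub hy hf hweak' hl hl', ← hq, sub_eq_zero]
    exact hgq _ _ (mem_diracOp_graph.mpr ⟨f', hf, rfl, L, R, hl, hb⟩)

end

section

/-! ### The lifted couple: abstract linear algebra -/

/-- The linear algebra behind the couple `(Π̂, Θ̂)`. Here `Pd` stands for `Π ⊕ Π`, `Td` for `Θ ⊕ Θ`
(extended by `0`), `S` for the exchange of the two summands, and `N₁`, `N` for the operators with
matrices `M₁`, `M₂` at each point; `Ns` is the adjoint of `N`, and `Ni`, `N₁i` are the inverses of
`N`, `N₁`. The decisive relation is `N* N₁ = S`. -/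
structure IsLift {V : Type*} [NormedAddCommGroup V] [InnerProductSpace ℂ V]
    (Pd Td S N Ns Ni N₁ N₁i : V →L[ℂ] V) : Prop where
  idem : ∀ x, Pd (Pd x) = Pd x
  symm_P : ∀ x z, ⟪Pd x, z⟫_ℂ = ⟪x, Pd z⟫_ℂ
  symm_T : ∀ x z, ⟪Td x, z⟫_ℂ = ⟪x, Td z⟫_ℂ
  symm_S : ∀ x z, ⟪S x, z⟫_ℂ = ⟪x, S z⟫_ℂ
  P_T : ∀ x, Pd (Td x) = Td x
  invol : ∀ x, S (S x) = x
  comm_P : ∀ x, Pd (S x) = S (Pd x)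
  comm_T : ∀ x, Td (S x) = S (Td x)
  adj : ∀ x z, ⟪N x, z⟫_ℂ = ⟪x, Ns z⟫_ℂ
  left_inv : ∀ x, Ni (N x) = x
  adj_N₁ : ∀ x, Ns (N₁ x) = S x
  inv_N₁ : ∀ x, N₁i x = S (Ns x)

theorem coe_compress {ι : Type} (P A : EuclideanSpace ℂ ι →L[ℂ] EuclideanSpace ℂ ι) (x : Ran P) :
    (compress P A x : EuclideanSpace ℂ ι) = P (A x) := rfl

section Lift

variable {ι : Type} [Fintype ι]

variable {Pd Td S N Ns Ni N₁ N₁i Q : EuclideanSpace ℂ ι →L[ℂ] EuclideanSpace ℂ ι}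

theorem IsLift.mem_ran (h : IsLift Pd Td S N Ns Ni N₁ N₁i) (hR : Ran Q = Ran (N * Pd))
    (b : EuclideanSpace ℂ ι) : N b ∈ Ran Q ↔ Pd b = b := by
  rw [hR]
  constructor
  · rintro ⟨c, hc⟩
    have := congrArg Ni hc
    change Ni (N (Pd c)) = Ni (N b) at this
    rw [h.left_inv, h.left_inv] at this
    rw [← this, h.idem]
  · intro hb
    exact ⟨b, congrArg N hb⟩

theorem IsLift.exists_of_mem (h : IsLift Pd Td S N Ns Ni N₁ N₁i) (hR : Ran Q = Ran (N * Pd))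
    (x : Ran Q) : ∃ u, Pd u = u ∧ (x : EuclideanSpace ℂ ι) = N u := by
  obtain ⟨x, hx⟩ := x
  have hx' := hx
  rw [hR] at hx'
  obtain ⟨c, rfl⟩ := hx'
  exact ⟨Pd c, h.idem c, rfl⟩

theorem IsLift.inner_of_mem (h : IsLift Pd Td S N Ns Ni N₁ N₁i) {u : EuclideanSpace ℂ ι}
    (hu : Pd u = u) (z : EuclideanSpace ℂ ι) : ⟪N u, z⟫_ℂ = ⟪u, Pd (Ns z)⟫_ℂ := by
  rw [h.adj, ← h.symm_P, hu]

theorem IsLift.coe_A (h : IsLift Pd Td S N Ns Ni N₁ N₁i) (hQ : IsStarProjection Q)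
    (hR : Ran Q = Ran (N * Pd)) (z : Ran Q) :
    (compress Q (N * Pd * N₁i) z : EuclideanSpace ℂ ι) = N (S (Pd (Ns z))) := by
  have hm : N (Pd (N₁i z)) ∈ Ran Q := (h.mem_ran hR _).mpr (h.idem _)
  rw [coe_compress]
  refine (starProjection_apply_of_mem hQ hm).trans ?_
  rw [h.inv_N₁, h.comm_P]

theorem IsLift.coe_B (h : IsLift Pd Td S N Ns Ni N₁ N₁i) (hQ : IsStarProjection Q)
    (hR : Ran Q = Ran (N * Pd)) (x : Ran Q) :
    (compress Q (N * Td * Ni) x : EuclideanSpace ℂ ι) = N (Td (Ni x)) := by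
  rw [coe_compress]
  exact starProjection_apply_of_mem hQ ((h.mem_ran hR _).mpr (h.P_T _))

theorem IsLift.A_eq_B_iff (h : IsLift Pd Td S N Ns Ni N₁ N₁i) (hQ : IsStarProjection Q)
    (hR : Ran Q = Ran (N * Pd)) (z x : Ran Q) :
    compress Q (N * Pd * N₁i) z = compress Q (N * Td * Ni) x ↔ Pd (Ns z) = S (Td (Ni x)) := by
  rw [Subtype.ext_iff, h.coe_A hQ hR, h.coe_B hQ hR]
  constructor
  · intro he
    have := congrArg Ni he
    rw [h.left_inv, h.left_inv] at this
    rw [← this, h.invol]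
  · intro he
    rw [he, h.invol]

/-- On `ran Π̂`, the operator `N₂ (Π ⊕ Π) N₁⁻¹ = N₂ (Π ⊕ Π) S N₂*` is injective, since the kernel of
`(Π ⊕ Π) N₂*` is orthogonal to the range of `N₂ (Π ⊕ Π)`. -/
theorem IsLift.isUnit_A (h : IsLift Pd Td S N Ns Ni N₁ N₁i) (hQ : IsStarProjection Q)
    (hR : Ran Q = Ran (N * Pd)) : IsUnit (compress Q (N * Pd * N₁i)) := by
  rw [LinearMap.isUnit_iff_ker_eq_bot, LinearMap.ker_eq_bot']
  intro z hz
  have h0 : Pd (Ns z) = 0 := by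
    have := congrArg Ni (congrArg Subtype.val hz)
    rw [h.coe_A hQ hR, h.left_inv, ZeroMemClass.coe_zero, map_zero] at this
    rw [← h.invol (Pd (Ns z)), this, map_zero]
  obtain ⟨u, hu, hz'⟩ := h.exists_of_mem hR z
  rw [← inner_self_eq_zero (𝕜 := ℂ), Submodule.coe_inner]
  have h1 := h.inner_of_mem hu z
  rwa [h0, inner_zero_right, ← hz'] at h1

/-- The relation `z = Θ̂ x`, without inverses of restricted operators. -/
theorem IsLift.theta_eq_iff (h : IsLift Pd Td S N Ns Ni N₁ N₁i) (hQ : IsStarProjection Q)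
    (hR : Ran Q = Ran (N * Pd)) (z x : Ran Q) :
    z = (Ring.inverse (compress Q (N * Pd * N₁i)) * compress Q (N * Td * Ni)) x ↔
      Pd (Ns z) = S (Td (Ni x)) := by
  have hA := h.isUnit_A hQ hR
  rw [← h.A_eq_B_iff hQ hR]
  constructor
  · rintro rfl
    rw [← Module.End.mul_apply, ← mul_assoc, Ring.mul_inverse_cancel _ hA, one_mul]
  · intro he
    rw [Module.End.mul_apply, ← he, ← Module.End.mul_apply, Ring.inverse_mul_cancel _ hA,
      Module.End.one_apply]

theorem IsLift.isCouple (h : IsLift Pd Td S N Ns Ni N₁ N₁i) (hQ : IsStarProjection Q)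
    (hR : Ran Q = Ran (N * Pd)) :
    IsCouple Q (Ring.inverse (compress Q (N * Pd * N₁i)) * compress Q (N * Td * Ni)) := by
  refine ⟨hQ, fun x x' => ?_⟩
  have e := (h.theta_eq_iff hQ hR _ x).mp rfl
  have e' := (h.theta_eq_iff hQ hR _ x').mp rfl
  obtain ⟨u, hu, hx⟩ := h.exists_of_mem hR x
  obtain ⟨u', hu', hx'⟩ := h.exists_of_mem hR x'
  rw [Submodule.coe_inner, Submodule.coe_inner]
  have h1 := h.inner_of_mem hu
    ((Ring.inverse (compress Q (N * Pd * N₁i)) * compress Q (N * Td * Ni)) x')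
  have h2 := h.inner_of_mem hu'
    ((Ring.inverse (compress Q (N * Pd * N₁i)) * compress Q (N * Td * Ni)) x)
  rw [e', hx', h.left_inv, ← hx] at h1
  rw [e, hx, h.left_inv, ← hx'] at h2
  rw [h1, ← inner_conj_symm, h2, inner_conj_symm, h.symm_S, h.symm_T, h.comm_T]

theorem IsLift.boundaryCondition_iff (h : IsLift Pd Td S N Ns Ni N₁ N₁i) (hQ : IsStarProjection Q)
    (hR : Ran Q = Ran (N * Pd)) (a b : EuclideanSpace ℂ ι) :
    BoundaryCondition Q (Ring.inverse (compress Q (N * Pd * N₁i)) * compress Q (N * Td * Ni))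
      (N₁ a) (N b) ↔ Pd b = b ∧ Pd a = Td b := by
  -- taking adjoints in `Π̂ N₂ (Π ⊕ Π) = N₂ (Π ⊕ Π)`
  have hproj : ∀ t, Pd (Ns (Q t)) = Pd (Ns t) := fun t => by
    refine ext_inner_left ℂ fun v => ?_
    rw [← h.symm_P, ← h.adj, ← starProjection_inner hQ, starProjection_apply_of_mem hQ
      ((h.mem_ran hR _).mpr (h.idem v)), h.adj, h.symm_P]
  have main : ∀ hb : N b ∈ Ran Q, Q (N₁ a) = (Ring.inverse (compress Q (N * Pd * N₁i)) *
      compress Q (N * Td * Ni)) ⟨N b, hb⟩ ↔ Pd a = Td b := by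
    intro hb
    have h1 := h.theta_eq_iff hQ hR ⟨Q (N₁ a), N₁ a, rfl⟩ ⟨N b, hb⟩
    rw [Subtype.ext_iff] at h1
    rw [h1, hproj, h.adj_N₁, h.comm_P, h.left_inv]
    constructor
    · intro he
      rw [← h.invol (Pd a), he, h.invol]
    · intro he
      rw [he]
  constructor
  · rintro ⟨hb, he⟩
    exact ⟨(h.mem_ran hR b).mp hb, (main hb).mp he⟩
  · rintro ⟨hb, he⟩
    exact ⟨(h.mem_ran hR b).mpr hb, (main _).mpr he⟩

end Lift

/-! ### The lifted couple: the matrices `M₁` and `M₂` -/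

/-- The exchange of the two summands of `ℂ² ⊕ ℂ²`. -/
def swapMatrix : Matrix (Fin 4) (Fin 4) ℂ := !![0, 0, 1, 0; 0, 0, 0, 1; 1, 0, 0, 0; 0, 1, 0, 0]

theorem M2_conjTranspose_mul_M1 : M2.conjTranspose * M1 = swapMatrix := by
  ext i j
  fin_cases i <;> fin_cases j <;>
    simp [M1, M2, swapMatrix, Matrix.mul_apply, Fin.sum_univ_four, map_ofNat] <;> ring_nf <;> simp

theorem swapMatrix_mul_self : swapMatrix * swapMatrix = 1 := by
  ext i j
  fin_cases i <;> fin_cases j <;> simp [swapMatrix, Matrix.mul_apply, Fin.sum_univ_four]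

theorem swapMatrix_conjTranspose : swapMatrix.conjTranspose = swapMatrix := by
  ext i j
  fin_cases i <;> fin_cases j <;> simp [swapMatrix]

theorem M1_inv : M1⁻¹ = swapMatrix * M2.conjTranspose := by
  refine Matrix.inv_eq_left_inv ?_
  rw [mul_assoc, M2_conjTranspose_mul_M1, swapMatrix_mul_self]

theorem M2_inv_mul : M2⁻¹ * M2 = 1 := by
  have h1 : M1 * (swapMatrix * M2.conjTranspose) = 1 := by
    rw [mul_eq_one_comm, mul_assoc, M2_conjTranspose_mul_M1, swapMatrix_mul_self]
  have h2 : M2 * (M1 * swapMatrix).conjTranspose = 1 := by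
    rw [← mul_assoc] at h1
    simpa using congrArg Matrix.conjTranspose h1
  rw [Matrix.inv_eq_right_inv h2, mul_eq_one_comm, h2]

variable {n : ℕ}

/-- The four entries of a vector in `ℂ⁴ⁿ` at the point `k`. -/
def fiber (x : HatBdry n) (k : Fin n) : Fin 4 → ℂ := ![x (0, k, 0), x (0, k, 1), x (1, k, 0), x (1, k, 1)]

theorem fiber_ext {x z : HatBdry n} (h : ∀ k, fiber x k = fiber z k) : x = z := by
  ext ⟨c, k, s⟩
  have h0 := congrFun (h k) 0
  have h1 := congrFun (h k) 1
  have h2 := congrFun (h k) 2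
  have h3 := congrFun (h k) 3
  fin_cases c <;> fin_cases s
  exacts [h0, h1, h2, h3]

theorem fiber_atPoints (M : Matrix (Fin 4) (Fin 4) ℂ) (x : HatBdry n) (k : Fin n) :
    fiber (atPoints n M x) k = M.mulVec (fiber x k) := by
  have key : ∀ c s, (atPoints n M x) (c, k, s) = ∑ c', ∑ s',
      M (finProdFinEquiv (c, s)) (finProdFinEquiv (c', s')) * x (c', k, s') := by
    intro c s
    simp [atPoints, Matrix.mulVec, dotProduct, Fintype.sum_prod_type]
  have e0 : (finProdFinEquiv ((0 : Fin 2), (0 : Fin 2)) : Fin 4) = 0 := rfl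
  have e1 : (finProdFinEquiv ((0 : Fin 2), (1 : Fin 2)) : Fin 4) = 1 := rfl
  have e2 : (finProdFinEquiv ((1 : Fin 2), (0 : Fin 2)) : Fin 4) = 2 := rfl
  have e3 : (finProdFinEquiv ((1 : Fin 2), (1 : Fin 2)) : Fin 4) = 3 := rfl
  ext j
  fin_cases j <;>
  · simp only [fiber, key, Matrix.mulVec, dotProduct, Fin.sum_univ_two, Fin.sum_univ_four]
    simp [e0, e1, e2, e3, add_assoc]

theorem atPoints_atPoints (M M' : Matrix (Fin 4) (Fin 4) ℂ) (x : HatBdry n) :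
    atPoints n M (atPoints n M' x) = atPoints n (M * M') x :=
  fiber_ext fun k => by simp only [fiber_atPoints, Matrix.mulVec_mulVec]

theorem atPoints_one (x : HatBdry n) : atPoints n 1 x = x :=
  fiber_ext fun k => by rw [fiber_atPoints, Matrix.one_mulVec]

theorem inner_atPoints (M : Matrix (Fin 4) (Fin 4) ℂ) (x z : HatBdry n) :
    ⟪atPoints n M x, z⟫_ℂ = ⟪x, atPoints n M.conjTranspose z⟫_ℂ := by
  have : atPoints n M.conjTranspose = star (atPoints n M) := by
    rw [atPoints, atPoints, ← map_star]
    congr 1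
    ext p q
    by_cases h : p.2.1 = q.2.1
    · simp [Matrix.star_apply, h]
    · simp [Matrix.star_apply, h, Ne.symm h]
  rw [this, ContinuousLinearMap.star_eq_adjoint, ContinuousLinearMap.adjoint_inner_right]

/-- The `c`-th component of a vector in `ℂ⁴ⁿ = ℂ²ⁿ ⊕ ℂ²ⁿ`. -/
def half (x : HatBdry n) (c : Fin 2) : Bdry n := WithLp.toLp 2 fun p => x (c, p)

theorem half_ext {x z : HatBdry n} (h : ∀ c, half x c = half z c) : x = z := by
  ext ⟨c, p⟩
  exact congrArg (fun v : Bdry n => v p) (h c)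

theorem half_doubled (A : Bdry n →ₗ[ℂ] Bdry n) (x : HatBdry n) (c : Fin 2) :
    half (doubled A x) c = A (half x c) := rfl

theorem half_swap (x : HatBdry n) (c : Fin 2) : half (atPoints n swapMatrix x) c = half x (1 - c) := by
  ext ⟨k, s⟩
  have h := fiber_atPoints swapMatrix x k
  generalize atPoints n swapMatrix x = w at h ⊢
  have h0 := congrFun h 0
  have h1 := congrFun h 1
  have h2 := congrFun h 2
  have h3 := congrFun h 3
  simp only [fiber, swapMatrix, Matrix.mulVec, dotProduct, Fin.sum_univ_four] at h0 h1 h2 h3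
  simp at h0 h1 h2 h3
  fin_cases c <;> fin_cases s <;> simp [half, h0, h1, h2, h3]

theorem inner_eq_half (x z : HatBdry n) : ⟪x, z⟫_ℂ = ∑ c, ⟪half x c, half z c⟫_ℂ := by
  simp only [PiLp.inner_apply, half, Fintype.sum_prod_type]

theorem extendTheta_apply (P : Bdry n →L[ℂ] Bdry n) (T : Module.End ℂ (Ran P)) (x : Bdry n) :
    extendTheta P T x = T ⟨P x, x, rfl⟩ := rfl

variable {P : Bdry n →L[ℂ] Bdry n} {T : Module.End ℂ (Ran P)}

theorem IsCouple.isLift (h : IsCouple P T) :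
    IsLift (doubled (P : Bdry n →ₗ[ℂ] Bdry n)) (doubled (extendTheta P T)) (atPoints n swapMatrix)
      (atPoints n M2) (atPoints n M2.conjTranspose) (atPoints n M2⁻¹) (atPoints n M1)
      (atPoints n M1⁻¹) where
  idem x := half_ext fun c => by
    simp only [half_doubled]
    exact h.apply_of_mem ⟨half x c, rfl⟩
  symm_P x z := by
    simp only [inner_eq_half, half_doubled]
    exact Finset.sum_congr rfl fun c _ => h.inner_left _ _
  symm_T x z := by
    simp only [inner_eq_half, half_doubled, extendTheta_apply]
    refine Finset.sum_congr rfl fun c _ => ?_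
    have h1 := h.2 ⟨P (half x c), _, rfl⟩ ⟨P (half z c), _, rfl⟩
    rw [Submodule.coe_inner, Submodule.coe_inner] at h1
    change ⟪_, P (half z c)⟫_ℂ = ⟪P (half x c), _⟫_ℂ at h1
    rwa [← h.inner_left, h.inner_left (half x c), h.apply_of_mem (Subtype.prop _),
      h.apply_of_mem (Subtype.prop _)] at h1
  symm_S x z := by rw [inner_atPoints, swapMatrix_conjTranspose]
  P_T x := half_ext fun c => by
    simp only [half_doubled, extendTheta_apply]
    exact h.apply_of_mem (Subtype.prop _)
  invol x := by rw [atPoints_atPoints, swapMatrix_mul_self, atPoints_one]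
  comm_P x := half_ext fun c => by simp only [half_doubled, half_swap]
  comm_T x := half_ext fun c => by simp only [half_doubled, half_swap]
  adj x z := inner_atPoints M2 x z
  left_inv x := by rw [atPoints_atPoints, M2_inv_mul, atPoints_one]
  adj_N₁ x := by rw [atPoints_atPoints, M2_conjTranspose_mul_M1]
  inv_N₁ x := by rw [M1_inv, atPoints_atPoints]

theorem isStarProjection_hatPi (P : Bdry n →L[ℂ] Bdry n) : IsStarProjection (hatPi P) :=
  isStarProjection_starProjection

theorem ran_hatPi (P : Bdry n →L[ℂ] Bdry n) :
    Ran (hatPi P) = Ran (atPoints n M2 * doubled (P : Bdry n →ₗ[ℂ] Bdry n)) :=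
  Submodule.range_starProjection _

theorem IsCouple.hat (h : IsCouple P T) : IsCouple (hatPi P) (hatTheta P T) :=
  h.isLift.isCouple (isStarProjection_hatPi P) (ran_hatPi P)

theorem IsCouple.boundaryCondition_hat_iff (h : IsCouple P T) (a b : HatBdry n) :
    BoundaryCondition (hatPi P) (hatTheta P T) (atPoints n M1 a) (atPoints n M2 b) ↔
      ∀ c, BoundaryCondition P T (half a c) (half b c) := by
  refine (h.isLift.boundaryCondition_iff (isStarProjection_hatPi P) (ran_hatPi P) a b).trans ?_
  constructor
  · rintro ⟨h1, h2⟩ c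
    have h1' : P (half b c) = half b c := congrArg (half · c) h1
    have h2' : P (half a c) = extendTheta P T (half b c) := congrArg (half · c) h2
    refine ⟨⟨_, h1'⟩, h2'.trans ?_⟩
    rw [extendTheta_apply]
    congr 2
    exact Subtype.ext h1'
  · intro hb
    refine ⟨half_ext fun c => ?_, half_ext fun c => ?_⟩
    · obtain ⟨h1, -⟩ := hb c
      exact h.apply_of_mem h1
    · obtain ⟨h1, h2⟩ := hb c
      rw [half_doubled, half_doubled, extendTheta_apply]
      refine h2.trans ?_
      congr 2
      exact Subtype.ext (h.apply_of_mem h1).symm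

/-- The vector of `ℂ⁴ⁿ = ℂ²ⁿ ⊕ ℂ²ⁿ` with given components. -/
def pair (u v : Bdry n) : HatBdry n := WithLp.toLp 2 fun p => (![u, v] p.1) p.2

/-- The one-sided limits of the Dirac expression, in terms of those of `Ψ` and `Ψ'`. -/
noncomputable def diracSide (L L' : Fin n → C2) : Fin n → C2 := fun k =>
  -Complex.I • act sigma1 (L' k) + (1 / 2 : ℂ) • act sigma3 (L k)

/-- `τ̂Ψ = N₁ (τΨ, τDΨ)`. -/
theorem hatTau_eq (L R L' R' : Fin n → C2) :
    hatTau L R L' R' = atPoints n M1 (pair (tau L R) (tau (diracSide L L') (diracSide R R'))) := by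
  have hI := Complex.I_mul_I
  refine fiber_ext fun k => ?_
  rw [fiber_atPoints]
  ext j
  fin_cases j <;>
  · simp [fiber, hatTau, pair, tau, diracSide, M1, act_apply, sigma1, sigma3, Matrix.mulVec,
      dotProduct, Fin.sum_univ_four]
    try first
      | linear_combination ((L' k 0 + R' k 0) / 2) * hI
      | linear_combination ((L' k 1 + R' k 1) / 2) * hI

/-- `ρ̂Ψ = N₂ (ρΨ, ρDΨ)`. -/
theorem hatRho_eq (L R L' R' : Fin n → C2) :
    hatRho L R L' R' = atPoints n M2 (pair (rho L R) (rho (diracSide L L') (diracSide R R'))) := by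
  have hI := Complex.I_mul_I
  refine fiber_ext fun k => ?_
  rw [fiber_atPoints]
  ext j
  fin_cases j <;>
  · simp [fiber, hatRho, pair, rho, diracSide, M2, act_apply, sigma1, sigma3, Matrix.mulVec,
      dotProduct, Fin.sum_univ_four, Fin.sum_univ_two]
    first
      | linear_combination (R' k 0 - L' k 0) * hI
      | linear_combination (R' k 1 - L' k 1) * hI
      | linear_combination (L k 0 - R k 0) * hI
      | linear_combination (L k 1 - R k 1) * hI

end

section

/-! ### The supersymmetric system -/

variable {n : ℕ} {y : Fin n → ℝ} {P : Bdry n →L[ℂ] Bdry n} {T : Module.End ℂ (Ran P)}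

theorem sigma3_mul_sigma3 : sigma3 * sigma3 = 1 := by
  ext i j; fin_cases i <;> fin_cases j <;> simp [sigma3, Matrix.mul_apply]

theorem sigma2_mul_sigma2 : sigma2 * sigma2 = 1 := by
  ext i j; fin_cases i <;> fin_cases j <;> simp [sigma2, Matrix.mul_apply]

theorem sigma3_mul_sigma1 : sigma3 * sigma1 = (-1 : ℂ) • (sigma1 * sigma3) := by
  ext i j; fin_cases i <;> fin_cases j <;> simp [sigma1, sigma3, Matrix.mul_apply]

theorem sigma1_mul_sigma2 : sigma1 * sigma2 = (-1 : ℂ) • (sigma2 * sigma1) := by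
  ext i j; fin_cases i <;> fin_cases j <;> simp [sigma1, sigma2, Matrix.mul_apply]

theorem sigma3_mul_sigma2 : sigma3 * sigma2 = (-1 : ℂ) • (sigma2 * sigma3) := by
  ext i j; fin_cases i <;> fin_cases j <;> simp [sigma2, sigma3, Matrix.mul_apply]

theorem diracExpr_diracExpr (f f' f'' : L2) :
    diracExpr (diracExpr f f') (diracExpr f' f'') = (1 / 4 : ℂ) • f - f'' := by
  simp only [diracExpr, map_add, map_smul, mulL2_mulL2, sigma1_mul_sigma1, sigma3_mul_sigma3,
    sigma3_mul_sigma1, mulL2_smul, mulL2_one, smul_add, smul_smul, neg_mul_neg, Complex.I_mul_I]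
  module

theorem diracExpr_sigma2 (f f' : L2) :
    diracExpr (mulL2 sigma2 f) (mulL2 sigma2 f') = -mulL2 sigma2 (diracExpr f f') := by
  simp only [diracExpr, map_add, map_smul, mulL2_mulL2, sigma1_mul_sigma2, sigma3_mul_sigma2,
    mulL2_smul]
  module

theorem IsWeakDeriv.diracExpr {f f' f'' : L2} (h : IsWeakDeriv y f f') (h' : IsWeakDeriv y f' f'') :
    IsWeakDeriv y (diracExpr f f') (diracExpr f' f'') :=
  ((h'.mulL2 sigma1).smul _).add ((h.mulL2 sigma3).smul _)

theorem HasSideLimits.diracExpr {f f' : L2} {L R L' R' : Fin n → C2} (h : HasSideLimits y f L R)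
    (h' : HasSideLimits y f' L' R') :
    HasSideLimits y (diracExpr f f') (diracSide L L') (diracSide R R') :=
  ((h'.mulL2 sigma1).smul _).add ((h.mulL2 sigma3).smul _)

theorem mem_susyHamiltonian_graph {f q : L2} :
    (f, q) ∈ (susyHamiltonian y P T).graph ↔ ∃ f' f'' : L2, IsWeakDeriv y f f' ∧
      IsWeakDeriv y f' f'' ∧ q = (1 / 4 : ℂ) • f - f'' ∧
      ∃ L R L' R', HasSideLimits y f L R ∧ HasSideLimits y f' L' R' ∧
        BoundaryCondition (hatPi P) (hatTheta P T) (hatTau L R L' R') (hatRho L R L' R') := by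
  have h1 : (f, q) ∈ (susyHamiltonian y P T).graph ↔
      (f, q - (1 / 4 : ℂ) • f) ∈ (schrodingerOp y (hatPi P) (hatTheta P T)).graph := by
    simp only [LinearPMap.mem_graph_iff, susyHamiltonian]
    constructor
    · rintro ⟨x, rfl, hx⟩
      refine ⟨x, rfl, ?_⟩
      rw [← hx, LinearPMap.vadd_apply]
      simp
    · rintro ⟨x, rfl, hx⟩
      refine ⟨x, rfl, ?_⟩
      rw [LinearPMap.vadd_apply, hx]
      simp
  rw [h1, schrodingerOp_graph]
  have h2 : ∀ f'' : L2, q - (1 / 4 : ℂ) • f = -f'' ↔ q = (1 / 4 : ℂ) • f - f'' := fun f'' => by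
    rw [sub_eq_iff_eq_add, neg_add_eq_sub]
  constructor
  · rintro ⟨f', f'', a, b, c, d⟩
    exact ⟨f', f'', a, b, (h2 f'').mp c, d⟩
  · rintro ⟨f', f'', a, b, c, d⟩
    exact ⟨f', f'', a, b, (h2 f'').mpr c, d⟩

theorem boundaryCondition_hat_diracSide (h : IsCouple P T) (L R L' R' : Fin n → C2) :
    BoundaryCondition (hatPi P) (hatTheta P T) (hatTau L R L' R') (hatRho L R L' R') ↔
      BoundaryCondition P T (tau L R) (rho L R) ∧
        BoundaryCondition P T (tau (diracSide L L') (diracSide R R'))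
          (rho (diracSide L L') (diracSide R R')) := by
  rw [hatTau_eq, hatRho_eq, h.boundaryCondition_hat_iff, Fin.forall_fin_two]
  rfl

/-- `Ĥ + 1/4 = Q²`, domains included. -/
theorem mem_susyHamiltonian_graph_iff_sq (hy : Function.Injective y) (h : IsCouple P T)
    (f q : L2) : (f, q) ∈ (susyHamiltonian y P T).graph ↔
      ∃ w, (f, w) ∈ (diracOp y P T).graph ∧ (w, q) ∈ (diracOp y P T).graph := by
  rw [mem_susyHamiltonian_graph]
  constructor
  · rintro ⟨f', f'', h1, h2, rfl, L, R, L', R', h3, h4, h5⟩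
    rw [boundaryCondition_hat_diracSide h] at h5
    exact ⟨diracExpr f f', mem_diracOp_graph.mpr ⟨f', h1, rfl, L, R, h3, h5.1⟩,
      mem_diracOp_graph.mpr ⟨_, h1.diracExpr h2, (diracExpr_diracExpr _ _ _).symm, _, _,
        h3.diracExpr h4, h5.2⟩⟩
  · rintro ⟨w, h1, h2⟩
    obtain ⟨f', hf, hw, L, R, hl, hb⟩ := mem_diracOp_graph.mp h1
    obtain ⟨w', hww, hq, Lw, Rw, hlw, hbw⟩ := mem_diracOp_graph.mp h2
    obtain ⟨f'', hf''⟩ : ∃ f'' : L2, f'' = Complex.I • mulL2 sigma1 (w' - (1 / 2 : ℂ) • mulL2 sigma3 f') :=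
      ⟨_, rfl⟩
    have hff : IsWeakDeriv y f' f'' := by
      have e1 : w - (1 / 2 : ℂ) • mulL2 sigma3 f = w + (-(1 / 2) : ℂ) • mulL2 sigma3 f := by module
      have e2 : w' - (1 / 2 : ℂ) • mulL2 sigma3 f' = w' + (-(1 / 2) : ℂ) • mulL2 sigma3 f' := by
        module
      rw [eq_of_diracExpr_eq hw, hf'', e1, e2]
      exact ((hww.add ((hf.mulL2 sigma3).smul _)).mulL2 sigma1).smul _
    obtain ⟨L', R', hl'⟩ := hff.exists_hasSideLimits hy
    have hs : HasSideLimits y w (diracSide L L') (diracSide R R') := by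
      rw [hw]; exact hl.diracExpr hl'
    obtain ⟨rfl, rfl⟩ := hs.unique hlw
    refine ⟨f', f'', hf, hff, ?_, L, R, L', R', hl, hl', ?_⟩
    · rw [hq, diracExpr_of_eq hf'', hw, diracExpr_diracExpr]
    · exact (boundaryCondition_hat_diracSide h L R L' R').mpr ⟨hb, hbw⟩

theorem sigma2Sum_apply (x : Bdry n) (k : Fin n) (s : Fin 2) :
    sigma2Sum n x (k, s) = ∑ s', sigma2 s s' * x (k, s') := by
  simp [sigma2Sum, Matrix.mulVec, dotProduct, Fintype.sum_prod_type, Matrix.kroneckerMap_apply,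
    Matrix.one_apply]

theorem tau_sigma2 (L R : Fin n → C2) :
    tau (fun k => act sigma2 (L k)) (fun k => act sigma2 (R k)) = sigma2Sum n (tau L R) := by
  ext ⟨k, s⟩
  rw [sigma2Sum_apply]
  fin_cases s <;> simp [tau, act_apply, sigma2, Fin.sum_univ_two] <;> ring

theorem rho_sigma2 (L R : Fin n → C2) :
    rho (fun k => act sigma2 (L k)) (fun k => act sigma2 (R k)) = -sigma2Sum n (rho L R) := by
  ext ⟨k, s⟩
  rw [PiLp.neg_apply, sigma2Sum_apply]
  fin_cases s <;>
    simp [rho, act_apply, sigma1, sigma2, Fin.sum_univ_two, Matrix.mulVec, dotProduct] <;> ring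

/-- `σ₂` preserves the boundary conditions: it anticommutes with `Θ`, and also with the matrix `σ₁`
in the definition of `ρ`. -/
theorem BoundaryCondition.sigma2 (h : IsCouple P T) (hs : SusyCondition P T) {t r : Bdry n}
    (hb : BoundaryCondition P T t r) :
    BoundaryCondition P T (sigma2Sum n t) (-sigma2Sum n r) := by
  obtain ⟨hr, ht⟩ := hb
  rw [SusyCondition] at hs
  generalize sigma2Sum n = S at hs ⊢
  have hc : ∀ x, P (S x) = S (P x) := fun x => DFunLike.congr_fun (sub_eq_zero.mp hs.1) x
  have hSr : P (S r) = S r := by rw [hc, h.apply_of_mem hr]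
  have hr' : S r ∈ Ran P := ⟨S r, hSr⟩
  refine ⟨Submodule.neg_mem _ hr', ?_⟩
  have e1 : (⟨-S r, Submodule.neg_mem _ hr'⟩ : Ran P) = -(compress P S ⟨r, hr⟩) := by
    refine Subtype.ext ?_
    rw [Submodule.coe_neg, coe_compress, hSr]
  have e2 : T (compress P S ⟨r, hr⟩) = -(compress P S (T ⟨r, hr⟩)) :=
    eq_neg_of_add_eq_zero_left (DFunLike.congr_fun hs.2 ⟨r, hr⟩)
  rw [e1, map_neg, e2, neg_neg, coe_compress, hc, hc, h.apply_of_mem (Subtype.prop _), ht]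

theorem mem_diracOp_graph_sigma2 (h : IsCouple P T) (hs : SusyCondition P T) {f q : L2}
    (hf : (f, q) ∈ (diracOp y P T).graph) :
    (mulL2 sigma2 f, -mulL2 sigma2 q) ∈ (diracOp y P T).graph := by
  obtain ⟨f', hw, rfl, L, R, hl, hb⟩ := mem_diracOp_graph.mp hf
  refine mem_diracOp_graph.mpr ⟨_, hw.mulL2 sigma2, (diracExpr_sigma2 _ _).symm, _, _,
    hl.mulL2 sigma2, ?_⟩
  rw [tau_sigma2, rho_sigma2]
  exact hb.sigma2 h hs

theorem isSupersymmetric (hy : Function.Injective y) (h : IsCouple P T) (hs : SusyCondition P T) :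
    IsSupersymmetric (susyHamiltonian y P T) (mulL2 sigma2) (diracOp y P T) where
  selfAdjoint_H := isSelfAdjoint_of_sq (isSelfAdjoint_diracOp hy h)
    (mem_susyHamiltonian_graph_iff_sq hy h)
  selfAdjoint_P := by
    rw [ContinuousLinearMap.isSelfAdjoint_iff_isSymmetric]
    intro f g
    change ⟪mulL2 sigma2 f, g⟫_ℂ = ⟪f, mulL2 sigma2 g⟫_ℂ
    rw [inner_mulL2_left, sigma2_conjTranspose]
  selfAdjoint_Q := isSelfAdjoint_diracOp hy h
  involution := by
    ext1 f
    change mulL2 sigma2 (mulL2 sigma2 f) = f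
    rw [mulL2_mulL2, sigma2_mul_sigma2, mulL2_one]
  anticomm x := by
    obtain ⟨z, hz, hz'⟩ := (LinearPMap.mem_graph_iff _).mp
      (mem_diracOp_graph_sigma2 h hs (LinearPMap.mem_graph _ x))
    dsimp only at hz hz'
    have hm : mulL2 sigma2 x ∈ (diracOp y P T).domain := hz ▸ z.2
    refine ⟨hm, ?_⟩
    have : (⟨mulL2 sigma2 x, hm⟩ : (diracOp y P T).domain) = z := Subtype.ext hz.symm
    rw [this, hz', add_neg_cancel]
  square := mem_susyHamiltonian_graph_iff_sq hy h

/-- A supersymmetric state is a zero mode of `Q`, since `Q² x = 0` implies `‖Q x‖² = 0`. -/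
theorem IsSupersymmetric.isSpontaneouslyBroken {E : Type*} [NormedAddCommGroup E] [InnerProductSpace ℂ E]
    [CompleteSpace E] {H Q : E →ₗ.[ℂ] E} {S : E →L[ℂ] E} (h : IsSupersymmetric H S Q)
    (hQ : ¬ HasEigenvalue Q 0) : IsSpontaneouslyBroken H S Q := by
  refine ⟨h, ?_⟩
  rintro ⟨x, hx, hx0⟩
  have hg := LinearPMap.mem_graph H x
  rw [hx0] at hg
  obtain ⟨w, h1, h2⟩ := (h.square _ _).mp hg
  have hw := (mem_graph_iff_of_isSelfAdjoint h.selfAdjoint_Q _ _).mp h2 _ _ h1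
  rw [inner_zero_right, inner_self_eq_zero] at hw
  obtain ⟨z, hz, hz'⟩ := (LinearPMap.mem_graph_iff _).mp h1
  dsimp only at hz hz'
  exact hQ ⟨z, by rwa [hz], by rw [hz', hw, zero_smul]⟩

end

section

/-! ### Zero modes of the Dirac operator -/

variable {n : ℕ} {y : Fin n → ℝ} {P : Bdry n →L[ℂ] Bdry n} {T : Module.End ℂ (Ran P)}

/-- If `u' = κ u` on `ℝ \ Y`, then `e^{-κx} u` is a step function. -/
theorem exists_exp_mul_eq_step (hy : Function.Injective y) {u : ℝ → ℂ} {κ : ℝ}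
    (h : HasPrimitiveOff y u fun x => (κ : ℂ) * u x) :
    ∃ (c : ℂ) (J : Fin n → ℂ),
      (∀ᵐ x, (Real.exp (-κ * x) : ℂ) * u x = c + ∑ k, if y k < x then J k else 0) ∧
      ∀ k l r, Tendsto u (𝓝[<] (y k) ⊓ ae volume) (𝓝 l) →
        Tendsto u (𝓝[>] (y k) ⊓ ae volume) (𝓝 r) → J k = (Real.exp (-κ * y k) : ℂ) * (r - l) := by
  have hexp : HasPrimitiveOff y (fun x => (Real.exp (-κ * x) : ℂ))
      (fun x => (-κ : ℂ) * (Real.exp (-κ * x) : ℂ)) := by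
    refine .of_hasDerivAt (fun x => ?_) (by fun_prop)
    have : HasDerivAt (fun x : ℝ => Real.exp (-κ * x)) (Real.exp (-κ * x) * (-κ * 1)) x :=
      ((hasDerivAt_id x).const_mul (-κ)).exp
    refine this.ofReal_comp.congr_deriv ?_
    push_cast
    ring
  have hz : (fun x => (-κ : ℂ) * (Real.exp (-κ * x) : ℂ) * u x +
      (Real.exp (-κ * x) : ℂ) * ((κ : ℂ) * u x)) = 0 := by
    funext x
    simp only [Pi.zero_apply]
    ring
  have hp := hexp.mul h (by rw [hz]; exact locallyIntegrable_zero)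
  rw [hz] at hp
  obtain ⟨c, J, hJ⟩ := hp.exists_jumps hy
  refine ⟨c, J, ?_, fun k l r hl hr => ?_⟩
  · filter_upwards [hJ] with x hx
    simpa using hx
  · have he : Continuous fun x : ℝ => (Real.exp (-κ * x) : ℂ) := by fun_prop
    rw [jump_eq_of_ae_eq_jumps hy locallyIntegrable_zero hJ
      (((he.tendsto (y k)).mono_left (inf_le_left.trans nhdsWithin_le_nhds)).mul hl)
      (((he.tendsto (y k)).mono_left (inf_le_left.trans nhdsWithin_le_nhds)).mul hr)]
    ring

/-- A square integrable solution that grows is determined by the jumps to its right. -/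
theorem ae_eq_of_hasPrimitiveOff_growing (hy : Function.Injective y) {u : ℝ → ℂ} {κ : ℝ}
    (hκ : 0 < κ) (h : HasPrimitiveOff y u fun x => (κ : ℂ) * u x) (hu : MemLp u 2 volume)
    {l r : Fin n → ℂ} (hl : ∀ k, Tendsto u (𝓝[<] (y k) ⊓ ae volume) (𝓝 (l k)))
    (hr : ∀ k, Tendsto u (𝓝[>] (y k) ⊓ ae volume) (𝓝 (r k))) :
    ∀ᵐ x, u x = ∑ k, if y k < x then 0 else -((Real.exp (κ * (x - y k)) : ℂ) * (r k - l k)) := by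
  obtain ⟨c, J, hJ, hjump⟩ := exists_exp_mul_eq_step hy h
  have hc : c + ∑ k, J k = 0 := by
    by_contra hne
    obtain ⟨A, hA⟩ := eventually_atTop.mp ((eventually_all.mpr fun k =>
      eventually_gt_atTop (y k)).and (eventually_ge_atTop (0 : ℝ)))
    refine not_ae_le_norm_atTop two_ne_zero ENNReal.ofNat_ne_top hu (norm_pos_iff.mpr hne) A ?_
    filter_upwards [hJ] with x hx hAx
    rw [Finset.sum_congr rfl fun k _ => if_pos ((hA x hAx.le).1 k)] at hx
    rw [← hx, norm_mul, Complex.norm_real, Real.norm_of_nonneg (Real.exp_pos _).le]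
    refine mul_le_of_le_one_left (norm_nonneg _) (Real.exp_le_one_iff.mpr ?_)
    nlinarith [(hA x hAx.le).2]
  filter_upwards [hJ] with x hx
  have h1 : u x = (Real.exp (κ * x) : ℂ) * ((Real.exp (-κ * x) : ℂ) * u x) := by
    rw [← mul_assoc, ← Complex.ofReal_mul, ← Real.exp_add]
    simp
  rw [h1, hx, eq_neg_of_add_eq_zero_left hc, neg_add_eq_sub, ← Finset.sum_sub_distrib,
    Finset.mul_sum]
  refine Finset.sum_congr rfl fun k _ => ?_
  split_ifs
  · ring
  · rw [hjump k _ _ (hl k) (hr k), show κ * (x - y k) = κ * x + -κ * y k by ring, Real.exp_add]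
    push_cast
    ring

/-- A square integrable solution that decays is determined by the jumps to its left. -/
theorem ae_eq_of_hasPrimitiveOff_decaying (hy : Function.Injective y) {u : ℝ → ℂ} {κ : ℝ}
    (hκ : 0 < κ) (h : HasPrimitiveOff y u fun x => ((-κ : ℝ) : ℂ) * u x) (hu : MemLp u 2 volume)
    {l r : Fin n → ℂ} (hl : ∀ k, Tendsto u (𝓝[<] (y k) ⊓ ae volume) (𝓝 (l k)))
    (hr : ∀ k, Tendsto u (𝓝[>] (y k) ⊓ ae volume) (𝓝 (r k))) :
    ∀ᵐ x, u x = ∑ k, if y k < x then (Real.exp (-κ * (x - y k)) : ℂ) * (r k - l k) else 0 := by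
  obtain ⟨c, J, hJ, hjump⟩ := exists_exp_mul_eq_step hy h
  simp only [neg_neg] at hJ hjump
  have hc : c = 0 := by
    by_contra hne
    obtain ⟨A, hA⟩ := eventually_atBot.mp ((eventually_all.mpr fun k =>
      eventually_le_atBot (y k)).and (eventually_le_atBot (0 : ℝ)))
    refine not_ae_le_norm_atBot two_ne_zero ENNReal.ofNat_ne_top hu (norm_pos_iff.mpr hne) A ?_
    filter_upwards [hJ] with x hx hAx
    rw [Finset.sum_congr rfl fun k _ => if_neg (not_lt.mpr ((hA x hAx.le).1 k)),
      Finset.sum_const_zero, add_zero] at hx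
    rw [← hx, norm_mul, Complex.norm_real, Real.norm_of_nonneg (Real.exp_pos _).le]
    refine mul_le_of_le_one_left (norm_nonneg _) (Real.exp_le_one_iff.mpr ?_)
    nlinarith [(hA x hAx.le).2]
  filter_upwards [hJ] with x hx
  have h1 : u x = (Real.exp (-κ * x) : ℂ) * ((Real.exp (κ * x) : ℂ) * u x) := by
    rw [← mul_assoc, ← Complex.ofReal_mul, ← Real.exp_add]
    simp
  rw [h1, hx, hc, zero_add, Finset.mul_sum]
  refine Finset.sum_congr rfl fun k _ => ?_
  split_ifs
  · rw [hjump k _ _ (hl k) (hr k), ← mul_assoc, ← Complex.ofReal_mul, ← Real.exp_add]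
    congr 3
    ring
  · ring

/-- Zero modes are of the form `G₀ ρΨ`. The Dirac equation decouples for `ψ₁ ± i ψ₂`: one of them
grows like `e^{x/2}`, the other one decays like `e^{-x/2}`. -/
theorem ae_eq_G0_of_diracExpr_eq_zero (hy : Function.Injective y) {f f' : L2}
    (hf : IsWeakDeriv y f f') (h0 : diracExpr f f' = 0) {L R : Fin n → C2}
    (hl : HasSideLimits y f L R) : f =ᵐ[volume] G0 y (rho L R) := by
  have hI := Complex.I_mul_I
  have hf' : f' = (-(Complex.I / 2)) • mulL2 (sigma1 * sigma3) f := by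
    rw [eq_of_diracExpr_eq h0.symm, zero_sub, map_neg, map_smul, mulL2_mulL2]
    module
  have hcoord : ∀ᵐ x, f' x 0 = Complex.I / 2 * f x 1 ∧ f' x 1 = -(Complex.I / 2) * f x 0 := by
    filter_upwards [Lp.coeFn_smul (-(Complex.I / 2)) (mulL2 (sigma1 * sigma3) f),
      coeFn_mulL2 (sigma1 * sigma3) f] with x h1 h2
    rw [hf', h1, Pi.smul_apply, h2]
    simp [act_apply, sigma1, sigma3]
  have hu := (((hf.hasPrimitiveOff 0).add ((hf.hasPrimitiveOff 1).const_mul Complex.I))).congr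
    (g' := fun x => ((1 / 2 : ℝ) : ℂ) * (f x 0 + Complex.I * f x 1)) (ae_eq_refl _) (by
      filter_upwards [hcoord] with x hx
      rw [hx.1, hx.2]
      push_cast
      linear_combination (-(1 / 2) * f x 0) * hI)
  have hv := (((hf.hasPrimitiveOff 0).add ((hf.hasPrimitiveOff 1).const_mul (-Complex.I)))).congr
    (g' := fun x => ((-(1 / 2) : ℝ) : ℂ) * (f x 0 + -Complex.I * f x 1)) (ae_eq_refl _) (by
      filter_upwards [hcoord] with x hx
      rw [hx.1, hx.2]
      push_cast
      linear_combination (1 / 2 * f x 0) * hI)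
  have hlim : ∀ (z : ℂ) (l : Filter ℝ) (a : C2), Tendsto f l (𝓝 a) →
      Tendsto (fun x => f x 0 + z * f x 1) l (𝓝 (a 0 + z * a 1)) := fun z l a ha =>
    (tendsto_C2_iff.mp ha 0).add ((tendsto_C2_iff.mp ha 1).const_mul z)
  have hmem : ∀ z : ℂ, MemLp (fun x => f x 0 + z * f x 1) 2 (volume : Measure ℝ) := fun z =>
    (memLp_coord f 0).add ((memLp_coord f 1).const_mul z)
  have eu := ae_eq_of_hasPrimitiveOff_growing hy (by norm_num) hu (hmem _)
    (fun k => hlim _ _ _ (hl k).1) (fun k => hlim _ _ _ (hl k).2)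
  have ev := ae_eq_of_hasPrimitiveOff_decaying hy (by norm_num) hv (hmem _)
    (fun k => hlim _ _ _ (hl k).1) (fun k => hlim _ _ _ (hl k).2)
  have hne : ∀ᵐ x : ℝ, ∀ k, x ≠ y k := ae_all_iff.mpr fun k => by rw [ae_iff]; simp
  filter_upwards [eu, ev, hne] with x hx hx' hxy
  have gu : G0 y (rho L R) x 0 + Complex.I * G0 y (rho L R) x 1 = f x 0 + Complex.I * f x 1 := by
    rw [hx]
    simp only [G0, Finset.mul_sum]
    rw [← Finset.sum_add_distrib]
    refine Finset.sum_congr rfl fun k _ => ?_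
    rcases lt_or_gt_of_ne (hxy k) with h | h
    · rw [if_neg (not_lt.mpr h.le), show 1 / 2 * (x - y k) = -|x - y k| / 2 by
        rw [abs_of_neg (by linarith)]; ring]
      simp [g0, Real.sign_of_neg (sub_neg.mpr h), rho, sigma1, Matrix.mulVec, dotProduct,
        Fin.sum_univ_two]
      field_simp
      ring_nf
      simp only [Complex.I_sq]
      ring
    · rw [if_pos h]
      simp [g0, Real.sign_of_pos (sub_pos.mpr h), rho, sigma1, Matrix.mulVec, dotProduct,
        Fin.sum_univ_two]
      field_simp
      ring_nf
      simp only [Complex.I_sq]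
      ring
  have gv : G0 y (rho L R) x 0 + -Complex.I * G0 y (rho L R) x 1 =
      f x 0 + -Complex.I * f x 1 := by
    rw [hx']
    simp only [G0, Finset.mul_sum]
    rw [← Finset.sum_add_distrib]
    refine Finset.sum_congr rfl fun k _ => ?_
    rcases lt_or_gt_of_ne (hxy k) with h | h
    · rw [if_neg (not_lt.mpr h.le)]
      simp [g0, Real.sign_of_neg (sub_neg.mpr h), rho, sigma1, Matrix.mulVec, dotProduct,
        Fin.sum_univ_two]
      field_simp
      ring_nf
      simp only [Complex.I_sq]
      ring
    · rw [if_pos h, show -(1 / 2) * (x - y k) = -|x - y k| / 2 by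
        rw [abs_of_pos (by linarith)]; ring]
      simp [g0, Real.sign_of_pos (sub_pos.mpr h), rho, sigma1, Matrix.mulVec, dotProduct,
        Fin.sum_univ_two]
      field_simp
      ring_nf
      simp only [Complex.I_sq]
      ring
  ext s
  fin_cases s
  · change f x 0 = G0 y (rho L R) x 0
    linear_combination (-(1 / 2)) * gu - (1 / 2) * gv
  · change f x 1 = G0 y (rho L R) x 1
    linear_combination (Complex.I / 2) * gu - (Complex.I / 2) * gv +
      (G0 y (rho L R) x 1 - f x 1) * -hI

theorem not_hasEigenvalue_zero (hy : Function.Injective y)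
    (hd : LinearMap.det (T - compress P (tauG0 y)) ≠ 0) :
    ¬ HasEigenvalue (diracOp y P T) 0 := by
  rintro ⟨x, hx, hx0⟩
  have hg := LinearPMap.mem_graph _ x
  rw [hx0, zero_smul] at hg
  obtain ⟨f', hf, h0, L, R, hl, hr, ht⟩ := mem_diracOp_graph.mp hg
  have hG := ae_eq_G0_of_diracExpr_eq_zero hy hf h0.symm hl
  obtain ⟨L', R', hl', htau, -⟩ := tauG0_spec hy (rho L R)
  obtain ⟨rfl, rfl⟩ := (hl.congr hG).unique hl'
  have hker : (T - compress P (tauG0 y)) ⟨rho L R, hr⟩ = 0 := by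
    refine Subtype.ext ?_
    rw [LinearMap.sub_apply, Submodule.coe_sub, coe_compress, ← htau, ← ht, sub_self]
    rfl
  have hrho : rho L R = 0 := by
    have hinj : LinearMap.ker (T - compress P (tauG0 y)) = ⊥ :=
      (LinearMap.isUnit_iff_ker_eq_bot _).mp
        ((LinearMap.isUnit_iff_isUnit_det _).mpr (isUnit_iff_ne_zero.mpr hd))
    exact congrArg Subtype.val ((LinearMap.ker_eq_bot'.mp hinj) _ hker)
  refine hx (Lp.ext ?_)
  filter_upwards [hG, Lp.coeFn_zero C2 2 (volume : Measure ℝ)] with t h1 h2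
  rw [h1, h2, hrho]
  ext s
  simp [G0]

end

/-! ### One point, with `Π = 1` -/

/-- For `n = 1` and `Π = 1`, the space `ran Π` is `ℂ²`. -/
def ranOneEquiv : Ran (1 : Bdry 1 →L[ℂ] Bdry 1) ≃ₗ[ℂ] (Fin 2 → ℂ) where
  toFun x s := (x : Bdry 1) (0, s)
  invFun v := ⟨WithLp.toLp 2 fun p => v p.2, _, rfl⟩
  map_add' _ _ := rfl
  map_smul' _ _ := rfl
  left_inv x := by
    refine Subtype.ext ?_
    ext ⟨k, s⟩
    rw [Subsingleton.elim k 0]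
  right_inv _ := rfl

theorem ranOneEquiv_apply (x : Ran (1 : Bdry 1 →L[ℂ] Bdry 1)) (s : Fin 2) :
    ranOneEquiv x s = (x : Bdry 1) (0, s) := rfl

theorem compress_one_eq_conj (M : Matrix (Fin 2) (Fin 2) ℂ) :
    compress 1 (Matrix.toEuclideanCLM (𝕜 := ℂ) ((1 : Matrix (Fin 1) (Fin 1) ℂ) ⊗ₖ M)) =
      ranOneEquiv.symm.conj (Matrix.toLin' M) := by
  refine LinearMap.ext fun x => Subtype.ext ?_
  ext ⟨k, s⟩
  rw [Subsingleton.elim k 0]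
  change (Matrix.toEuclideanCLM (𝕜 := ℂ) ((1 : Matrix (Fin 1) (Fin 1) ℂ) ⊗ₖ M) (x : Bdry 1)) (0, s) =
    M.mulVec (ranOneEquiv x) s
  simp [Matrix.mulVec, dotProduct, Fintype.sum_prod_type, Matrix.kroneckerMap_apply,
    ranOneEquiv_apply]

theorem exists_eq_conj_toLin' (T : Module.End ℂ (Ran (1 : Bdry 1 →L[ℂ] Bdry 1))) :
    ∃ M : Matrix (Fin 2) (Fin 2) ℂ, T = ranOneEquiv.symm.conj (Matrix.toLin' M) :=
  ⟨LinearMap.toMatrix' (ranOneEquiv.conj T), by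
    rw [Matrix.toLin'_toMatrix']
    exact (LinearEquiv.symm_apply_apply ranOneEquiv.conj T).symm⟩

theorem inner_ranOne (x z : Ran (1 : Bdry 1 →L[ℂ] Bdry 1)) :
    ⟪x, z⟫_ℂ = ∑ s, ranOneEquiv z s * (starRingEnd ℂ) (ranOneEquiv x s) := by
  rw [Submodule.coe_inner, PiLp.inner_apply, Fintype.sum_prod_type]
  simp [ranOneEquiv_apply, RCLike.inner_apply]

theorem isSymmetric_conj_toLin'_iff (M : Matrix (Fin 2) (Fin 2) ℂ) :
    LinearMap.IsSymmetric (𝕜 := ℂ) (E := Ran (1 : Bdry 1 →L[ℂ] Bdry 1))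
      (ranOneEquiv.symm.conj (Matrix.toLin' M)) ↔
      ∀ i j, (starRingEnd ℂ) (M i j) = M j i := by
  have e : ∀ x, ranOneEquiv (ranOneEquiv.symm.conj (Matrix.toLin' M) x) =
      M.mulVec (ranOneEquiv x) := fun x => rfl
  constructor
  · intro h i j
    have := h (ranOneEquiv.symm (Pi.single j 1)) (ranOneEquiv.symm (Pi.single i 1))
    rw [inner_ranOne, inner_ranOne, e, e] at this
    simpa [Pi.single_apply, apply_ite (starRingEnd ℂ)] using this
  · intro h x z
    rw [inner_ranOne, inner_ranOne, e, e]
    have h00 := h 0 0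
    have h01 := h 0 1
    have h10 := h 1 0
    have h11 := h 1 1
    simp only [Matrix.mulVec, dotProduct, Fin.sum_univ_two, map_add, map_mul, h00, h01, h10, h11]
    ring

theorem isCouple_and_susyCondition_one_iff (T : Module.End ℂ (Ran (1 : Bdry 1 →L[ℂ] Bdry 1))) :
    IsCouple 1 T ∧ SusyCondition 1 T ↔ ∃ a b : ℝ, T = thetaAB a b := by
  obtain ⟨M, rfl⟩ := exists_eq_conj_toLin' T
  have hs : SusyCondition 1 (ranOneEquiv.symm.conj (Matrix.toLin' M)) ↔
      M * sigma2 + sigma2 * M = 0 := by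
    rw [SusyCondition, sigma2Sum, compress_one_eq_conj, one_mul, mul_one, sub_self]
    simp only [true_and]
    have : ranOneEquiv.symm.conj (Matrix.toLin' M) * ranOneEquiv.symm.conj (Matrix.toLin' sigma2) +
        ranOneEquiv.symm.conj (Matrix.toLin' sigma2) * ranOneEquiv.symm.conj (Matrix.toLin' M) =
        ranOneEquiv.symm.conj (Matrix.toLin' (M * sigma2 + sigma2 * M)) := by
      rw [map_add, map_add, Matrix.toLin'_mul, Matrix.toLin'_mul, LinearEquiv.conj_comp,
        LinearEquiv.conj_comp]
      rfl
    rw [this, LinearEquiv.map_eq_zero_iff, LinearEquiv.map_eq_zero_iff]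
  have hc : IsCouple 1 (ranOneEquiv.symm.conj (Matrix.toLin' M)) ↔
      ∀ i j, (starRingEnd ℂ) (M i j) = M j i := by
    rw [← isSymmetric_conj_toLin'_iff]
    exact ⟨fun h => h.2, fun h => ⟨IsStarProjection.one _, h⟩⟩
  have ht : ∀ a b : ℝ, ranOneEquiv.symm.conj (Matrix.toLin' M) = thetaAB a b ↔
      M = (b : ℂ) • sigma1 + (a : ℂ) • sigma3 := by
    intro a b
    rw [thetaAB, compress_one_eq_conj, EmbeddingLike.apply_eq_iff_eq, EmbeddingLike.apply_eq_iff_eq]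
  simp only [hs, hc, ht]
  constructor
  · rintro ⟨h1, h2⟩
    have h00 := congrFun (congrFun h2 0) 0
    have h01 := congrFun (congrFun h2 0) 1
    simp only [Matrix.add_apply, Matrix.mul_apply, Fin.sum_univ_two, Matrix.zero_apply] at h00 h01
    simp [sigma2] at h00 h01
    have e1 : M 1 0 = M 0 1 := by
      refine mul_left_cancel₀ Complex.I_ne_zero ?_
      linear_combination -h00
    have e2 : M 1 1 = -M 0 0 := by
      refine mul_left_cancel₀ Complex.I_ne_zero ?_
      linear_combination -h01
    obtain ⟨a, ha⟩ := Complex.conj_eq_iff_real.mp (h1 0 0)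
    obtain ⟨b, hb⟩ := Complex.conj_eq_iff_real.mp ((h1 0 1).trans e1)
    refine ⟨a, b, ?_⟩
    ext i j
    fin_cases i <;> fin_cases j <;> simp [sigma1, sigma3, e1, e2, ha, hb]
  · rintro ⟨a, b, rfl⟩
    refine ⟨fun i j => ?_, ?_⟩
    · fin_cases i <;> fin_cases j <;> simp [sigma1, sigma3]
    · ext i j
      fin_cases i <;> fin_cases j <;>
        simp [sigma1, sigma2, sigma3] <;> ring

theorem tauG0_one (y : Fin 1 → ℝ) : tauG0 y = Matrix.toEuclideanCLM (𝕜 := ℂ)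
    ((1 : Matrix (Fin 1) (Fin 1) ℂ) ⊗ₖ ((-(1 / 2) : ℂ) • sigma3)) := by
  rw [tauG0]
  congr 1
  ext ⟨k, s⟩ ⟨k', s'⟩
  rw [Subsingleton.elim k 0, Subsingleton.elim k' 0]
  fin_cases s <;> fin_cases s' <;> simp [g0, sigma3, Matrix.kroneckerMap_apply] <;>
    field_simp <;> simp

theorem det_thetaAB_sub (y : Fin 1 → ℝ) (a b : ℝ) :
    LinearMap.det (thetaAB a b - compress 1 (tauG0 y)) = -((b ^ 2 + (a + 1 / 2) ^ 2 : ℝ) : ℂ) := by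
  rw [thetaAB, tauG0_one, compress_one_eq_conj, compress_one_eq_conj, ← map_sub, ← map_sub,
    LinearEquiv.conj_apply, LinearMap.comp_assoc]
  rw [show ranOneEquiv.symm.symm = ranOneEquiv from rfl]
  have := LinearMap.det_conj (Matrix.toLin' ((b : ℂ) • sigma1 + (a : ℂ) • sigma3 -
    (-(1 / 2) : ℂ) • sigma3)) ranOneEquiv.symm
  refine this.trans ?_
  rw [LinearMap.det_toLin', Matrix.det_fin_two]
  simp [sigma1, sigma3]
  ring

theorem det_thetaAB_sub_eq_zero_iff (y : Fin 1 → ℝ) (a b : ℝ) :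
    LinearMap.det (thetaAB a b - compress 1 (tauG0 y)) = 0 ↔ b = 0 ∧ a = -1 / 2 := by
  rw [det_thetaAB_sub, neg_eq_zero, Complex.ofReal_eq_zero]
  constructor
  · intro h
    have h1 : b = 0 := by nlinarith [sq_nonneg b, sq_nonneg (a + 1 / 2)]
    have h2 : a + 1 / 2 = 0 := by nlinarith [sq_nonneg b, sq_nonneg (a + 1 / 2)]
    exact ⟨h1, by linarith⟩
  · rintro ⟨rfl, rfl⟩
    norm_num

end DiracPoint

theorem mainTheorem9 :
    (∀ (n : ℕ) (y : Fin n → ℝ), StrictMono y →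
      ∀ (P : DiracPoint.Bdry n →L[ℂ] DiracPoint.Bdry n)
        (T : Module.End ℂ (DiracPoint.Ran P)), DiracPoint.IsCouple P T →
      DiracPoint.SusyCondition P T →
        DiracPoint.IsCouple (DiracPoint.hatPi P) (DiracPoint.hatTheta P T) ∧
        DiracPoint.IsSupersymmetric (DiracPoint.susyHamiltonian y P T)
          (DiracPoint.mulL2 DiracPoint.sigma2) (DiracPoint.diracOp y P T) ∧
        (LinearMap.det (T - DiracPoint.compress P (DiracPoint.tauG0 y)) ≠ 0 →
          ¬ DiracPoint.HasEigenvalue (DiracPoint.diracOp y P T) 0 ∧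
          DiracPoint.IsSpontaneouslyBroken (DiracPoint.susyHamiltonian y P T)
            (DiracPoint.mulL2 DiracPoint.sigma2) (DiracPoint.diracOp y P T))) ∧
    (∀ T : Module.End ℂ (DiracPoint.Ran (1 : DiracPoint.Bdry 1 →L[ℂ] DiracPoint.Bdry 1)),
      DiracPoint.IsCouple 1 T ∧ DiracPoint.SusyCondition 1 T ↔
        ∃ a b : ℝ, T = DiracPoint.thetaAB a b) ∧
    (∀ (y : Fin 1 → ℝ) (a b : ℝ),
      (LinearMap.det (DiracPoint.thetaAB a b - DiracPoint.compress 1 (DiracPoint.tauG0 y)) = 0 ↔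
        b = 0 ∧ a = -1 / 2) ∧
      ((a, b) ≠ (-1 / 2, 0) →
        ¬ DiracPoint.HasEigenvalue (DiracPoint.diracOp y 1 (DiracPoint.thetaAB a b)) 0 ∧
        DiracPoint.IsSpontaneouslyBroken
          (DiracPoint.susyHamiltonian y 1 (DiracPoint.thetaAB a b))
          (DiracPoint.mulL2 DiracPoint.sigma2)
          (DiracPoint.diracOp y 1 (DiracPoint.thetaAB a b)))) := by
  refine ⟨fun n y hy P T hc hs => ⟨hc.hat, DiracPoint.isSupersymmetric hy.injective hc hs,
    fun hd => ?_⟩, DiracPoint.isCouple_and_susyCondition_one_iff, fun y a b =>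
    ⟨DiracPoint.det_thetaAB_sub_eq_zero_iff y a b, fun hab => ?_⟩⟩
  · have h0 := DiracPoint.not_hasEigenvalue_zero hy.injective hd
    exact ⟨h0, DiracPoint.IsSupersymmetric.isSpontaneouslyBroken
      (DiracPoint.isSupersymmetric hy.injective hc hs) h0⟩
  · have hy := Function.injective_of_subsingleton y
    obtain ⟨hc, hs⟩ := (DiracPoint.isCouple_and_susyCondition_one_iff _).mpr ⟨a, b, rfl⟩
    have h0 := DiracPoint.not_hasEigenvalue_zero (T := DiracPoint.thetaAB a b) hy fun hd => hab (by
      obtain ⟨h1, h2⟩ := (DiracPoint.det_thetaAB_sub_eq_zero_iff y a b).mp hd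
      rw [h1, h2])
    exact ⟨h0, DiracPoint.IsSupersymmetric.isSpontaneouslyBroken (DiracPoint.isSupersymmetric hy hc hs) h0⟩
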